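/- Let $k$ be a field of characteristic zero. A variety is a reduced separated scheme of finite type over $k$. Let $X$ be a variety and $D$ a $\mathbb Q$-Weil divisor on $X$, i.e. a finite $\mathbb Q$-linear combination of irreducible closed subsets, each of codimension one in every irreducible component of $X$ that contains it. The pair $(X,D)$ is *snc* at $a\in X$ if a neighbourhood of $a$ in $X$ has a closed embedding in a smooth $Z$ with a regular system of coordinates $t_1,\dots,t_n$ at $a$ such that, near $a$, each irreducible component of $X$ is a coordinate subspace of $Z$ and $D=\sum_j\alpha_j\,(t_j=0)|_X$ with $\alpha_j\in\mathbb Q$, where only coordinates $t_j$ occur that vanish identically on no component of $X$ at $a$. For a blowing-up $\sigma:X'\to X$ with smooth centre $C\subset X$, the transform of $(X,D)$ is $(X',D')$, where $D'$ is the birational transform of $D$ (components of $D$ contained in $C$ are dropped) plus the divisor of $\sigma^{-1}(C)$. Consider the union of three smooth surfaces $$X=(z=x=0)\cup(z=y=0)\cup(z+xw=x+y=0)\subset\mathbb A^4_{w,x,y,z}.$$ 1. $(X,0)$ is snc at every point except the origin, where it is not snc. Hence the only nonempty smooth closed $C\subset X$ that contains no snc point is the origin (as a reduced point). 2. In the $w$-chart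 of the blowing-up of the origin of $\mathbb A^4$, with coordinates $(w,x/w,y/w,z/w)$, the strict transform of $X$ is given by the same equations as $X$, and the exceptional divisor is $(w=0)$. 3. Let $\sigma:X'\to X$ be the blowing-up of the origin of $X$. Its $w$-chart is an open copy of $X$ on which $\sigma$ is $(w,x,y,z)\mapsto(w,wx,wy,wz)$ and $\sigma^{-1}(0)=(w=0)$. If $D'$ denotes the divisor of $\sigma^{-1}(0)$, then $(X',D')$ is snc at every point except the origin of this chart, where it is not snc. 4. There is no finite sequence of blowings-up $X=X_0\leftarrow X_1\leftarrow\cdots\leftarrow X_t$, with smooth centres $C_j\subset X_j$ containing no snc point of $(X_j,D_j)$ (where $D_0=0$ and $(X_{j+1},D_{j+1})$ is the transform of $(X_j,D_j)$), such that $(X_t,D_t)$ is snc at every point. Consequently the following assertion is false: for every variety $X$ over $k$ and every $\mathbb Q$-Weil divisor $D$ on $X$, there is a finite sequence of blowings-up with smooth centres, each of which contains no snc point of the current transform of $(X,D)$, such that the last transform is snc at every point. -/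

import Mathlib

open CategoryTheory AlgebraicGeometry TopologicalSpace

universe u

noncomputable section

namespace SncBlowup

/-! ### Blowings-up -/

/-- An ideal sheaf is invertible if it is locally generated by one nonzerodivisor. -/
def IsInvertible {Y : Scheme.{u}} (I : Y.IdealSheafData) : Prop :=
  ∀ y : Y, ∃ U : Y.affineOpens, y ∈ U.1 ∧
    ∃ f ∈ nonZeroDivisors Γ(Y, U.1), I.ideal U = Ideal.span {f}

/-- `σ : B ⟶ Y` is the blowing-up of `Y` with centre the closed subscheme defined by `C`: the
inverse image ideal sheaf of `C` is invertible, and `σ` is universal with this property. -/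
structure IsBlowup {B Y : Scheme.{u}} (C : Y.IdealSheafData) (σ : B ⟶ Y) : Prop where
  invertible : IsInvertible (C.comap σ)
  universal : ∀ {T : Scheme.{u}} (g : T ⟶ Y), IsInvertible (C.comap g) →
    ∃! h : T ⟶ B, h ≫ σ = g

/-! ### Pairs `(X, D)` and their transforms -/

/-- A scheme over `k` with a `ℚ`-cycle `D`, given by its coefficients: `D η` is the coefficient of
the irreducible closed subset with generic point `η`. -/
structure Pair (k : Type u) [Field k] where
  /-- the underlying scheme -/
  X : Scheme.{u}
  /-- the structure morphism -/
  str : X ⟶ Spec (CommRingCat.of k)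
  /-- the coefficients of the cycle -/
  D : X → ℚ

/-- A (reduced) algebraic variety over `k`: a reduced separated scheme of finite type; it need be
neither irreducible nor equidimensional. -/
structure IsVariety {k : Type u} [Field k] {X : Scheme.{u}}
    (f : X ⟶ Spec (CommRingCat.of k)) : Prop where
  reduced : IsReduced X
  separated : IsSeparated f
  locallyOfFiniteType : LocallyOfFiniteType f
  quasiCompact : QuasiCompact f

/-- `D` is a `ℚ`-Weil divisor on `X`: a finite linear combination of irreducible closed subsets,
each of codimension one in every irreducible component of `X` that contains it. (The irreducible
components of `X` through `η` are the minimal primes of the local ring at `η`.) -/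
def IsQWeilDivisor (X : Scheme.{u}) (D : X → ℚ) : Prop :=
  (Function.support D).Finite ∧
    ∀ η : X, D η ≠ 0 → ∀ P ∈ minimalPrimes (X.presheaf.stalk η),
      ringKrullDim (X.presheaf.stalk η ⧸ P) = 1

open Classical in
/-- The coefficient at `b` of the divisor of the subscheme `E = σ⁻¹(C)` of `B`: the length of the
local ring of `E` at `b` if `b` is the generic point of an irreducible component of `E`, and zero
for all other points `b`. -/
def exceptionalCoeff {B Y : Scheme.{u}} (C : Y.IdealSheafData) (σ : B ⟶ Y) (b : B) : ℚ :=
  if h : ∃ e : (C.comap σ).subscheme, (C.comap σ).subschemeι e = b ∧ ∀ e', e' ⤳ e → e' = e then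
    ((Module.length ((C.comap σ).subscheme.presheaf.stalk h.choose)
      ((C.comap σ).subscheme.presheaf.stalk h.choose)).toNat : ℚ)
  else 0

open Classical in
/-- The transform of `D` by the blowing-up `σ` with centre `C`: the birational transform of `D`
(the closures of the inverse images of the components of `D` that are not contained in `C`) plus
the exceptional divisor `σ⁻¹(C)`. -/
def transform {B Y : Scheme.{u}} (C : Y.IdealSheafData) (σ : B ⟶ Y) (D : Y → ℚ) : B → ℚ :=
  fun b => if σ b ∈ C.support then exceptionalCoeff C σ b else D (σ b)

/-! ### Simple normal crossings -/

/-- `t` is a regular system of coordinates of the regular local ring `R`, i.e. a minimal system of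
generators of its maximal ideal. -/
def IsRegularSystem {R : Type*} [CommRing R] [IsLocalRing R] {n : ℕ} (t : Fin n → R) : Prop :=
  Ideal.span (Set.range t) = IsLocalRing.maximalIdeal R ∧
    n = (IsLocalRing.maximalIdeal R).spanFinrank

/-- `(X, D)` has simple normal crossings at `a`: a neighbourhood `U` of `a` in `X` has a closed
embedding `i` over `k` into a smooth `Z`, with a regular system of coordinates `t` of `Z` at `a`,
such that (near `a`) every irreducible component of `X` is a coordinate subspace of `Z`, and
`D = ∑ j, α j • (t j = 0)|_X`, where only coordinates `t j` occur that vanish identically on no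
irreducible component of `X` at `a`.
(The irreducible components of `X` through `a` correspond to the minimal primes of the local ring,
and the irreducible closed subsets through `a` to its primes `q`.) -/
def Pair.IsSncAt {k : Type u} [Field k] (P : Pair k) (a : P.X) : Prop :=
  ∃ (U : P.X.Opens) (ha : a ∈ U) (Z : Scheme.{u}) (g : Z ⟶ Spec (CommRingCat.of k))
    (i : U.toScheme ⟶ Z),
    Smooth g ∧ IsClosedImmersion i ∧ i ≫ g = U.ι ≫ P.str ∧
    ∃ (n : ℕ) (t : Fin n → Z.presheaf.stalk (i ⟨a, ha⟩)) (α : Fin n → ℚ),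
      IsRegularSystem t ∧
      (∀ p ∈ minimalPrimes (U.toScheme.presheaf.stalk ⟨a, ha⟩),
        ∃ I : Set (Fin n), p.comap (i.stalkMap ⟨a, ha⟩).hom = Ideal.span (t '' I)) ∧
      (∀ j, α j ≠ 0 → ∀ p ∈ minimalPrimes (U.toScheme.presheaf.stalk ⟨a, ha⟩),
        (i.stalkMap ⟨a, ha⟩).hom (t j) ∉ p) ∧
      ∀ q : PrimeSpectrum (U.toScheme.presheaf.stalk ⟨a, ha⟩),
        P.D (U.ι (U.toScheme.fromSpecStalk ⟨a, ha⟩ q)) =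
          ∑ j, open Classical in
            if q.asIdeal ∈ (Ideal.span {(i.stalkMap ⟨a, ha⟩).hom (t j)}).minimalPrimes
            then α j else 0

/-! ### Desingularization preserving a class of singularities -/

/-- A permissible centre, for a class `good` of points of pairs: a smooth closed subscheme of `X`
none of whose points is good. (The empty centre is allowed.) -/
def IsPermissibleCentre {k : Type u} [Field k] (good : ∀ P : Pair k, P.X → Prop)
    (P : Pair k) (C : P.X.IdealSheafData) : Prop :=
  Smooth (C.subschemeι ≫ P.str) ∧ ∀ a : P.X, a ∈ C.support → ¬ good P a

/-- `P'` is the transform of `P` by a blowing-up with permissible centre. -/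
def IsPermissibleTransform {k : Type u} [Field k] (good : ∀ P : Pair k, P.X → Prop)
    (P P' : Pair k) : Prop :=
  ∃ (C : P.X.IdealSheafData) (σ : P'.X ⟶ P.X), IsPermissibleCentre good P C ∧
    IsBlowup C σ ∧ σ ≫ P.str = P'.str ∧ P'.D = transform C σ P.D

/-- There is a finite sequence of blowings-up with smooth centres which contain no good points, such
that the last transform of `P` is good at every point. -/
def IsResolvable {k : Type u} [Field k] (good : ∀ P : Pair k, P.X → Prop) (P : Pair k) : Prop :=
  ∃ P' : Pair k, Relation.ReflTransGen (IsPermissibleTransform good) P P' ∧ ∀ a, good P' a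

/-- The desingularization theorem for the class `good`: it holds for every pair `(X, D)` of a
(reduced) variety over `k` and a `ℚ`-Weil divisor. -/
def DesingularizationTheorem (k : Type u) [Field k] (good : ∀ P : Pair k, P.X → Prop) : Prop :=
  ∀ P : Pair k, IsVariety P.str → IsQWeilDivisor P.X P.D → IsResolvable good P

/-! ### The variety `X ⊆ 𝔸⁴` with coordinates `(w, x, y, z)` -/

section Example

variable (k : Type u) [Field k]

/-- The coordinate ring `k[w, x, y, z]` of `𝔸⁴`. -/
abbrev A : Type u := MvPolynomial (Fin 4) k

/-- The coordinate function `w`; the next three are `x`, `y`, `z`. -/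
abbrev w : A k := MvPolynomial.X 0
abbrev x : A k := MvPolynomial.X 1
abbrev y : A k := MvPolynomial.X 2
abbrev z : A k := MvPolynomial.X 3

/-- The ideal of `X = (z = x = 0) ∪ (z = y = 0) ∪ (z + xw = x + y = 0)`. -/
def idealX : Ideal (A k) :=
  Ideal.span {z k, x k} ⊓ Ideal.span {z k, y k} ⊓ Ideal.span {z k + x k * w k, x k + y k}

/-- The affine space `𝔸⁴` with coordinates `(w, x, y, z)`. -/
abbrev A4 : Scheme.{u} := Spec (CommRingCat.of (A k))

/-- The coordinate ring of `X`. -/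
abbrev RX : Type u := A k ⧸ idealX k

/-- The variety `X`. -/
abbrev X : Scheme.{u} := Spec (CommRingCat.of (RX k))

/-- The inclusion of `X` in `𝔸⁴`. -/
def incl : X k ⟶ A4 k := Spec.map (CommRingCat.ofHom (Ideal.Quotient.mk (idealX k)))

/-- The structure morphism of `X`. -/
def strX : X k ⟶ Spec (CommRingCat.of k) := Spec.map (CommRingCat.ofHom (algebraMap k (RX k)))

/-- The pair `(X, 0)`. -/
def pairX : Pair k := ⟨X k, strX k, fun _ => 0⟩

/-- The ideal sheaf on `Spec R` given by an ideal of `R`. -/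
def sheafOf {R : Type u} [CommRing R] (J : Ideal R) :
    (Spec (CommRingCat.of R)).IdealSheafData :=
  (Spec.map (CommRingCat.ofHom (Ideal.Quotient.mk J))).ker

/-- The ideal of the origin of `𝔸⁴`. -/
def originIdealA4 : Ideal (A k) := Ideal.span {w k, x k, y k, z k}

/-- The ideal of the origin in the coordinate ring of `X`. -/
def originIdealX : Ideal (RX k) := (originIdealA4 k).map (Ideal.Quotient.mk (idealX k))

/-- The substitution `w ↦ w, x ↦ w x, y ↦ w y, z ↦ w z`, that is, the blowing-up of the origin
in the `w`-chart with coordinates `(w, x/w, y/w, z/w)`. -/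
def chartHom : A k →ₐ[k] A k :=
  MvPolynomial.aeval ![w k, w k * x k, w k * y k, w k * z k]

lemma idealX_le_comap : idealX k ≤ (idealX k).comap (chartHom k).toRingHom := by
  have hw : chartHom k (w k) = w k := by simp [chartHom]
  have hx : chartHom k (x k) = w k * x k := by simp [chartHom]
  have hy : chartHom k (y k) = w k * y k := by simp [chartHom]
  have hz : chartHom k (z k) = w k * z k := by simp [chartHom]
  have key : ∀ a b : A k, chartHom k a = w k * a → chartHom k b = w k * b →
      Ideal.span {a, b} ≤ (Ideal.span {a, b}).comap (chartHom k).toRingHom := by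
    intro a b ha hb
    rw [Ideal.span_le]
    intro c hc
    have hc' : chartHom k c = w k * c := by
      rcases hc with rfl | rfl
      · exact ha
      · exact hb
    change chartHom k c ∈ Ideal.span {a, b}
    rw [hc']
    exact Ideal.mul_mem_left _ _ (Ideal.subset_span hc)
  rintro f ⟨⟨h1, h2⟩, h3⟩
  refine ⟨⟨key _ _ hz hx h1, key _ _ hz hy h2⟩, key _ _ ?_ ?_ h3⟩
  · rw [map_add, map_mul, hz, hx, hw]; ring
  · rw [map_add, hx, hy]; ring

/-- The chart map `(w, x, y, z) ↦ (w, w x, w y, w z)` of `𝔸⁴`. -/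
def chartA4 : A4 k ⟶ A4 k := Spec.map (CommRingCat.ofHom (chartHom k).toRingHom)

/-- The chart map `(w, x, y, z) ↦ (w, w x, w y, w z)` from `X` to `X`. -/
def chartX : X k ⟶ X k :=
  Spec.map (CommRingCat.ofHom
    (Ideal.quotientMap (idealX k) (chartHom k).toRingHom (idealX_le_comap k)))

/-- The strict transform of `X` by a morphism `π` to `𝔸⁴` (the blowing-up of the origin): the
reduced closed subscheme carried by the closure of the inverse image of `X` minus the origin. -/
def strictTransform {B : Scheme.{u}} (π : B ⟶ A4 k) : B.IdealSheafData :=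
  Scheme.IdealSheafData.vanishingIdeal
    (Closeds.closure (π ⁻¹' (((sheafOf (idealX k)).support : Set (A4 k)) \
      ((sheafOf (originIdealA4 k)).support : Set (A4 k)))))

end Example

end SncBlowup

end

/-! The blowing-up of the origin reproduces the singularity it is meant to remove. With `w` as a
parameter, the four equations of `X` are homogeneous in `x`, `y`, `z`, so the substitution `(w, w x,
w y, w z)` multiplies each of them by a power of `w`, and the `w`-chart of the blowing-up is `X`
again. The proof therefore carries an invariant along any permissible tower: `IsCopy P c α` says
that `P` contains an open copy of `X` on which the cycle is `α (w = 0)`.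

A copy is snc at every point other than its origin. Off the `w`-axis the three planes are disjoint
and smooth, and the cycle is a multiple of a coordinate line (`isSncAt_plane`). On the axis away
from the origin `w` is a unit, so `z`, `z + x w`, `z - y w` are part of a regular system, and each
plane is cut out by two of them (`isSncAt_axis`).

The origin is never snc, whatever the cycle (`not_isSncSystem_origin`). Look at the derivatives in
`x` and `y` only. The ideals of the three planes then have linear parts in the lines spanned by
`dx`, `dy` and `dx + dy`, three distinct lines of a plane. If all three ideals were generated by
members of one regular system, a member used by two of them would have zero derivative, and
minimality of the system would make the relation `x + y - (x + y) = 0` impossible.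

Hence a permissible centre meets the copy at most in its origin. Being smooth, it is there empty or
the reduced point (`ker_eq_bot_of_formallySmooth`). In the first case the copy lifts unchanged; in
the second the `w`-chart is a copy with `α = 1`. By induction every pair of the tower contains a
copy of `X`, and so a point that is not snc.

Blowings-up are handled through their universal property. `IsBlowupChart` is its version for rings,
and `IsBlowupChart.exists_openImmersion_of_Spec` shows that such a ring is an open part of any
blowing-up. For the first blowing-up `X'` it must also be known that nothing else fails to be snc
outside the `w`-chart. By `exists_generates` the rest is covered by the charts where two of `x`,
`y`, `x + y` generate the exceptional ideal. There only one plane survives, and the chart is one of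
the blowing-up of a point of a plane. -/

noncomputable section

namespace SncBlowup

/-! ### Ideal sheaves on affine schemes -/

/-- The ideal of `R` given by an ideal sheaf on `Spec R`. -/
def idealOf {R : Type u} [CommRing R] (I : (Spec (CommRingCat.of R)).IdealSheafData) : Ideal R :=
  (I.ideal ⟨⊤, isAffineOpen_top _⟩).comap (Scheme.ΓSpecIso (CommRingCat.of R)).inv.hom

lemma ker_Spec_map {R S : Type u} [CommRing R] [CommRing S] (φ : R →+* S) :
    idealOf (Spec.map (CommRingCat.ofHom φ)).ker = RingHom.ker φ := by
  rw [idealOf, Scheme.Hom.ker_apply]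
  ext a
  simp only [Ideal.mem_comap, RingHom.mem_ker]
  have h := ConcreteCategory.congr_hom
    (Scheme.ΓSpecIso_inv_naturality (CommRingCat.ofHom φ)) a
  change (ConcreteCategory.hom ((Scheme.ΓSpecIso (CommRingCat.of R)).inv ≫
    Scheme.Hom.appTop (Spec.map (CommRingCat.ofHom φ)))) a = 0 ↔ _
  rw [← h, CommRingCat.comp_apply, map_eq_zero_iff _
    (ConcreteCategory.bijective_of_isIso (Scheme.ΓSpecIso (CommRingCat.of S)).inv).1]
  rfl

lemma idealOf_sheafOf {R : Type u} [CommRing R] (J : Ideal R) : idealOf (sheafOf J) = J := by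
  rw [sheafOf, ker_Spec_map, Ideal.mk_ker]

lemma idealOf_le_iff {R : Type u} [CommRing R]
    {I I' : (Spec (CommRingCat.of R)).IdealSheafData} : idealOf I ≤ idealOf I' ↔ I ≤ I' := by
  constructor
  · intro h
    refine Scheme.IdealSheafData.le_of_isAffine ?_
    rwa [idealOf, idealOf, Ideal.comap_le_comap_iff_of_surjective] at h
    exact (ConcreteCategory.bijective_of_isIso (Scheme.ΓSpecIso (CommRingCat.of R)).inv).2
  · intro h
    exact Ideal.comap_mono (h _)

lemma idealOf_injective {R : Type u} [CommRing R] :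
    Function.Injective (idealOf (R := R)) := fun _ _ h =>
  le_antisymm (idealOf_le_iff.mp h.le) (idealOf_le_iff.mp h.ge)

lemma sheafOf_idealOf {R : Type u} [CommRing R]
    (I : (Spec (CommRingCat.of R)).IdealSheafData) : sheafOf (idealOf I) = I :=
  idealOf_injective (idealOf_sheafOf _)

lemma sheafOf_le_iff {R : Type u} [CommRing R] {J K : Ideal R} :
    sheafOf J ≤ sheafOf K ↔ J ≤ K := by
  rw [← idealOf_le_iff, idealOf_sheafOf, idealOf_sheafOf]

lemma ker_Spec_map_eq {R S : Type u} [CommRing R] [CommRing S] (φ : R →+* S) :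
    (Spec.map (CommRingCat.ofHom φ)).ker = sheafOf (RingHom.ker φ) :=
  idealOf_injective (by rw [ker_Spec_map, idealOf_sheafOf])

lemma sheafOf_top {R : Type u} [CommRing R] : sheafOf (⊤ : Ideal R) = ⊤ := by
  rw [eq_top_iff, ← sheafOf_idealOf ⊤, sheafOf_le_iff]
  exact le_top

lemma map_sheafOf {R S : Type u} [CommRing R] [CommRing S] (φ : R →+* S) (K : Ideal S) :
    (sheafOf K).map (Spec.map (CommRingCat.ofHom φ)) = sheafOf (K.comap φ) := by
  rw [sheafOf, Scheme.IdealSheafData.map_ker, ← Spec.map_comp, ← CommRingCat.ofHom_comp,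
    ker_Spec_map_eq]
  congr 1
  ext a
  simp [RingHom.mem_ker, Ideal.Quotient.eq_zero_iff_mem]

/-- Inverse image of ideal sheaves is left adjoint to direct image, and extension of ideals is left
adjoint to contraction; the claim follows from `map_sheafOf`. -/
lemma comap_sheafOf {R S : Type u} [CommRing R] [CommRing S] (φ : R →+* S) (J : Ideal R) :
    (sheafOf J).comap (Spec.map (CommRingCat.ofHom φ)) = sheafOf (J.map φ) := by
  refine eq_of_forall_ge_iff fun I => ?_
  rw [← Scheme.IdealSheafData.le_map_iff_comap_le, ← sheafOf_idealOf I, map_sheafOf,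
    sheafOf_le_iff, sheafOf_le_iff, Ideal.map_le_iff_le_comap]

lemma mem_support_sheafOf {R : Type u} [CommRing R] (J : Ideal R)
    (p : Spec (CommRingCat.of R)) : p ∈ (sheafOf J).support ↔ J ≤ p.asIdeal := by
  have h : ((sheafOf J).support : Set (Spec (CommRingCat.of R))) = PrimeSpectrum.zeroLocus J := by
    rw [sheafOf, Scheme.Hom.support_ker]
    have : Set.range (Spec.map (CommRingCat.ofHom (Ideal.Quotient.mk J))) =
        PrimeSpectrum.zeroLocus (J : Set R) := by
      have := range_comap_of_surjective (R ⧸ J) (Ideal.Quotient.mk J)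
        Ideal.Quotient.mk_surjective
      rw [Ideal.mk_ker] at this
      exact this
    rw [this]
    exact (PrimeSpectrum.isClosed_zeroLocus _).closure_eq
  exact Set.ext_iff.mp h p

/-! ### Sections and germs of functions on `Spec R` along a morphism to `Spec R` -/

section Pullback

variable {R : Type u} [CommRing R] {T : Scheme.{u}} (g : T ⟶ Spec (CommRingCat.of R))

/-- Pullback of functions on `Spec R` to sections over `U`. -/
def secHom (U : T.Opens) : R →+* Γ(T, U) :=
  ((Scheme.ΓSpecIso (CommRingCat.of R)).inv ≫ g.appTop ≫
    T.presheaf.map (homOfLE le_top : U ⟶ ⊤).op).hom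

/-- Pullback of functions on `Spec R` to germs at `b`. -/
def germHom (b : T) : R →+* T.presheaf.stalk b :=
  (T.presheaf.germ ⊤ b trivial).hom.comp (secHom g ⊤)

lemma map_secHom {U V : T.Opens} (i : Opposite.op U ⟶ Opposite.op V) (r : R) :
    (T.presheaf.map i).hom (secHom g U r) = secHom g V r := by
  simp only [secHom]
  rw [← CommRingCat.comp_apply, Category.assoc, Category.assoc, ← T.presheaf.map_comp]
  rfl

lemma germ_secHom (U : T.Opens) (b : T) (hb : b ∈ U) (r : R) :
    (T.presheaf.germ U b hb).hom (secHom g U r) = germHom g b r := by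
  rw [germHom, RingHom.comp_apply, ← map_secHom g (homOfLE le_top : U ⟶ ⊤).op,
    ← CommRingCat.comp_apply, T.presheaf.germ_res]

lemma germ_comp_secHom (U : T.Opens) (b : T) (hb : b ∈ U) :
    (T.presheaf.germ U b hb).hom.comp (secHom g U) = germHom g b :=
  RingHom.ext (germ_secHom g U b hb)

lemma toSpecΓ_comp_appTop : g = T.toSpecΓ ≫ Spec.map g.appTop ≫
    Spec.map (Scheme.ΓSpecIso (CommRingCat.of R)).inv := by
  rw [← Scheme.toSpecΓ_naturality_assoc, ← SpecMap_ΓSpecIso_hom, ← Spec.map_comp]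
  simp

lemma secHom_top :
    secHom g ⊤ = ((Scheme.ΓSpecIso (CommRingCat.of R)).inv ≫ g.appTop).hom := by
  have h : T.presheaf.map (homOfLE le_top : (⊤ : T.Opens) ⟶ ⊤).op = 𝟙 _ := T.presheaf.map_id _
  rw [secHom, h, Category.comp_id]

/-- Morphisms to an affine scheme are ring homomorphisms to the global sections, so a factorization
of rings gives one of morphisms, with no affineness assumed of `T`. -/
lemma exists_comp_eq_of_secHom {R' : Type u} [CommRing R'] {ψ : R →+* R'} {χ : R' →+* Γ(T, ⊤)}
    (hχ : χ.comp ψ = secHom g ⊤) : ∃ h : T ⟶ Spec (CommRingCat.of R'),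
      h ≫ Spec.map (CommRingCat.ofHom ψ) = g := by
  refine ⟨T.toSpecΓ ≫ Spec.map (CommRingCat.ofHom χ), ?_⟩
  conv_rhs => rw [toSpecΓ_comp_appTop g]
  rw [Category.assoc, ← Spec.map_comp, ← Spec.map_comp, ← CommRingCat.ofHom_comp, hχ, secHom_top,
    CommRingCat.ofHom_hom]

lemma fromSpec_comp {U : T.Opens} (hU : IsAffineOpen U) :
    hU.fromSpec ≫ g = Spec.map (CommRingCat.ofHom (secHom g U)) := by
  conv_lhs => rw [toSpecΓ_comp_appTop g]
  rw [hU.fromSpec_toSpecΓ_assoc, ← Spec.map_comp, ← Spec.map_comp]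
  congr 1

lemma appIso_fromSpec {U : T.Opens} (hU : IsAffineOpen U) (h : U = hU.fromSpec ''ᵁ ⊤) :
    T.presheaf.map (eqToHom h.symm).op ≫ (hU.fromSpec.appIso ⊤).hom =
      (Scheme.ΓSpecIso Γ(T, U)).inv := by
  rw [Scheme.Hom.appIso_hom', Scheme.Hom.map_appLE, Scheme.Hom.appLE, hU.fromSpec_app_self,
    Category.assoc, ← Functor.map_comp]
  exact (congrArg _ ((Spec Γ(T, U)).presheaf.map_id _)).trans (Category.comp_id _)

lemma idealOf_comap_fromSpec (I : T.IdealSheafData) {U : T.Opens} (hU : IsAffineOpen U) :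
    idealOf (I.comap hU.fromSpec) = I.ideal ⟨U, hU⟩ := by
  have h : U = hU.fromSpec ''ᵁ ⊤ := by
    rw [Scheme.Hom.image_top_eq_opensRange, hU.opensRange_fromSpec]
  have h2 : (Scheme.ΓSpecIso Γ(T, U)).inv ≫ (hU.fromSpec.appIso ⊤).inv =
      T.presheaf.map (eqToHom h.symm).op := by
    rw [← appIso_fromSpec hU h, Category.assoc, Iso.hom_inv_id, Category.comp_id]
  rw [idealOf, Scheme.IdealSheafData.ideal_comap_of_isOpenImmersion, Ideal.comap_comap]
  change Ideal.comap ((Scheme.ΓSpecIso Γ(T, U)).inv ≫ (hU.fromSpec.appIso ⊤).inv).hom _ = _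
  rw [h2, ← I.map_ideal' (U := ⟨_, (isAffineOpen_top _).image_of_isOpenImmersion hU.fromSpec⟩)
    (V := ⟨U, hU⟩) (eqToHom h.symm).op]
  exact Ideal.comap_map_of_bijective _
    (ConcreteCategory.bijective_of_isIso (T.presheaf.map (eqToHom h.symm).op))

/-- This turns invertibility of an inverse image ideal sheaf into a statement about extended ideals
in rings of sections. -/
lemma ideal_comap_sheafOf (J : Ideal R) {U : T.Opens} (hU : IsAffineOpen U) :
    ((sheafOf J).comap g).ideal ⟨U, hU⟩ = J.map (secHom g U) := by
  have h := idealOf_comap_fromSpec ((sheafOf J).comap g) hU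
  rw [← Scheme.IdealSheafData.comap_comp, fromSpec_comp] at h
  rw [← h, comap_sheafOf]
  exact idealOf_sheafOf _

end Pullback

/-! ### Sections whose germs are nonzerodivisors -/

lemma germ_mem_nonZeroDivisors {T : Scheme.{u}} {U : T.Opens} (hU : IsAffineOpen U)
    {s : Γ(T, U)} (hs : s ∈ nonZeroDivisors Γ(T, U)) (b : T) (hb : b ∈ U) :
    (T.presheaf.germ U b hb).hom s ∈ nonZeroDivisors (T.presheaf.stalk b) := by
  let := TopCat.Presheaf.algebra_section_stalk T.presheaf (⟨b, hb⟩ : U)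
  have := hU.isLocalization_stalk ⟨b, hb⟩
  exact IsLocalization.map_nonZeroDivisors_le (hU.primeIdealOf ⟨b, hb⟩).asIdeal.primeCompl _ ⟨s, hs, rfl⟩

lemma mem_nonZeroDivisors_of_germ {T : Scheme.{u}} {U : T.Opens}
    {s : Γ(T, U)} (hs : ∀ b (hb : b ∈ U), (T.presheaf.germ U b hb).hom s ∈
      nonZeroDivisors (T.presheaf.stalk b)) : s ∈ nonZeroDivisors Γ(T, U) := by
  rw [mem_nonZeroDivisors_iff_right]
  intro x hx
  refine TopCat.Presheaf.section_ext T.sheaf U x 0 fun b hb => ?_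
  have h := congrArg (T.presheaf.germ U b hb).hom hx
  rw [map_mul, map_zero] at h
  have := (mem_nonZeroDivisors_iff_right.mp (hs b hb)) _ h
  change (T.presheaf.germ U b hb).hom x = (T.presheaf.germ U b hb).hom 0
  rw [this, map_zero]

/-! ### Invertible ideal sheaves -/

/-- The germ of `f` at `b` is a nonzerodivisor which generates the inverse image of `J`. -/
def GeneratesAt {R : Type u} [CommRing R] {T : Scheme.{u}} (g : T ⟶ Spec (CommRingCat.of R))
    (J : Ideal R) (f : R) (b : T) : Prop :=
  germHom g b f ∈ nonZeroDivisors (T.presheaf.stalk b) ∧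
    J.map (germHom g b) = Ideal.span {germHom g b f}

lemma map_mem_nonZeroDivisors_iff_of_bijective {S S' : Type*} [CommRing S] [CommRing S']
    (e : S →+* S') (he : Function.Bijective e) {s : S} :
    e s ∈ nonZeroDivisors S' ↔ s ∈ nonZeroDivisors S := by
  simp only [mem_nonZeroDivisors_iff_right]
  refine ⟨fun hs x hx => ?_, fun hs x hx => ?_⟩
  · rw [← map_eq_zero_iff _ he.1]
    exact hs _ (by rw [← map_mul, hx, map_zero])
  · obtain ⟨x, rfl⟩ := he.2 x
    rw [← map_mul, map_eq_zero_iff _ he.1] at hx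
    rw [hs _ hx, map_zero]

lemma mem_nonZeroDivisors_map_of_bijective {S S' : Type*} [CommRing S] [CommRing S']
    (e : S →+* S') (he : Function.Bijective e) {s : S} (hs : s ∈ nonZeroDivisors S) :
    e s ∈ nonZeroDivisors S' :=
  (map_mem_nonZeroDivisors_iff_of_bijective e he).mpr hs

lemma restrict_mem_nonZeroDivisors {T : Scheme.{u}} {U V : T.Opens} (hU : IsAffineOpen U)
    (h : Opposite.op U ⟶ Opposite.op V) {s : Γ(T, U)} (hs : s ∈ nonZeroDivisors Γ(T, U)) :
    (T.presheaf.map h).hom s ∈ nonZeroDivisors Γ(T, V) := by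
  refine mem_nonZeroDivisors_of_germ fun b hb => ?_
  have := germ_mem_nonZeroDivisors hU hs b (h.unop.le hb)
  rwa [← T.presheaf.germ_res h.unop b hb, CommRingCat.comp_apply] at this

lemma IsInvertible.comap_of_isOpenImmersion {V T : Scheme.{u}} {I : T.IdealSheafData}
    (hI : IsInvertible I) (j : V ⟶ T) [IsOpenImmersion j] : IsInvertible (I.comap j) := by
  intro v
  obtain ⟨U, hvU, f, hf, hfI⟩ := hI (j v)
  obtain ⟨W, hW, hvW, hWU⟩ := V.isBasis_affineOpens.exists_subset_of_mem_open
    (show v ∈ ((j ⁻¹ᵁ U.1 : V.Opens) : Set V) from hvU) (j ⁻¹ᵁ U.1).isOpen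
  obtain ⟨W, hW, rfl⟩ := hW
  have hle : j ''ᵁ W ≤ U.1 := by
    rintro _ ⟨x, hx, rfl⟩
    exact hWU hx
  let i : Opposite.op U.1 ⟶ Opposite.op (j ''ᵁ W) := (homOfLE hle).op
  have hb : Function.Bijective (j.appIso W).hom.hom :=
    ConcreteCategory.bijective_of_isIso (j.appIso W).hom
  refine ⟨⟨W, hW⟩, hvW, (j.appIso W).hom.hom ((T.presheaf.map i).hom f),
    mem_nonZeroDivisors_map_of_bijective _ hb (restrict_mem_nonZeroDivisors U.2 i hf), ?_⟩
  rw [Scheme.IdealSheafData.ideal_comap_of_isOpenImmersion,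
    ← I.map_ideal' (U := ⟨_, hW.image_of_isOpenImmersion j⟩) (V := U) i, hfI, Ideal.map_span,
    Set.image_singleton]
  refine Eq.trans ?_ (Eq.trans (Ideal.map_span (j.appIso W).hom.hom _) (by rw [Set.image_singleton]))
  exact (Ideal.map_comap_of_equiv (j.appIso W).commRingCatIsoToRingEquiv).symm

lemma bijective_secHom_id (R : Type u) [CommRing R] :
    Function.Bijective (secHom (𝟙 (Spec (CommRingCat.of R))) ⊤) := by
  have h : secHom (𝟙 (Spec (CommRingCat.of R))) ⊤ =
      (Scheme.ΓSpecIso (CommRingCat.of R)).inv.hom := by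
    rw [secHom_top, Scheme.Hom.id_appTop, Category.comp_id]
  rw [h]
  exact ConcreteCategory.bijective_of_isIso (Scheme.ΓSpecIso (CommRingCat.of R)).inv

lemma isInvertible_sheafOf_span {R : Type u} [CommRing R] {f : R} (hf : f ∈ nonZeroDivisors R) :
    IsInvertible (sheafOf (Ideal.span {f})) := by
  intro b
  refine ⟨⟨⊤, isAffineOpen_top _⟩, trivial, secHom (𝟙 _) ⊤ f,
    mem_nonZeroDivisors_map_of_bijective _ (bijective_secHom_id R) hf, ?_⟩
  have := ideal_comap_sheafOf (𝟙 (Spec (CommRingCat.of R))) (Ideal.span {f}) (isAffineOpen_top _)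
  rwa [Scheme.IdealSheafData.comap_id, Ideal.map_span, Set.image_singleton] at this

section Generators

variable {R : Type u} [CommRing R] {T : Scheme.{u}} {g : T ⟶ Spec (CommRingCat.of R)}
  {J : Ideal R}

lemma exists_local_generator (hg : IsInvertible ((sheafOf J).comap g)) (b : T) :
    ∃ U : T.Opens, b ∈ U ∧ ∃ s : Γ(T, U), J.map (secHom g U) = Ideal.span {s} ∧
      ∀ b' (hb' : b' ∈ U), (T.presheaf.germ U b' hb').hom s ∈
        nonZeroDivisors (T.presheaf.stalk b') ∧
        J.map (germHom g b') = Ideal.span {(T.presheaf.germ U b' hb').hom s} := by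
  obtain ⟨U, hbU, s, hs, hJ⟩ := hg b
  rw [ideal_comap_sheafOf g J U.2] at hJ
  refine ⟨U.1, hbU, s, hJ, fun b' hb' => ⟨germ_mem_nonZeroDivisors U.2 hs b' hb', ?_⟩⟩
  rw [← germ_comp_secHom g U.1 b' hb', ← Ideal.map_map]
  refine (congrArg (Ideal.map _) hJ).trans ?_
  rw [Ideal.map_span, Set.image_singleton]

lemma exists_generator_stalk (hg : IsInvertible ((sheafOf J).comap g)) (b : T) :
    ∃ s ∈ nonZeroDivisors (T.presheaf.stalk b), J.map (germHom g b) = Ideal.span {s} := by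
  obtain ⟨U, hb, s, -, h⟩ := exists_local_generator hg b
  exact ⟨_, (h b hb).1, (h b hb).2⟩

lemma isUnit_of_span_mul_eq {S : Type*} [CommRing S] {s a : S} (hs : s ∈ nonZeroDivisors S)
    (h : Ideal.span {s} = Ideal.span {s * a}) : IsUnit a := by
  obtain ⟨b, hb⟩ := Ideal.mem_span_singleton'.mp
    (h ▸ Ideal.mem_span_singleton_self s : s ∈ Ideal.span {s * a})
  refine IsUnit.of_mul_eq_one b ?_
  have : (a * b - 1) * s = 0 := by linear_combination hb
  exact sub_eq_zero.mp (mem_nonZeroDivisors_iff_right.mp hs _ this)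

/-- If `s` is a local generator and `f = a s`, then `f` generates exactly where `a` is a unit. -/
lemma isOpen_generatesAt (hg : IsInvertible ((sheafOf J).comap g)) {f : R} (hf : f ∈ J) :
    IsOpen {b | GeneratesAt g J f b} := by
  rw [isOpen_iff_forall_mem_open]
  intro b hb
  obtain ⟨U, hbU, s, hJ, h⟩ := exists_local_generator hg b
  obtain ⟨a, ha⟩ := Ideal.mem_span_singleton'.mp (hJ ▸ Ideal.mem_map_of_mem (secHom g U) hf)
  have key : ∀ b' (hb' : b' ∈ U), germHom g b' f =
      (T.presheaf.germ U b' hb').hom s * (T.presheaf.germ U b' hb').hom a := by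
    intro b' hb'
    rw [← germ_secHom g U b' hb', ← ha, map_mul, mul_comm]
  refine ⟨T.basicOpen a, fun b' hb' => ?_, (T.basicOpen a).isOpen, ?_⟩
  · have hbU' := T.basicOpen_le a hb'
    have hu : IsUnit ((T.presheaf.germ U b' hbU').hom a) := (T.mem_basicOpen a b' hbU').mp hb'
    refine ⟨?_, ?_⟩
    · rw [key b' hbU']
      exact mul_mem (h b' hbU').1 hu.mem_nonZeroDivisors
    · rw [(h b' hbU').2, key b' hbU', Ideal.span_singleton_mul_right_unit hu]
  · refine (T.mem_basicOpen a b hbU).mpr (isUnit_of_span_mul_eq (h b hbU).1 ?_)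
    rw [← (h b hbU).2, hb.2, key b hbU]

/-- For `r ∈ J` the quotient `r / f` exists near each point. It is unique because `f` is a
nonzerodivisor, so the local quotients glue; `T` need not be affine. -/
lemma map_secHom_top_eq_span {f : R} (hf : f ∈ J) (h : ∀ b, GeneratesAt g J f b) :
    secHom g ⊤ f ∈ nonZeroDivisors Γ(T, ⊤) ∧
      J.map (secHom g ⊤) = Ideal.span {secHom g ⊤ f} := by
  have hnz : ∀ V : T.Opens, secHom g V f ∈ nonZeroDivisors Γ(T, V) := fun V =>
    mem_nonZeroDivisors_of_germ fun b hb => by rw [germ_secHom]; exact (h b).1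
  refine ⟨hnz ⊤, le_antisymm ?_ ?_⟩
  swap
  · rw [Ideal.span_singleton_le_iff_mem]
    exact Ideal.mem_map_of_mem _ hf
  rw [Ideal.map_le_iff_le_comap]
  intro r hr
  have hloc : ∀ b : T, ∃ (V : T.Opens) (_ : b ∈ V) (a : Γ(T, V)),
      secHom g V r = a * secHom g V f := by
    intro b
    obtain ⟨a, ha⟩ := Ideal.mem_span_singleton'.mp
      ((h b).2 ▸ Ideal.mem_map_of_mem (germHom g b) hr)
    obtain ⟨V, hbV, a, rfl⟩ := T.presheaf.exists_germ_eq a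
    rw [← germ_secHom g V b hbV, ← germ_secHom g V b hbV] at ha
    obtain ⟨W, hbW, i, i', hi⟩ := T.presheaf.germ_eq b hbV hbV (a * secHom g V f) (secHom g V r)
      ((map_mul (T.presheaf.germ V b hbV).hom _ _).trans ha)
    refine ⟨W, hbW, (T.presheaf.map i.op).hom a, ?_⟩
    have hi' : (T.presheaf.map i.op).hom (a * secHom g V f) =
      (T.presheaf.map i'.op).hom (secHom g V r) := hi
    rw [map_mul, map_secHom, map_secHom] at hi'
    exact hi'.symm
  choose V hbV a ha using hloc
  have hcov : (⊤ : T.Opens) ≤ iSup V := fun b _ => Opens.mem_iSup.mpr ⟨b, hbV b⟩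
  have hcomp : TopCat.Presheaf.IsCompatible T.sheaf.1 V a := by
    intro b b'
    have h1 : (T.presheaf.map ((V b).infLELeft (V b')).op).hom (a b) * secHom g (V b ⊓ V b') f =
        (T.presheaf.map ((V b).infLERight (V b')).op).hom (a b') * secHom g (V b ⊓ V b') f := by
      rw [← map_secHom g ((V b).infLELeft (V b')).op f, ← map_mul, ← ha, map_secHom,
        map_secHom, ← map_secHom g ((V b).infLERight (V b')).op f, ← map_mul, ← ha, map_secHom]
    exact (mul_cancel_right_mem_nonZeroDivisors (hnz _)).mp h1
  obtain ⟨s₀, hs, -⟩ := T.sheaf.existsUnique_gluing' V ⊤ (fun b => homOfLE le_top) hcov a hcomp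
  let s : Γ(T, ⊤) := s₀
  refine Ideal.mem_span_singleton'.mpr ⟨s, ?_⟩
  refine T.sheaf.eq_of_locally_eq' V ⊤ (fun b => homOfLE le_top) hcov _ _ fun b => ?_
  have hs' : (T.presheaf.map (homOfLE le_top : V b ⟶ ⊤).op).hom s = a b := hs b
  change (T.presheaf.map (homOfLE le_top : V b ⟶ ⊤).op).hom (s * secHom g ⊤ f) =
    (T.presheaf.map (homOfLE le_top : V b ⟶ ⊤).op).hom (secHom g ⊤ r)
  rw [map_mul, hs', map_secHom, map_secHom, ha]

end Generators

section Comp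

variable {R : Type u} [CommRing R] {T T' : Scheme.{u}} (h : T' ⟶ T)
  (g : T ⟶ Spec (CommRingCat.of R)) {J : Ideal R} {f : R}

lemma germHom_comp (b : T') :
    germHom (h ≫ g) b = (h.stalkMap b).hom.comp (germHom g (h b)) := by
  ext r
  rw [RingHom.comp_apply, germHom, germHom, RingHom.comp_apply, RingHom.comp_apply]
  refine Eq.trans ?_ (Scheme.Hom.germ_stalkMap_apply h ⊤ b trivial _).symm
  congr 1
  change (T'.presheaf.map (homOfLE le_top : ⊤ ⟶ ⊤).op).hom (h.appTop.hom (g.appTop.hom _)) =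
    h.appTop.hom ((T.presheaf.map (homOfLE le_top : ⊤ ⟶ ⊤).op).hom (g.appTop.hom _))
  have e : (homOfLE le_top : (⊤ : T'.Opens) ⟶ ⊤) = 𝟙 _ := rfl
  have e' : (homOfLE le_top : (⊤ : T.Opens) ⟶ ⊤) = 𝟙 _ := rfl
  rw [e, e', op_id, op_id, T.presheaf.map_id, T'.presheaf.map_id]
  rfl

/-- With `f = a s` for a generator `s` downstairs, `a` becomes a unit upstairs, and the local
homomorphism of stalks reflects units. -/
lemma GeneratesAt.of_comp (hg : IsInvertible ((sheafOf J).comap g)) (hf : f ∈ J) {b : T'}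
    (hb : GeneratesAt (h ≫ g) J f b) : GeneratesAt g J f (h b) := by
  obtain ⟨s, hs, hJ⟩ := exists_generator_stalk hg (h b)
  obtain ⟨a, ha⟩ := Ideal.mem_span_singleton'.mp (hJ ▸ Ideal.mem_map_of_mem (germHom g (h b)) hf)
  obtain ⟨hb1, hb2⟩ := hb
  rw [germHom_comp, RingHom.comp_apply] at hb1 hb2
  rw [← Ideal.map_map, hJ, Ideal.map_span, Set.image_singleton, ← ha, map_mul, mul_comm] at hb2
  rw [← ha, map_mul] at hb1
  have hu : IsUnit ((h.stalkMap b).hom a) :=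
    isUnit_of_span_mul_eq ((mul_mem_nonZeroDivisors.mp hb1).2) hb2
  have hu' : IsUnit a := isUnit_of_map_unit (h.stalkMap b).hom a hu
  refine ⟨ha ▸ mul_mem hu'.mem_nonZeroDivisors hs, ?_⟩
  rw [hJ, ← ha, Ideal.span_singleton_mul_left_unit hu']

lemma generatesAt_comp_iff [IsOpenImmersion h] (b : T') :
    GeneratesAt (h ≫ g) J f b ↔ GeneratesAt g J f (h b) := by
  have hbij : Function.Bijective (h.stalkMap b).hom :=
    ConcreteCategory.bijective_of_isIso (h.stalkMap b)
  let e := RingEquiv.ofBijective _ hbij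
  have he : (h.stalkMap b).hom = (e : _ →+* _) := rfl
  rw [GeneratesAt, GeneratesAt, germHom_comp, ← Ideal.map_map, RingHom.comp_apply,
    ← Set.image_singleton, ← Ideal.map_span]
  refine and_congr (map_mem_nonZeroDivisors_iff_of_bijective _ hbij)
    ⟨fun H => ?_, fun H => by rw [H]⟩
  rw [he, Ideal.map_coe, Ideal.map_coe] at H
  have := congrArg (Ideal.comap e) H
  rwa [Ideal.comap_map_of_bijective _ e.bijective, Ideal.comap_map_of_bijective _ e.bijective]
    at this

end Comp

lemma germHom_comp_Spec_map {R S : Type u} [CommRing R] [CommRing S] {T : Scheme.{u}}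
    (g : T ⟶ Spec (CommRingCat.of S)) (φ : R →+* S) (b : T) :
    germHom (g ≫ Spec.map (CommRingCat.ofHom φ)) b = (germHom g b).comp φ := by
  ext r
  rw [RingHom.comp_apply, ← germ_secHom _ ⊤ b trivial, ← germ_secHom _ ⊤ b trivial]
  congr 1
  have h := ConcreteCategory.congr_hom
    (Scheme.ΓSpecIso_inv_naturality (CommRingCat.ofHom φ)) r
  change (T.presheaf.map _).hom (g.appTop.hom (ConcreteCategory.hom
    ((Scheme.ΓSpecIso (CommRingCat.of R)).inv ≫
      Scheme.Hom.appTop (Spec.map (CommRingCat.ofHom φ))) r)) = _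
  rw [← h]
  rfl

lemma generatesAt_comp_Spec_map {R S : Type u} [CommRing R] [CommRing S] {T : Scheme.{u}}
    (g : T ⟶ Spec (CommRingCat.of S)) (φ : R →+* S) (J : Ideal R) (f : R) (b : T) :
    GeneratesAt (g ≫ Spec.map (CommRingCat.ofHom φ)) J f b ↔
      GeneratesAt g (J.map φ) (φ f) b := by
  rw [GeneratesAt, GeneratesAt, germHom_comp_Spec_map, Ideal.map_map]
  rfl

lemma generatesAt_span {R : Type u} [CommRing R] {f : R} (hf : f ∈ nonZeroDivisors R)
    (b : Spec (CommRingCat.of R)) : GeneratesAt (𝟙 _) (Ideal.span {f}) f b := by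
  refine ⟨?_, by rw [Ideal.map_span, Set.image_singleton]⟩
  rw [← germ_secHom _ ⊤ b trivial]
  exact germ_mem_nonZeroDivisors (isAffineOpen_top _)
    (mem_nonZeroDivisors_map_of_bijective _ (bijective_secHom_id R) hf) b trivial

/-! ### Affine charts of blowings-up -/

/-- `ψ : R → R'` is the chart of the blowing-up of the ideal `J` on which all elements of `F`
generate `J`. -/
structure IsBlowupChart {R R' : Type u} [CommRing R] [CommRing R'] (J : Ideal R) (F : Set R)
    (ψ : R →+* R') : Prop where
  nonempty : F.Nonempty
  finite : F.Finite
  subset : F ⊆ J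
  generates : ∀ f ∈ F, ψ f ∈ nonZeroDivisors R' ∧ J.map ψ = Ideal.span {ψ f}
  universal : ∀ {S : Type u} [CommRing S] (φ : R →+* S),
    (∀ f ∈ F, φ f ∈ nonZeroDivisors S ∧ J.map φ = Ideal.span {φ f}) →
    ∃ χ : R' →+* S, χ.comp ψ = φ
  unique : ∀ (χ : R' →+* R'), χ.comp ψ = ψ → χ = RingHom.id R'

lemma IsBlowupChart.isInvertible {R R' : Type u} [CommRing R] [CommRing R'] {J : Ideal R}
    {F : Set R} {ψ : R →+* R'} (hψ : IsBlowupChart J F ψ) :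
    IsInvertible ((sheafOf J).comap (Spec.map (CommRingCat.ofHom ψ))) := by
  obtain ⟨f, hf⟩ := hψ.nonempty
  rw [comap_sheafOf, (hψ.generates f hf).2]
  exact isInvertible_sheafOf_span (hψ.generates f hf).1

theorem IsBlowupChart.exists_openImmersion_of_Spec {R R' : Type u} [CommRing R] [CommRing R']
    {J : Ideal R} {F : Set R} {ψ : R →+* R'} (hψ : IsBlowupChart J F ψ) {B : Scheme.{u}}
    {σ : B ⟶ Spec (CommRingCat.of R)} (hσ : IsBlowup (sheafOf J) σ) :
    ∃ c : Spec (CommRingCat.of R') ⟶ B, IsOpenImmersion c ∧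
      c ≫ σ = Spec.map (CommRingCat.ofHom ψ) ∧
      ∀ b, (∀ f ∈ F, GeneratesAt σ J f b) → b ∈ Set.range c := by
  -- The universal property of `σ` gives `c`. It is an isomorphism onto the open set `U` where all
  -- of `F` generates: the universal property of the chart gives `h` in the other direction, and the
  -- two uniqueness statements show that `h` and `c₀` are inverse to each other.
  obtain ⟨c, hc, -⟩ := hσ.universal _ hψ.isInvertible
  let U : B.Opens := ⟨{b | ∀ f ∈ F, GeneratesAt σ J f b}, by
    have : {b | ∀ f ∈ F, GeneratesAt σ J f b} = ⋂ f ∈ F, {b | GeneratesAt σ J f b} := by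
      ext b; simp
    rw [this]
    exact hψ.finite.isOpen_biInter fun f hf =>
      isOpen_generatesAt hσ.invertible (hψ.subset hf)⟩
  have hU : ∀ f ∈ F, ∀ b : U.toScheme, GeneratesAt (U.ι ≫ σ) J f b := fun f hf b =>
    (generatesAt_comp_iff U.ι σ b).mpr (b.2 f hf)
  obtain ⟨χ, hχ⟩ := hψ.universal (secHom (U.ι ≫ σ) ⊤) fun f hf =>
    map_secHom_top_eq_span (hψ.subset hf) (hU f hf)
  have hcU : Set.range c ⊆ Set.range U.ι := by
    rintro _ ⟨p, rfl⟩
    rw [Scheme.Opens.range_ι]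
    intro f hf
    refine GeneratesAt.of_comp c σ hσ.invertible (hψ.subset hf) ?_
    rw [hc, ← Category.id_comp (Spec.map (CommRingCat.ofHom ψ)), generatesAt_comp_Spec_map,
      (hψ.generates f hf).2]
    exact generatesAt_span (hψ.generates f hf).1 p
  let c₀ := IsOpenImmersion.lift U.ι c hcU
  have hc₀ : c₀ ≫ U.ι = c := IsOpenImmersion.lift_fac _ _ _
  obtain ⟨h, hh⟩ := exists_comp_eq_of_secHom (U.ι ≫ σ) hχ
  have h1 : h ≫ c = U.ι := by
    refine (hσ.universal (U.ι ≫ σ) ?_).unique (by rw [Category.assoc, hc, hh]) rfl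
    rw [Scheme.IdealSheafData.comap_comp]
    exact hσ.invertible.comap_of_isOpenImmersion U.ι
  have h2 : h ≫ c₀ = 𝟙 _ := by
    rw [← cancel_mono U.ι, Category.assoc, hc₀, h1, Category.id_comp]
  have h3 : c₀ ≫ h = 𝟙 _ := by
    have h4 : Spec.map (Spec.preimage (c₀ ≫ h)) = c₀ ≫ h := Spec.map_preimage _
    have h5 := hψ.unique (Spec.preimage (c₀ ≫ h)).hom <| by
      have : CommRingCat.ofHom ψ ≫ Spec.preimage (c₀ ≫ h) = CommRingCat.ofHom ψ := by
        apply Spec.map_injective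
        rw [Spec.map_comp, h4, Category.assoc, hh, ← Category.assoc, hc₀, hc]
      exact congrArg CommRingCat.Hom.hom this
    rw [← h4, ← Spec.map_id]
    congr 1
    ext x
    exact DFunLike.congr_fun h5 x
  have hiso : IsIso c₀ := ⟨h, h3, h2⟩
  refine ⟨c, hc₀ ▸ inferInstance, hc, fun b hb => ⟨h ⟨b, hb⟩, ?_⟩⟩
  exact congrArg (fun q : U.toScheme ⟶ B => q ⟨b, hb⟩) h1

/-- Blowing-up is local on the base; this lets affine charts be used over an open copy of `X` in an
arbitrary scheme. -/
lemma IsBlowup.pullback_snd {B Y V : Scheme.{u}} {C : Y.IdealSheafData} {σ : B ⟶ Y}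
    (hσ : IsBlowup C σ) (j : V ⟶ Y) [IsOpenImmersion j] :
    IsBlowup (C.comap j) (Limits.pullback.snd σ j) where
  invertible := by
    rw [← Scheme.IdealSheafData.comap_comp, ← Limits.pullback.condition,
      Scheme.IdealSheafData.comap_comp]
    exact hσ.invertible.comap_of_isOpenImmersion _
  universal := by
    intro T g hg
    rw [← Scheme.IdealSheafData.comap_comp] at hg
    obtain ⟨h, hh, hu⟩ := hσ.universal (g ≫ j) hg
    refine ⟨Limits.pullback.lift h g hh, Limits.pullback.lift_snd _ _ _, fun h' hh' => ?_⟩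
    refine Limits.pullback.hom_ext ?_ ?_
    · rw [Limits.pullback.lift_fst]
      refine hu _ ?_
      beta_reduce
      rw [Category.assoc, Limits.pullback.condition, reassoc_of% hh']
    · rw [Limits.pullback.lift_snd, hh']

theorem IsBlowupChart.exists_openImmersion {R R' : Type u} [CommRing R] [CommRing R']
    {J : Ideal R} {F : Set R} {ψ : R →+* R'} (hψ : IsBlowupChart J F ψ) {B Y : Scheme.{u}}
    {C : Y.IdealSheafData} {σ : B ⟶ Y} (hσ : IsBlowup C σ) (j : Spec (CommRingCat.of R) ⟶ Y)
    [IsOpenImmersion j] (hj : C.comap j = sheafOf J) :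
    ∃ c : Spec (CommRingCat.of R') ⟶ B, IsOpenImmersion c ∧
      c ≫ σ = Spec.map (CommRingCat.ofHom ψ) ≫ j := by
  obtain ⟨c, hc, hcσ, -⟩ := hψ.exists_openImmersion_of_Spec (hj ▸ hσ.pullback_snd j)
  refine ⟨c ≫ Limits.pullback.fst σ j, inferInstance, ?_⟩
  rw [Category.assoc, Limits.pullback.condition, reassoc_of% hcσ]

/-! ### The coefficients of the exceptional divisor -/

lemma length_eq_one_of_isField {K : Type*} [CommRing K] (h : IsField K) :
    Module.length K K = 1 := by
  have : IsSimpleModule K K := by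
    let := h.toField
    exact inferInstanceAs (IsSimpleModule K K)
  exact Module.length_eq_one K K

lemma exists_openImmersion_subscheme {B : Scheme.{u}} (I : B.IdealSheafData) {Q : Type u}
    [CommRing Q] {K : Ideal Q} (c : Spec (CommRingCat.of Q) ⟶ B) [IsOpenImmersion c]
    (hK : I.comap c = sheafOf K) :
    ∃ u : Spec (CommRingCat.of (Q ⧸ K)) ⟶ I.subscheme, IsOpenImmersion u ∧
      u ≫ I.subschemeι = Spec.map (CommRingCat.ofHom (Ideal.Quotient.mk K)) ≫ c ∧
      Set.range u = I.subschemeι ⁻¹' Set.range c := by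
  let i : Spec (CommRingCat.of (Q ⧸ K)) ⟶ Spec (CommRingCat.of Q) :=
    Spec.map (CommRingCat.ofHom (Ideal.Quotient.mk K))
  have : IsClosedImmersion i := IsClosedImmersion.spec_of_surjective _ Ideal.Quotient.mk_surjective
  have hex : ∀ I' : (Spec (CommRingCat.of Q)).IdealSheafData, i.ker = I' →
      ∃ e : Spec (CommRingCat.of (Q ⧸ K)) ⟶ I'.subscheme, IsIso e ∧ e ≫ I'.subschemeι = i := by
    rintro _ rfl
    exact ⟨i.toImage, inferInstance, i.toImage_imageι⟩
  obtain ⟨e, he', he⟩ := hex _ hK.symm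
  let u := e ≫ (I.comapIso c).hom ≫ Limits.pullback.snd c I.subschemeι
  refine ⟨u, inferInstance, ?_, ?_⟩
  · simp only [u, Category.assoc]
    rw [← Limits.pullback.condition, Scheme.IdealSheafData.comapIso_hom_fst_assoc, reassoc_of% he]
  · change _ = ((I.subschemeι ⁻¹ᵁ c.opensRange : Scheme.Opens _) : Set I.subscheme)
    rw [← IsOpenImmersion.range_pullbackSnd]
    simp only [u]
    rw [← Category.assoc, Scheme.Hom.comp_base, TopCat.coe_comp, Set.range_comp,
      Set.range_eq_univ.mpr, Set.image_univ]
    exact (e ≫ (I.comapIso c).hom).surjective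

-- In the chart the exceptional subscheme is the spectrum of the domain `Q ⧸ K`. It has one generic
-- point, and the local ring there is a field, of length one.
open Classical in
theorem exceptionalCoeff_eq {B Y : Scheme.{u}} {C : Y.IdealSheafData} {σ : B ⟶ Y} {Q : Type u}
    [CommRing Q] {K : Ideal Q} [hKp : K.IsPrime] (c : Spec (CommRingCat.of Q) ⟶ B)
    [IsOpenImmersion c] (hK : (C.comap σ).comap c = sheafOf K) (b : Spec (CommRingCat.of Q)) :
    exceptionalCoeff C σ (c b) = if b.asIdeal = K then 1 else 0 := by
  obtain ⟨u, hu, huc, hr⟩ := exists_openImmersion_subscheme (C.comap σ) c hK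
  have hpt : ∀ s, (C.comap σ).subschemeι (u s) =
      c (Spec.map (CommRingCat.ofHom (Ideal.Quotient.mk K)) s) := fun s =>
    congrArg (fun q : Spec (CommRingCat.of (Q ⧸ K)) ⟶ B => q s) huc
  let s₀ : Spec (CommRingCat.of (Q ⧸ K)) := (⟨⊥, Ideal.isPrime_bot⟩ : PrimeSpectrum (Q ⧸ K))
  have hs₀ : ∀ s, s₀ ⤳ s := fun s =>
    (PrimeSpectrum.le_iff_specializes s₀ s).mp (bot_le : (⊥ : Ideal (Q ⧸ K)) ≤ _)
  have hs₀' : ∀ s, s ⤳ s₀ → s = s₀ := fun s hs => PrimeSpectrum.ext (le_antisymm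
    ((PrimeSpectrum.le_iff_specializes s s₀).mpr hs) bot_le)
  have hι : Function.Injective (C.comap σ).subschemeι := (C.comap σ).subschemeι.isEmbedding.injective
  have hmem : (Spec.map (CommRingCat.ofHom (Ideal.Quotient.mk K)) s₀).asIdeal = K := by
    change (⊥ : Ideal (Q ⧸ K)).comap (Ideal.Quotient.mk K) = K
    rw [← RingHom.ker_eq_comap_bot, Ideal.mk_ker]
  by_cases hb : b.asIdeal = K
  · have hb' : Spec.map (CommRingCat.ofHom (Ideal.Quotient.mk K)) s₀ = b :=
      PrimeSpectrum.ext (hmem.trans hb.symm)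
    have h : ∃ e : (C.comap σ).subscheme, (C.comap σ).subschemeι e = c b ∧
        ∀ e', e' ⤳ e → e' = e := by
      refine ⟨u s₀, by rw [hpt, hb'], fun e' he' => ?_⟩
      obtain ⟨s, rfl⟩ := he'.mem_open u.isOpenEmbedding.isOpen_range ⟨s₀, rfl⟩
      rw [hs₀' s (u.isOpenEmbedding.isInducing.specializes_iff.mp he')]
    have hlen : ∀ e, e = u s₀ → Module.length ((C.comap σ).subscheme.presheaf.stalk e)
        ((C.comap σ).subscheme.presheaf.stalk e) = 1 := by
      rintro _ rfl
      refine length_eq_one_of_isField ?_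
      have hF : IsField ((Spec (CommRingCat.of (Q ⧸ K))).presheaf.stalk s₀) :=
        isField_stalk_of_closure_mem_irreducibleComponents _ s₀ (by
          have : closure {s₀} = Set.univ := by
            ext s; simpa [← specializes_iff_mem_closure] using hs₀ s
          rw [this, irreducibleComponents_eq_singleton]
          rfl)
      exact (asIso (u.stalkMap s₀)).commRingCatIsoToRingEquiv.isField hF
    rw [if_pos hb, exceptionalCoeff, dif_pos h, hlen _ (hι (by rw [h.choose_spec.1, hpt, hb']))]
    rfl
  · rw [if_neg hb, exceptionalCoeff, dif_neg]
    rintro ⟨e, he, hgen⟩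
    obtain ⟨s, rfl⟩ : e ∈ Set.range u := by rw [hr]; exact ⟨b, he.symm⟩
    have h1 := hgen _ ((hs₀ s).map u.continuous)
    rw [← h1, hpt] at he
    rw [← c.isOpenEmbedding.injective he] at hb
    exact hb hmem

/-! ### Charts of the blowing-up of the origin -/

/-- The case of a centre disjoint from the copy, stated as a chart so that
`IsBlowupChart.exists_openImmersion` covers it too. -/
lemma isBlowupChart_top (R : Type u) [CommRing R] :
    IsBlowupChart (⊤ : Ideal R) {1} (RingHom.id R) where
  nonempty := ⟨1, rfl⟩
  finite := Set.finite_singleton 1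
  subset := fun _ _ => trivial
  generates := by
    rintro _ rfl
    rw [map_one, Ideal.map_id, Ideal.span_singleton_one]
    exact ⟨one_mem _, rfl⟩
  universal := fun φ _ => ⟨φ, RingHom.comp_id φ⟩
  unique := fun _ h => h

section WChart

variable {k : Type u} [Field k]

lemma chartHom_w : chartHom k (w k) = w k := by simp [chartHom]
lemma chartHom_x : chartHom k (x k) = w k * x k := by simp [chartHom]
lemma chartHom_y : chartHom k (y k) = w k * y k := by simp [chartHom]
lemma chartHom_z : chartHom k (z k) = w k * z k := by simp [chartHom]

lemma ringHom_ext_A {S : Type*} [CommRing S] {φ φ' : A k →+* S}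
    (hC : ∀ a, φ (MvPolynomial.C a) = φ' (MvPolynomial.C a)) (hw : φ (w k) = φ' (w k))
    (hx : φ (x k) = φ' (x k)) (hy : φ (y k) = φ' (y k)) (hz : φ (z k) = φ' (z k)) : φ = φ' := by
  refine MvPolynomial.ringHom_ext hC fun i => ?_
  fin_cases i
  exacts [hw, hx, hy, hz]

lemma map_originIdealA4 {S : Type*} [CommRing S] (φ : A k →+* S) :
    (originIdealA4 k).map φ = Ideal.span {φ (w k), φ (x k), φ (y k), φ (z k)} := by
  rw [originIdealA4, Ideal.map_span]
  congr 1
  simp [Set.image_insert_eq]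

/-- The `w`-chart of the blowing-up of the origin of a closed subscheme of `𝔸⁴` which is invariant
under `(w, x, y, z) ↦ (w, t x, t y, t z)` and on which `w` is not a zerodivisor. -/
lemma isBlowupChart_w {R : Type u} [CommRing R] (π : A k →+* R) (hπ : Function.Surjective π)
    (G : Set (A k)) (hG : RingHom.ker π = Ideal.span G)
    (hGw : ∀ a ∈ G, ∃ n, chartHom k a = w k ^ n * a) (hw : π (w k) ∈ nonZeroDivisors R)
    (ψ : R →+* R) (hψ : ψ.comp π = π.comp (chartHom k).toRingHom) :
    IsBlowupChart ((originIdealA4 k).map π) {π (w k)} ψ := by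
  have hψ' : ∀ a, ψ (π a) = π (chartHom k a) := fun a => RingHom.congr_fun hψ a
  have hψw : ψ (π (w k)) = π (w k) := by rw [hψ', chartHom_w]
  refine ⟨⟨_, rfl⟩, Set.finite_singleton _, ?_, ?_, ?_, ?_⟩
  · rintro _ rfl
    exact Ideal.mem_map_of_mem _ (Ideal.subset_span (by simp))
  · rintro _ rfl
    refine ⟨by rwa [hψw], ?_⟩
    rw [Ideal.map_map, map_originIdealA4]
    simp only [RingHom.comp_apply, hψ', chartHom_w, chartHom_x, chartHom_y, chartHom_z, map_mul]
    refine le_antisymm (Ideal.span_le.mpr ?_) (Ideal.span_mono (by simp))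
    have := Ideal.mem_span_singleton_self (π (w k))
    rintro _ (rfl | rfl | rfl | rfl)
    exacts [this, Ideal.mul_mem_right _ _ this, Ideal.mul_mem_right _ _ this,
      Ideal.mul_mem_right _ _ this]
  · intro S _ φ hφ
    obtain ⟨hnz, hJ⟩ := hφ _ rfl
    have hex : ∀ a ∈ originIdealA4 k, ∃ b, b * φ (π (w k)) = φ (π a) := fun a ha =>
      Ideal.mem_span_singleton'.mp (hJ ▸ Ideal.mem_map_of_mem φ (Ideal.mem_map_of_mem π ha))
    obtain ⟨x', hx'⟩ := hex (x k) (Ideal.subset_span (by simp))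
    obtain ⟨y', hy'⟩ := hex (y k) (Ideal.subset_span (by simp))
    obtain ⟨z', hz'⟩ := hex (z k) (Ideal.subset_span (by simp))
    let χ : A k →+* S := MvPolynomial.eval₂Hom ((φ.comp π).comp MvPolynomial.C)
      ![φ (π (w k)), x', y', z']
    have hχ : χ.comp (chartHom k).toRingHom = φ.comp π := by
      refine ringHom_ext_A (fun a => ?_) ?_ ?_ ?_ ?_
      · change χ (chartHom k (MvPolynomial.C a)) = _
        rw [← MvPolynomial.algebraMap_eq, AlgHom.commutes]
        simp [χ]
      · change χ (chartHom k (w k)) = _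
        rw [chartHom_w]; simp [χ]
      · change χ (chartHom k (x k)) = φ (π (x k))
        rw [chartHom_x, ← hx']; simp [χ, mul_comm]
      · change χ (chartHom k (y k)) = φ (π (y k))
        rw [chartHom_y, ← hy']; simp [χ, mul_comm]
      · change χ (chartHom k (z k)) = φ (π (z k))
        rw [chartHom_z, ← hz']; simp [χ, mul_comm]
    -- Homogeneity enters here: for `a ∈ G`, `φ (π (w k)) ^ n * χ a = χ (chartHom k a) = φ (π a) =
    -- 0`, and `φ (π (w k))` is a nonzerodivisor.
    have hker : RingHom.ker π ≤ RingHom.ker χ := by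
      rw [hG, Ideal.span_le]
      intro a ha
      obtain ⟨n, hn⟩ := hGw a ha
      have h1 : χ (chartHom k a) = φ (π a) := RingHom.congr_fun hχ a
      have h2 : π a = 0 := by
        rw [← RingHom.mem_ker, hG]; exact Ideal.subset_span ha
      have h3 : χ (w k) = φ (π (w k)) := by simp [χ]
      rw [hn, h2, map_zero, map_mul, map_pow, h3, mul_comm] at h1
      exact mem_nonZeroDivisors_iff_right.mp (pow_mem hnz n) _ h1
    refine ⟨RingHom.liftOfSurjective π hπ ⟨χ, hker⟩, ?_⟩
    rw [← RingHom.cancel_right hπ, RingHom.comp_assoc, hψ, ← RingHom.comp_assoc,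
      RingHom.liftOfSurjective_comp, hχ]
  · intro χ hχ
    have hχ' : ∀ a, χ (π (chartHom k a)) = π (chartHom k a) := fun a => by
      rw [← hψ']; exact RingHom.congr_fun hχ _
    have h0 : χ (π (w k)) = π (w k) := by simpa [chartHom_w] using hχ' (w k)
    have key : ∀ a, chartHom k a = w k * a → χ (π a) = π a := by
      intro a ha
      have := hχ' a
      rw [ha, map_mul, map_mul, h0] at this
      exact (mul_cancel_left_mem_nonZeroDivisors hw).mp this
    rw [← RingHom.cancel_right hπ]
    refine ringHom_ext_A (fun a => ?_) h0 (key _ chartHom_x) (key _ chartHom_y) (key _ chartHom_z)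
    have := hχ' (MvPolynomial.C a)
    rwa [← MvPolynomial.algebraMap_eq, AlgHom.commutes] at this

lemma w_ne_zero : w k ≠ 0 := MvPolynomial.X_ne_zero _

lemma isBlowupChart_A4 : IsBlowupChart (originIdealA4 k) {w k} (chartHom k).toRingHom := by
  have h := isBlowupChart_w (RingHom.id (A k)) Function.surjective_id ∅
    (by rw [Ideal.span_empty]; exact (RingHom.injective_iff_ker_eq_bot _).mp fun _ _ h => h)
    (by simp) (mem_nonZeroDivisors_of_ne_zero w_ne_zero) (chartHom k).toRingHom
    (by rw [RingHom.comp_id, RingHom.id_comp])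
  rwa [Ideal.map_id] at h

end WChart

/-! ### Equations of `X` -/

section Equations

variable (k : Type u) [Field k]

/-- The coordinate ring of the affine plane. -/
abbrev M : Type u := MvPolynomial (Fin 2) k

/-- The coordinates `u` and `v` of the affine plane. -/
abbrev uu : M k := MvPolynomial.X 0
abbrev vv : M k := MvPolynomial.X 1

variable {k}

lemma ringHom_ext_M {S : Type*} [CommRing S] {φ φ' : M k →+* S}
    (hC : ∀ a, φ (MvPolynomial.C a) = φ' (MvPolynomial.C a)) (hu : φ (uu k) = φ' (uu k))
    (hv : φ (vv k) = φ' (vv k)) : φ = φ' := by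
  refine MvPolynomial.ringHom_ext hC fun i => ?_
  fin_cases i
  exacts [hu, hv]

/-- A plane in `𝔸⁴`: `ρ` is the restriction of functions to the plane with coordinates
`u = f` and `v = w`, and `P` is its ideal. -/
structure IsPlane (P : Ideal (A k)) (f : A k) (ρ : A k →ₐ[k] M k) : Prop where
  map_f : ρ f = uu k
  map_w : ρ (w k) = vv k
  le_ker : P ≤ RingHom.ker ρ
  sub_mem : ∀ a ∈ ({x k, y k, z k} : Set (A k)),
    a - MvPolynomial.aeval ![f, w k] (ρ a) ∈ P

variable {P : Ideal (A k)} {f : A k} {ρ : A k →ₐ[k] M k}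

/-- The section of `ρ`. -/
def planeSection (f : A k) : M k →ₐ[k] A k := MvPolynomial.aeval ![f, w k]

lemma IsPlane.map_section (h : IsPlane P f ρ) (m : M k) : ρ (planeSection f m) = m := by
  have : ρ.comp (planeSection f) = AlgHom.id k _ := by
    ext i
    fin_cases i
    · simp [planeSection, h.map_f]
    · simp [planeSection, h.map_w]
  exact AlgHom.congr_fun this m

lemma IsPlane.sub_section_mem (h : IsPlane P f ρ) (a : A k) : a - planeSection f (ρ a) ∈ P := by
  have : ((Ideal.Quotient.mkₐ k P).comp (planeSection f)).comp ρ = Ideal.Quotient.mkₐ k P := by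
    refine MvPolynomial.algHom_ext fun i => ?_
    rw [AlgHom.comp_apply, AlgHom.comp_apply, Ideal.Quotient.mkₐ_eq_mk, eq_comm,
      Ideal.Quotient.eq]
    fin_cases i
    · change w k - planeSection f (ρ (w k)) ∈ P
      rw [h.map_w]; simp [planeSection]
    · exact h.sub_mem (x k) (by simp)
    · exact h.sub_mem (y k) (by simp)
    · exact h.sub_mem (z k) (by simp)
  rw [← Ideal.Quotient.eq]
  exact (AlgHom.congr_fun this a).symm

lemma IsPlane.mem_iff (h : IsPlane P f ρ) (a : A k) : a ∈ P ↔ ρ a = 0 := by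
  refine ⟨fun ha => h.le_ker ha, fun ha => ?_⟩
  have := h.sub_section_mem a
  rwa [ha, map_zero, sub_zero] at this

lemma IsPlane.surjective (h : IsPlane P f ρ) : Function.Surjective ρ :=
  fun m => ⟨_, h.map_section m⟩

lemma IsPlane.isPrime (h : IsPlane P f ρ) : P.IsPrime := by
  have : P = RingHom.ker ρ := by ext a; exact h.mem_iff a
  rw [this]
  exact RingHom.ker_isPrime ρ

variable (k)

/-- Restriction of functions to the components of `X`. -/
def rho₁ : A k →ₐ[k] M k := MvPolynomial.aeval ![vv k, 0, uu k, 0]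
def rho₂ : A k →ₐ[k] M k := MvPolynomial.aeval ![vv k, uu k, 0, 0]
def rho₃ : A k →ₐ[k] M k := MvPolynomial.aeval ![vv k, uu k, -uu k, -(uu k * vv k)]

/-- The ideals of the components of `X`. -/
def P₁ : Ideal (A k) := Ideal.span {z k, x k}
def P₂ : Ideal (A k) := Ideal.span {z k, y k}
def P₃ : Ideal (A k) := Ideal.span {z k + x k * w k, x k + y k}

lemma isPlane₁ : IsPlane (P₁ k) (y k) (rho₁ k) := by
  refine ⟨by simp [rho₁], by simp [rho₁], ?_, ?_⟩
  · rw [P₁, Ideal.span_le]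
    rintro _ (rfl | rfl) <;> simp [rho₁, RingHom.mem_ker]
  · rintro _ (rfl | rfl | rfl)
    · simpa [rho₁, P₁] using Ideal.subset_span (by simp)
    · simp [rho₁]
    · simpa [rho₁, P₁] using Ideal.subset_span (by simp)

lemma isPlane₂ : IsPlane (P₂ k) (x k) (rho₂ k) := by
  refine ⟨by simp [rho₂], by simp [rho₂], ?_, ?_⟩
  · rw [P₂, Ideal.span_le]
    rintro _ (rfl | rfl) <;> simp [rho₂, RingHom.mem_ker]
  · rintro _ (rfl | rfl | rfl)
    · simp [rho₂]
    · simpa [rho₂, P₂] using Ideal.subset_span (by simp)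
    · simpa [rho₂, P₂] using Ideal.subset_span (by simp)

lemma isPlane₃ : IsPlane (P₃ k) (x k) (rho₃ k) := by
  refine ⟨by simp [rho₃], by simp [rho₃], ?_, ?_⟩
  · rw [P₃, Ideal.span_le]
    rintro _ (rfl | rfl) <;> simp [rho₃, RingHom.mem_ker]
  · rintro _ (rfl | rfl | rfl)
    · simp [rho₃]
    · simp only [rho₃, MvPolynomial.aeval_X]
      simpa [add_comm, P₃] using Ideal.subset_span (by simp)
    · simp only [rho₃, MvPolynomial.aeval_X]
      simpa [P₃] using Ideal.subset_span (by simp)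

lemma idealX_eq : idealX k = P₁ k ⊓ P₂ k ⊓ P₃ k := rfl

/-- The equations of `X`. -/
def equationsX : Set (A k) :=
  {x k * (z k - w k * y k), z k * (z k + x k * w k), (x k + y k) * z k,
    (x k + y k) * (x k * y k)}

variable {k}

lemma mem_idealX {a : A k} : a ∈ idealX k ↔ rho₁ k a = 0 ∧ rho₂ k a = 0 ∧ rho₃ k a = 0 := by
  rw [idealX_eq, Ideal.mem_inf, Ideal.mem_inf, (isPlane₁ k).mem_iff, (isPlane₂ k).mem_iff,
    (isPlane₃ k).mem_iff, and_assoc]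

/-- Homogeneous generators are what `isBlowupChart_w` requires. An element of `P₁ ⊓ P₂` has the form
`p' z + t x y`. On the third plane its vanishing reads `p' v = -t u`, so there `p' = c u` and `t =
-c v`. Lifting `c` to `𝔸⁴` writes the element as `c x (z - w y)` plus multiples of the equations. -/
lemma span_equationsX : idealX k = Ideal.span (equationsX k) := by
  refine le_antisymm ?_ (Ideal.span_le.mpr ?_)
  swap
  · rintro _ (rfl | rfl | rfl | rfl) <;> rw [SetLike.mem_coe, mem_idealX] <;>
      simp [rho₁, rho₂, rho₃] <;> ring
  intro a ha
  obtain ⟨⟨h1, h2⟩, h3⟩ := ha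
  obtain ⟨p, q, rfl⟩ := Ideal.mem_span_pair.mp h1
  have hq : q ∈ P₂ k := by
    have hz : z k ∈ P₂ k := Ideal.subset_span (by simp)
    have : q * x k ∈ P₂ k := (Ideal.add_mem_iff_right _ (Ideal.mul_mem_left _ _ hz)).mp h2
    refine ((isPlane₂ k).isPrime.mem_or_mem this).resolve_right ?_
    rw [(isPlane₂ k).mem_iff, (isPlane₂ k).map_f]
    exact MvPolynomial.X_ne_zero _
  obtain ⟨r, t, rfl⟩ := Ideal.mem_span_pair.mp hq
  have h3' := ((isPlane₃ k).mem_iff _).mp h3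
  have hu : uu k ≠ 0 := MvPolynomial.X_ne_zero _
  obtain ⟨p', hp'⟩ : ∃ p', p' = p + r * x k := ⟨_, rfl⟩
  have h4 : rho₃ k p' * vv k = - (rho₃ k t * uu k) := by
    refine mul_right_cancel₀ hu ?_
    rw [hp']
    simp only [map_add, map_mul] at h3' ⊢
    simp only [rho₃, MvPolynomial.aeval_X] at h3' ⊢
    simp at h3' ⊢
    linear_combination -h3'
  obtain ⟨c, hc⟩ : uu k ∣ rho₃ k p' := by
    have hd : uu k ∣ rho₃ k p' * vv k := ⟨-rho₃ k t, by rw [h4]; ring⟩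
    refine ((MvPolynomial.X_prime (R := k) (i := (0 : Fin 2))).dvd_or_dvd hd).resolve_right
      fun h => ?_
    simp [MvPolynomial.X_dvd_X] at h
  have ht : rho₃ k t = -(c * vv k) := by
    refine mul_right_cancel₀ hu ?_
    rw [hc] at h4
    linear_combination h4
  have e1 := (isPlane₃ k).sub_section_mem p'
  have e2 := (isPlane₃ k).sub_section_mem t
  obtain ⟨d, hd⟩ : ∃ d, d = planeSection (x k) c := ⟨_, rfl⟩
  have hsu : planeSection (x k) (uu k) = x k := by simp [planeSection]
  have hsv : planeSection (x k) (vv k) = w k := by simp [planeSection]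
  rw [hc, map_mul, hsu, ← hd] at e1
  rw [ht, map_neg, map_mul, hsv, ← hd] at e2
  obtain ⟨a1, b1, h1⟩ := Ideal.mem_span_pair.mp e1
  obtain ⟨a2, b2, h2⟩ := Ideal.mem_span_pair.mp e2
  have : p * z k + (r * z k + t * y k) * x k =
      (d + a2 * y k) * (x k * (z k - w k * y k)) + a1 * (z k * (z k + x k * w k)) +
      b1 * ((x k + y k) * z k) + (b2 + a2 * w k) * ((x k + y k) * (x k * y k)) := by
    linear_combination -z k * h1 - (x k * y k) * h2 - z k * hp'
  rw [this]
  refine Ideal.add_mem _ (Ideal.add_mem _ (Ideal.add_mem _ ?_ ?_) ?_) ?_ <;>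
    exact Ideal.mul_mem_left _ _ (Ideal.subset_span (by simp [equationsX]))

end Equations

section

variable (k : Type u) [Field k]

/-- The quotient map `k[w, x, y, z] → RX`. -/
abbrev mkX : A k →+* RX k := Ideal.Quotient.mk (idealX k)

variable {k}

lemma mkX_surjective : Function.Surjective (mkX k) := Ideal.Quotient.mk_surjective

lemma mkX_eq_zero {a : A k} (h : a ∈ equationsX k) : mkX k a = 0 := by
  rw [Ideal.Quotient.eq_zero_iff_mem, span_equationsX]
  exact Ideal.subset_span h

/-- `w` restricts to the nonzero function `v` on each plane, and a function on `X` is determined by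
its three restrictions. -/
lemma mkX_w_mem_nonZeroDivisors : mkX k (w k) ∈ nonZeroDivisors (RX k) := by
  rw [mem_nonZeroDivisors_iff_right]
  intro a ha
  obtain ⟨a, rfl⟩ := mkX_surjective a
  rw [← map_mul, Ideal.Quotient.eq_zero_iff_mem, mem_idealX] at ha
  rw [Ideal.Quotient.eq_zero_iff_mem, mem_idealX]
  have hv : vv k ≠ 0 := MvPolynomial.X_ne_zero _
  simpa [(isPlane₁ k).map_w, (isPlane₂ k).map_w, (isPlane₃ k).map_w, hv] using ha

variable (k) in
/-- The endomorphism of `RX` induced by `chartHom`. -/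
def chartHomX : RX k →+* RX k :=
  Ideal.quotientMap (idealX k) (chartHom k).toRingHom (idealX_le_comap k)

/-- The exponents 2, 2, 2, 3 are the degrees of the four equations in `x`, `y`, `z`. -/
lemma isBlowupChart_X : IsBlowupChart (originIdealX k) {mkX k (w k)} (chartHomX k) := by
  refine isBlowupChart_w (mkX k) mkX_surjective (equationsX k)
    (by rw [Ideal.mk_ker, span_equationsX]) ?_ mkX_w_mem_nonZeroDivisors _ (RingHom.ext fun a => rfl)
  rintro _ (rfl | rfl | rfl | rfl)
  · exact ⟨2, by simp only [map_sub, map_mul, chartHom_w, chartHom_x, chartHom_y, chartHom_z]; ring⟩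
  · exact ⟨2, by simp only [map_add, map_mul, chartHom_w, chartHom_x, chartHom_z]; ring⟩
  · exact ⟨2, by simp only [map_add, map_mul, chartHom_x, chartHom_y, chartHom_z]; ring⟩
  · exact ⟨3, by simp only [map_add, map_mul, chartHom_x, chartHom_y]; ring⟩

/-! ### The planes of `X` away from the `w`-axis -/

/-- `f * f'` vanishes on the two other components of `X`, and only on the `w`-axis of the component
given by `ρ`. -/
structure IsComponent (P : Ideal (A k)) (f f' : A k) (ρ : A k →ₐ[k] M k) : Prop where
  isPlane : IsPlane P f ρ
  idealX_le : idealX k ≤ P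
  mul_mem_idealX : ∀ a ∈ P, f * f' * a ∈ idealX k
  map_f' : ρ f' = uu k ∨ ρ f' = -uu k
  map_origin : (originIdealA4 k).map ρ.toRingHom = Ideal.span {uu k, vv k}
  f_mem : f ∈ originIdealA4 k
  f'_mem : f' ∈ originIdealA4 k

lemma x_mem : x k ∈ originIdealA4 k := Ideal.subset_span (by simp)
lemma y_mem : y k ∈ originIdealA4 k := Ideal.subset_span (by simp)
lemma z_mem : z k ∈ originIdealA4 k := Ideal.subset_span (by simp)
lemma w_mem : w k ∈ originIdealA4 k := Ideal.subset_span (by simp)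

lemma map_origin_of_le {ρ : A k →ₐ[k] M k} (hw : ρ (w k) = vv k)
    (hu : uu k ∈ (originIdealA4 k).map ρ.toRingHom)
    (h : ∀ a ∈ ({x k, y k, z k} : Set (A k)), ρ a ∈ Ideal.span {uu k, vv k}) :
    (originIdealA4 k).map ρ.toRingHom = Ideal.span {uu k, vv k} := by
  refine le_antisymm ?_ (Ideal.span_le.mpr ?_)
  · rw [map_originIdealA4, Ideal.span_le]
    rintro _ (rfl | rfl | rfl | rfl)
    · change ρ _ ∈ _
      rw [hw]
      exact Ideal.subset_span (by simp)
    exacts [h _ (by simp), h _ (by simp), h _ (by simp)]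
  · rintro _ (rfl | rfl)
    · exact hu
    · have := Ideal.mem_map_of_mem ρ.toRingHom (w_mem (k := k))
      change ρ (w k) ∈ _ at this
      rwa [hw] at this

lemma uu_mem : uu k ∈ Ideal.span {uu k, vv k} := Ideal.subset_span (by simp)

lemma isComponent₁ : IsComponent (P₁ k) (y k) (x k + y k) (rho₁ k) where
  isPlane := isPlane₁ k
  idealX_le := fun _ h => h.1.1
  mul_mem_idealX := by
    intro a ha
    rw [mem_idealX]
    have h1 := ((isPlane₁ k).mem_iff a).mp ha
    exact ⟨by rw [map_mul, h1, mul_zero], by simp [rho₂], by simp [rho₃]⟩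
  map_f' := by simp [rho₁]
  map_origin := by
    refine map_origin_of_le (isPlane₁ k).map_w ?_ ?_
    · rw [← (isPlane₁ k).map_f]; exact Ideal.mem_map_of_mem (rho₁ k).toRingHom y_mem
    · rintro _ (rfl | rfl | rfl) <;> simp [rho₁, uu_mem]
  f_mem := y_mem
  f'_mem := Ideal.add_mem _ x_mem y_mem

lemma isComponent₂ : IsComponent (P₂ k) (x k) (x k + y k) (rho₂ k) where
  isPlane := isPlane₂ k
  idealX_le := fun _ h => h.1.2
  mul_mem_idealX := by
    intro a ha
    rw [mem_idealX]
    have h1 := ((isPlane₂ k).mem_iff a).mp ha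
    exact ⟨by simp [rho₁], by rw [map_mul, h1, mul_zero], by simp [rho₃]⟩
  map_f' := by simp [rho₂]
  map_origin := by
    refine map_origin_of_le (isPlane₂ k).map_w ?_ ?_
    · rw [← (isPlane₂ k).map_f]; exact Ideal.mem_map_of_mem (rho₂ k).toRingHom x_mem
    · rintro _ (rfl | rfl | rfl) <;> simp [rho₂, uu_mem]
  f_mem := x_mem
  f'_mem := Ideal.add_mem _ x_mem y_mem

lemma isComponent₃ : IsComponent (P₃ k) (x k) (y k) (rho₃ k) where
  isPlane := isPlane₃ k
  idealX_le := fun _ h => h.2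
  mul_mem_idealX := by
    intro a ha
    rw [mem_idealX]
    have h1 := ((isPlane₃ k).mem_iff a).mp ha
    exact ⟨by simp [rho₁], by simp [rho₂], by rw [map_mul, h1, mul_zero]⟩
  map_f' := by simp [rho₃]
  map_origin := by
    refine map_origin_of_le (isPlane₃ k).map_w ?_ ?_
    · rw [← (isPlane₃ k).map_f]; exact Ideal.mem_map_of_mem (rho₃ k).toRingHom x_mem
    · rintro _ (rfl | rfl | rfl) <;> simp [rho₃, uu_mem, Ideal.mul_mem_right]
  f_mem := x_mem
  f'_mem := y_mem

variable {P : Ideal (A k)} {f f' : A k} {ρ : A k →ₐ[k] M k}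

/-- The restriction of functions on `X` to the component. -/
def IsComponent.res (h : IsComponent P f f' ρ) : RX k →ₐ[k] M k :=
  Ideal.Quotient.liftₐ (idealX k) ρ fun _ ha => h.isPlane.le_ker (h.idealX_le ha)

namespace IsComponent

variable (h : IsComponent P f f' ρ)

include h

lemma res_mkX (a : A k) : h.res (mkX k a) = ρ a := rfl

lemma res_surjective : Function.Surjective h.res := fun m => by
  obtain ⟨a, rfl⟩ := h.isPlane.surjective m
  exact ⟨mkX k a, rfl⟩

/-- Wherever `f` and `f'` are nonzerodivisors, functions vanishing on the plane become zero: the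
other two components disappear. -/
lemma mul_eq_zero_of_res_eq_zero {a : RX k} (ha : h.res a = 0) : mkX k f * mkX k f' * a = 0 := by
  obtain ⟨a, rfl⟩ := mkX_surjective a
  rw [res_mkX, ← h.isPlane.mem_iff] at ha
  rw [← map_mul, ← map_mul, Ideal.Quotient.eq_zero_iff_mem]
  exact h.mul_mem_idealX a ha

end IsComponent

variable (k) in
/-- The substitution `(u, v) ↦ (v, u v)`, a chart of the blowing-up of the origin of the plane. -/
def tau : M k →ₐ[k] M k := MvPolynomial.aeval ![vv k, uu k * vv k]

lemma tau_uu : tau k (uu k) = vv k := by simp [tau]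
lemma tau_vv : tau k (vv k) = uu k * vv k := by simp [tau]

/-- The chart of the blowing-up of the origin of `X` on which `f` and `f'` generate the inverse
image of the ideal of the origin. -/
lemma IsComponent.isBlowupChart (h : IsComponent P f f' ρ) :
    IsBlowupChart (originIdealX k) {mkX k f, mkX k f'} ((tau k).comp h.res).toRingHom := by
  have hv : vv k ≠ 0 := MvPolynomial.X_ne_zero _
  -- `tau` turns `(u, v)` into `(v, u v) = (v)`, so the exceptional divisor is the line `v = 0`, the
  -- form that `isSncAt_plane` expects.
  have hJ : (originIdealX k).map ((tau k).comp h.res).toRingHom = Ideal.span {vv k} := by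
    have : ((tau k).comp h.res).toRingHom.comp (mkX k) =
        (tau k).toRingHom.comp ρ.toRingHom := rfl
    rw [originIdealX, Ideal.map_map, this, ← Ideal.map_map, h.map_origin, Ideal.map_span,
      Set.image_pair]
    change Ideal.span {tau k (uu k), tau k (vv k)} = _
    rw [tau_uu, tau_vv]
    refine le_antisymm (Ideal.span_le.mpr ?_) (Ideal.span_mono (by simp))
    have := Ideal.mem_span_singleton_self (vv k)
    rintro _ (rfl | rfl)
    exacts [this, Ideal.mul_mem_left _ _ this]
  have hf : ((tau k).comp h.res).toRingHom (mkX k f) = vv k := by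
    change tau k (ρ f) = _
    rw [h.isPlane.map_f, tau_uu]
  have hf' : ((tau k).comp h.res).toRingHom (mkX k f') = vv k ∨
      ((tau k).comp h.res).toRingHom (mkX k f') = -vv k := by
    change tau k (ρ f') = _ ∨ tau k (ρ f') = _
    rcases h.map_f' with h' | h' <;> rw [h']
    · exact Or.inl tau_uu
    · right; rw [map_neg, tau_uu]
  refine ⟨⟨_, Set.mem_insert _ _⟩, Set.toFinite _, ?_, ?_, ?_, ?_⟩
  · rintro _ (rfl | rfl)
    exacts [Ideal.mem_map_of_mem _ h.f_mem, Ideal.mem_map_of_mem _ h.f'_mem]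
  · rintro _ (rfl | rfl)
    · rw [hf, hJ]
      exact ⟨mem_nonZeroDivisors_of_ne_zero hv, rfl⟩
    · rw [hJ]
      rcases hf' with h' | h' <;> rw [h']
      · exact ⟨mem_nonZeroDivisors_of_ne_zero hv, rfl⟩
      · exact ⟨mem_nonZeroDivisors_of_ne_zero (neg_ne_zero.mpr hv),
          (Ideal.span_singleton_neg _).symm⟩
  · intro S _ φ hφ
    obtain ⟨hnz, hJφ⟩ := hφ _ (Set.mem_insert _ _)
    obtain ⟨hnz', -⟩ := hφ _ (Set.mem_insert_of_mem _ rfl)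
    have hker : RingHom.ker h.res.toRingHom ≤ RingHom.ker φ := by
      intro a ha
      have := congrArg φ (h.mul_eq_zero_of_res_eq_zero ha)
      rw [map_zero, map_mul, map_mul, mul_comm] at this
      exact mem_nonZeroDivisors_iff_right.mp (mul_mem hnz hnz') _ this
    let φ' := RingHom.liftOfSurjective h.res.toRingHom h.res_surjective ⟨φ, hker⟩
    have hφ' : φ'.comp h.res.toRingHom = φ := RingHom.liftOfSurjective_comp _ _ _
    have hφ'a : ∀ a, φ' (ρ a) = φ (mkX k a) := fun a => RingHom.congr_fun hφ' (mkX k a)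
    obtain ⟨c, hc⟩ := Ideal.mem_span_singleton'.mp
      (hJφ ▸ Ideal.mem_map_of_mem φ (Ideal.mem_map_of_mem (mkX k) w_mem))
    let χ : M k →+* S := MvPolynomial.eval₂Hom (φ'.comp MvPolynomial.C) ![c, φ (mkX k f)]
    refine ⟨χ, ?_⟩
    have : χ.comp (tau k).toRingHom = φ' := by
      refine ringHom_ext_M (fun a => ?_) ?_ ?_
      · change χ (tau k (MvPolynomial.C a)) = _
        rw [← MvPolynomial.algebraMap_eq, AlgHom.commutes]
        simp [χ]
      · change χ (tau k (uu k)) = _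
        rw [tau_uu, ← h.isPlane.map_f, hφ'a]
        simp [χ]
      · change χ (tau k (vv k)) = _
        rw [tau_vv, ← h.isPlane.map_w, hφ'a, h.isPlane.map_w, ← hc]
        simp [χ]
    rw [← hφ', ← this]
    rfl
  · intro χ hχ
    have hτ : ∀ m, χ (tau k m) = tau k m := fun m => by
      obtain ⟨a, rfl⟩ := h.res_surjective m
      exact RingHom.congr_fun hχ a
    have h1 := hτ (uu k)
    have h2 := hτ (vv k)
    rw [tau_uu] at h1
    rw [tau_vv, map_mul, h1] at h2
    refine ringHom_ext_M (fun a => ?_) (mul_right_cancel₀ hv h2) h1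
    have := hτ (MvPolynomial.C a)
    rwa [← MvPolynomial.algebraMap_eq, AlgHom.commutes] at this

/-! ### The charts cover the blowing-up -/

/-- `f` is a nonzerodivisor which generates the extension of `J`. -/
def Generates {R S : Type*} [CommRing R] [CommRing S] (φ : R →+* S) (J : Ideal R) (f : R) : Prop :=
  φ f ∈ nonZeroDivisors S ∧ J.map φ = Ideal.span {φ f}

/-- At each point of the blowing-up of the origin of `X`, the inverse image of the ideal of the
origin is generated by `w`, or by two of `x`, `y`, `x + y`. -/
theorem exists_generates {S : Type*} [CommRing S] [IsLocalRing S] (φ : RX k →+* S) {s : S}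
    (hs : s ∈ nonZeroDivisors S) (hJ : (originIdealX k).map φ = Ideal.span {s}) :
    Generates φ (originIdealX k) (mkX k (w k)) ∨
    (Generates φ (originIdealX k) (mkX k (y k)) ∧
      Generates φ (originIdealX k) (mkX k (x k + y k))) ∨
    (Generates φ (originIdealX k) (mkX k (x k)) ∧
      Generates φ (originIdealX k) (mkX k (x k + y k))) ∨
    (Generates φ (originIdealX k) (mkX k (x k)) ∧
      Generates φ (originIdealX k) (mkX k (y k))) := by
  have hex : ∀ a ∈ originIdealA4 k, ∃ b, b * s = φ (mkX k a) := fun a ha =>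
    Ideal.mem_span_singleton'.mp (hJ ▸ Ideal.mem_map_of_mem φ (Ideal.mem_map_of_mem (mkX k) ha))
  obtain ⟨a, ha⟩ := hex (w k) w_mem
  obtain ⟨b, hb⟩ := hex (x k) x_mem
  obtain ⟨c, hc⟩ := hex (y k) y_mem
  obtain ⟨d, hd⟩ := hex (z k) z_mem
  have hcancel : ∀ {n : ℕ} {t : S}, s ^ n * t = 0 → t = 0 := fun {n t} h =>
    mem_nonZeroDivisors_iff_right.mp (pow_mem hs n) t (by rwa [mul_comm])
  -- the four equations of the strict transform
  have e1 : b * (d - a * s * c) = 0 := by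
    have := congrArg φ (mkX_eq_zero (k := k) (a := x k * (z k - w k * y k)) (by simp [equationsX]))
    simp only [map_mul, map_sub, map_zero, ← ha, ← hb, ← hc, ← hd] at this
    refine hcancel (n := 2) ?_
    linear_combination this
  have e2 : d * (d + b * a * s) = 0 := by
    have := congrArg φ (mkX_eq_zero (k := k) (a := z k * (z k + x k * w k)) (by simp [equationsX]))
    simp only [map_mul, map_add, map_zero, ← ha, ← hb, ← hd] at this
    refine hcancel (n := 2) ?_
    linear_combination this
  have e4 : (b + c) * (b * c) = 0 := by
    have := congrArg φ (mkX_eq_zero (k := k) (a := (x k + y k) * (x k * y k))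
      (by simp [equationsX]))
    simp only [map_mul, map_add, map_zero, ← hb, ← hc] at this
    refine hcancel (n := 3) ?_
    linear_combination this
  have hgen : ∀ {g : A k} {t : S}, IsUnit t → t * s = φ (mkX k g) →
      Generates φ (originIdealX k) (mkX k g) := fun ht e =>
    ⟨e ▸ mul_mem ht.mem_nonZeroDivisors hs, by
      rw [hJ, ← e, Ideal.span_singleton_mul_left_unit ht]⟩
  have hbc : (b + c) * s = φ (mkX k (x k + y k)) := by rw [map_add, map_add, ← hb, ← hc]; ring
  by_cases ua : IsUnit a
  · exact Or.inl (hgen ua ha)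
  right
  by_cases ub : IsUnit b
  · by_cases uc : IsUnit c
    · exact Or.inr (Or.inr ⟨hgen ub hb, hgen uc hc⟩)
    -- In a local ring `b = (b + c) - c` is a unit and `c` is not, so `b + c` is a unit.
    · refine Or.inr (Or.inl ⟨hgen ub hb, hgen ?_ hbc⟩)
      by_contra ubc
      rcases IsLocalRing.isUnit_or_isUnit_of_isUnit_add (a := b + c) (b := -c)
        (by simpa using ub) with h | h
      exacts [ubc h, uc (by simpa using h)]
  by_cases uc : IsUnit c
  · refine Or.inl ⟨hgen uc hc, hgen ?_ hbc⟩
    by_contra ubc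
    rcases IsLocalRing.isUnit_or_isUnit_of_isUnit_add (a := b + c) (b := -b)
      (by simpa using uc) with h | h
    exacts [ubc h, ub (by simpa using h)]
  exfalso
  -- `z` generates
  have ud : IsUnit d := by
    by_contra ud
    -- As in Nakayama's lemma: otherwise `s` would lie in the maximal ideal times `s`, although `s`
    -- is a nonzerodivisor.
    have hm : Ideal.span {a, b, c, d} ≤ IsLocalRing.maximalIdeal S := by
      rw [Ideal.span_le]
      rintro _ (rfl | rfl | rfl | rfl) <;> assumption
    have h1 : s ∈ (originIdealX k).map φ := hJ ▸ Ideal.mem_span_singleton_self s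
    have h2 : (originIdealX k).map φ ≤ IsLocalRing.maximalIdeal S * Ideal.span {s} := by
      rw [originIdealX, Ideal.map_map, map_originIdealA4, Ideal.span_le]
      rintro _ (rfl | rfl | rfl | rfl)
      · exact ha ▸ Ideal.mul_mem_mul ua (Ideal.mem_span_singleton_self s)
      · exact hb ▸ Ideal.mul_mem_mul ub (Ideal.mem_span_singleton_self s)
      · exact hc ▸ Ideal.mul_mem_mul uc (Ideal.mem_span_singleton_self s)
      · exact hd ▸ Ideal.mul_mem_mul ud (Ideal.mem_span_singleton_self s)
    obtain ⟨t, ht, hts⟩ := Ideal.mem_mul_span_singleton.mp (h2 h1)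
    have : (1 - t) * s = 0 := by rw [sub_mul, hts, one_mul, sub_self]
    have h1t := sub_eq_zero.mp (mem_nonZeroDivisors_iff_right.mp hs _ this)
    exact (IsLocalRing.mem_maximalIdeal t).mp ht (h1t ▸ isUnit_one)
  -- Cancelling the unit `d` in `e2` gives `d = -b a s`, so `b` divides a unit, contrary to `ub`.
  -- There is no point where `z` is the only generator.
  have h1 : d + b * a * s = 0 := by
    obtain ⟨d', hd'⟩ := ud.exists_left_inv
    linear_combination d' * e2 - (d + b * a * s) * hd'
  refine ub (isUnit_of_mul_isUnit_left (y := -(a * s)) ?_)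
  rwa [show b * -(a * s) = d by linear_combination -h1]

end

/-! ### Stalks as localizations -/

lemma isLocalization_germHom_id {R : Type u} [CommRing R] (p : PrimeSpectrum R) :
    @IsLocalization.AtPrime R _ ((Spec (CommRingCat.of R)).presheaf.stalk p) _
      (germHom (𝟙 (Spec (CommRingCat.of R))) p).toAlgebra p.asIdeal _ := by
  have h := StructureSheaf.IsLocalization.to_stalk R p
  have e : (germHom (𝟙 (Spec (CommRingCat.of R))) p).toAlgebra =
      StructureSheaf.stalkAlgebra R p := by
    refine Algebra.algebra_ext _ _ fun r => ?_
    change ((Spec (CommRingCat.of R)).presheaf.germ ⊤ p trivial).hom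
      (secHom (𝟙 (Spec (CommRingCat.of R))) ⊤ r) = _
    rw [secHom_top, Scheme.Hom.id_appTop, Category.comp_id]
    rfl
  rw [e]
  exact h

lemma isLocalization_germHom {R : Type u} [CommRing R] {W : Scheme.{u}}
    (j : W ⟶ Spec (CommRingCat.of R)) [IsOpenImmersion j] (b : W) (p : PrimeSpectrum R)
    (hp : j b = p) :
    @IsLocalization.AtPrime R _ (W.presheaf.stalk b) _ (germHom j b).toAlgebra p.asIdeal _ := by
  subst hp
  let := (germHom (𝟙 (Spec (CommRingCat.of R))) (j b)).toAlgebra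
  let := (germHom j b).toAlgebra
  have h := isLocalization_germHom_id (j b : PrimeSpectrum R)
  have hj : germHom j b = (j.stalkMap b).hom.comp (germHom (𝟙 _) (j b)) := by
    rw [← germHom_comp, Category.comp_id]
  let e : ((Spec (CommRingCat.of R)).presheaf.stalk (j b)) ≃ₐ[R] (W.presheaf.stalk b) :=
    AlgEquiv.ofRingEquiv (f := (asIso (j.stalkMap b)).commRingCatIsoToRingEquiv)
      fun r => (RingHom.congr_fun hj r).symm
  exact IsLocalization.isLocalization_of_algEquiv _ e

lemma fromSpecStalk_comp {R : Type u} [CommRing R] {T : Scheme.{u}}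
    (g : T ⟶ Spec (CommRingCat.of R)) (b : T) :
    T.fromSpecStalk b ≫ g = Spec.map (CommRingCat.ofHom (germHom g b)) := by
  conv_lhs => rw [toSpecΓ_comp_appTop g]
  rw [Scheme.fromSpecStalk_toSpecΓ_assoc, ← Spec.map_comp, ← Spec.map_comp, germHom, secHom_top]
  rfl

/-! ### Systems of coordinates -/

/-- The algebraic content of `Pair.IsSncAt`. -/
structure IsSncSystem {R S : Type*} [CommRing R] [IsLocalRing R] [CommRing S] (φ : R →+* S)
    {n : ℕ} (t : Fin n → R) (α : Fin n → ℚ) (D : PrimeSpectrum S → ℚ) : Prop where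
  regular : IsRegularSystem t
  components : ∀ p ∈ minimalPrimes S, ∃ I : Set (Fin n), p.comap φ = Ideal.span (t '' I)
  not_mem : ∀ j, α j ≠ 0 → ∀ p ∈ minimalPrimes S, φ (t j) ∉ p
  divisor : ∀ q, D q = ∑ j, open Classical in
    if q.asIdeal ∈ (Ideal.span {φ (t j)}).minimalPrimes then α j else 0

/-- `Pair.IsSncAt` speaks of local rings of open subschemes, whereas systems are built on charts;
the two local rings are isomorphic. -/
lemma IsSncSystem.comp {R S S' : Type*} [CommRing R] [IsLocalRing R] [CommRing S] [CommRing S']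
    {φ : R →+* S} {n : ℕ} {t : Fin n → R} {α : Fin n → ℚ} {D : PrimeSpectrum S → ℚ}
    (h : IsSncSystem φ t α D) (e : S →+* S') (he : Function.Bijective e) :
    IsSncSystem (e.comp φ) t α (fun q => D (PrimeSpectrum.comap e q)) := by
  have key : ∀ (I : Ideal S) (p : Ideal S'), p ∈ (I.map e).minimalPrimes ↔
      p.comap e ∈ I.minimalPrimes := by
    intro I p
    rw [← Ideal.comap_map_of_bijective e he (I := I),
      Ideal.comap_minimalPrimes_eq_of_surjective he.2, Ideal.comap_map_of_bijective e he]
    exact (Function.Injective.mem_set_image (Ideal.comap_injective_of_surjective e he.2)).symm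
  have key' : ∀ p ∈ minimalPrimes S', p.comap e ∈ minimalPrimes S := by
    intro p hp
    rw [minimalPrimes, ← key, Ideal.map_bot]
    exact hp
  refine ⟨h.regular, fun p hp => ?_, fun j hj p hp => ?_, fun q => ?_⟩
  · rw [← Ideal.comap_comap]
    exact h.components _ (key' p hp)
  · exact h.not_mem j hj _ (key' p hp)
  · rw [h.divisor]
    refine Finset.sum_congr rfl fun j _ => ?_
    have : q.asIdeal ∈ _ ↔ (PrimeSpectrum.comap e q).asIdeal ∈ _ :=
      key (Ideal.span {φ (t j)}) q.asIdeal
    rw [Ideal.map_span, Set.image_singleton] at this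
    split_ifs <;> first | rfl | tauto

/-- The range of `c`, identified with `V`, is the neighbourhood required by `Pair.IsSncAt`; what
remains is a question about one map of local rings. -/
theorem isSncAt_of_isSncSystem {k : Type u} [Field k] (P : Pair k) {V Z : Scheme.{u}}
    (c : V ⟶ P.X) [IsOpenImmersion c] (b : V) (g : Z ⟶ Spec (CommRingCat.of k)) [Smooth g]
    (i : V ⟶ Z) [IsClosedImmersion i] (hi : i ≫ g = c ≫ P.str)
    (h : ∃ (n : ℕ) (t : Fin n → Z.presheaf.stalk (i b)) (α : Fin n → ℚ),
      IsSncSystem (i.stalkMap b).hom t α fun q => P.D (c (V.fromSpecStalk b q))) :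
    P.IsSncAt (c b) := by
  have main : ∀ (U : P.X.Opens) (e : U.toScheme ⟶ V) [IsIso e] (_ : e ≫ c = U.ι)
      (a : U.toScheme) (_ : b = e a), P.IsSncAt a.1 := by
    rintro U e _ hec a rfl
    obtain ⟨n, t, α, ht⟩ := h
    refine ⟨U, a.2, Z, g, e ≫ i, inferInstance, inferInstance, ?_, n, t, α, ?_⟩
    · rw [Category.assoc, hi, reassoc_of% hec]
    have h' := ht.comp (e.stalkMap a).hom (ConcreteCategory.bijective_of_isIso (e.stalkMap a))
    have e1 : (Scheme.Hom.stalkMap (e ≫ i) a).hom = (e.stalkMap a).hom.comp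
        (i.stalkMap (e a)).hom := by
      rw [Scheme.Hom.stalkMap_comp]; rfl
    rw [← e1] at h'
    refine ⟨h'.regular, h'.components, h'.not_mem, fun q => ?_⟩
    refine Eq.trans ?_ (h'.divisor q)
    have e2 := Scheme.SpecMap_stalkMap_fromSpecStalk (f := e) (x := a)
    have e3 := congrArg (· ≫ c) e2
    simp only [Category.assoc, hec] at e3
    exact congrArg P.D (congrArg (fun f : Spec _ ⟶ P.X => f q) e3.symm)
  exact main c.opensRange c.isoOpensRange.inv (by simp) ⟨c b, ⟨b, rfl⟩⟩ (by
    refine c.isOpenEmbedding.injective ?_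
    exact congrArg (fun f : c.opensRange.toScheme ⟶ P.X => f ⟨c b, ⟨b, rfl⟩⟩)
      (show c.opensRange.ι = c.isoOpensRange.inv ≫ c by simp))

/-! ### Regular systems of coordinates -/

/-- By Krull's height theorem no system of generators has fewer elements than the height. -/
lemma isRegularSystem_of_card_le_height {O : Type*} [CommRing O] [IsLocalRing O]
    [IsNoetherianRing O] {n : ℕ} (t : Fin n → O)
    (ht : Ideal.span (Set.range t) = IsLocalRing.maximalIdeal O)
    (hh : n ≤ (IsLocalRing.maximalIdeal O).height) : IsRegularSystem t := by
  refine ⟨ht, le_antisymm ?_ ?_⟩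
  · have := (IsLocalRing.maximalIdeal O).height_le_spanFinrank Ideal.IsPrime.ne_top'
    exact_mod_cast hh.trans this
  · rw [← ht]
    refine (Submodule.spanFinrank_span_le_ncard_of_finite (Set.finite_range t)).trans ?_
    rw [← Set.image_univ]
    exact (Set.ncard_image_le Set.finite_univ).trans (by simp)

lemma exists_isRegularSystem (O : Type*) [CommRing O] [IsLocalRing O] [IsNoetherianRing O] :
    ∃ (n : ℕ) (t : Fin n → O), IsRegularSystem t := by
  have hfg := (IsLocalRing.maximalIdeal O).fg_of_isNoetherianRing
  have hfin : (IsLocalRing.maximalIdeal O).generators.Finite := Submodule.FG.finite_generators hfg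
  have := hfin.fintype
  let e := (Fintype.equivFin (IsLocalRing.maximalIdeal O).generators).symm
  refine ⟨_, fun i => (e i : O), ?_, ?_⟩
  · have : Set.range (fun i => (e i : O)) = (IsLocalRing.maximalIdeal O).generators := by
      rw [← Function.comp_def, Set.range_comp, e.range_eq_univ, Set.image_univ,
        Subtype.range_coe]
    rw [this]
    exact (IsLocalRing.maximalIdeal O).span_generators
  · rw [← Submodule.FG.generators_ncard hfg, ← Nat.card_eq_fintype_card, Nat.card_coe_set_eq]

/-- A system of generators of a prime ideal of height at least the number of the generators, over
which the maximal ideal needs only one further generator, extends to a system of coordinates. -/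
lemma exists_isRegularSystem_extending {O : Type*} [CommRing O] [IsLocalRing O]
    [IsNoetherianRing O] {r : ℕ} (t : Fin r → O) (hp : (Ideal.span (Set.range t)).IsPrime)
    (hh : r ≤ (Ideal.span (Set.range t)).height) (s : O)
    (hs : IsLocalRing.maximalIdeal O = Ideal.span (Set.range t) ⊔ Ideal.span {s}) :
    ∃ (n : ℕ) (h : r ≤ n) (t' : Fin n → O), IsRegularSystem t' ∧
      ∀ j, t' (Fin.castLE h j) = t j := by
  by_cases hst : s ∈ Ideal.span (Set.range t)
  · have hm : Ideal.span (Set.range t) = IsLocalRing.maximalIdeal O := by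
      rw [hs, left_eq_sup, Ideal.span_singleton_le_iff_mem]
      exact hst
    exact ⟨r, le_rfl, t, isRegularSystem_of_card_le_height t hm (hm ▸ hh), fun j => rfl⟩
  -- Here the maximal ideal is strictly larger than the prime spanned by `t`, so its height is at
  -- least `r + 1`.
  · refine ⟨r + 1, Nat.le_succ r, Fin.snoc t s, isRegularSystem_of_card_le_height _ ?_ ?_,
      fun j => Fin.snoc_castSucc (α := fun _ => O) s t j⟩
    · rw [hs, Fin.range_snoc, Ideal.span_insert, sup_comm]
    · have hlt : Ideal.span (Set.range t) < IsLocalRing.maximalIdeal O := by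
        rw [hs, left_lt_sup, Ideal.span_singleton_le_iff_mem]
        exact hst
      refine le_trans ?_ (Ideal.height_add_one_le_of_lt_of_isPrime hlt)
      push_cast
      exact add_le_add_left hh 1

/-- The image of `q` in `R'` is principal. With `R' = k[X]`, the ideal of a point on a line needs at
most one generator besides the equations of the line. -/
lemma exists_eq_sup_span_singleton {R R' : Type*} [CommRing R] [CommRing R']
    [IsPrincipalIdealRing R'] (ε : R →+* R') (hε : Function.Surjective ε) {q : Ideal R}
    (hq : RingHom.ker ε ≤ q) : ∃ s, q = RingHom.ker ε ⊔ Ideal.span {s} := by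
  obtain ⟨g, hg⟩ := IsPrincipalIdealRing.principal (q.map ε)
  obtain ⟨s, rfl⟩ := hε g
  refine ⟨s, ?_⟩
  have h1 : (q.map ε).comap ε = q := by
    rw [Ideal.comap_map_of_surjective _ hε, ← RingHom.ker_eq_comap_bot, sup_eq_left]
    exact hq
  have h2 : ((Ideal.span {s}).map ε).comap ε = Ideal.span {s} ⊔ RingHom.ker ε := by
    rw [Ideal.comap_map_of_surjective _ hε, ← RingHom.ker_eq_comap_bot]
  rw [← h1, hg, sup_comm, ← h2, Ideal.map_span, Set.image_singleton]

/-! ### Primes of a localization at a prime -/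

section AtPrime

variable {R O : Type*} [CommRing R] [CommRing O] [Algebra R O] {q : Ideal R}
  [hq : q.IsPrime] [IsLocalization.AtPrime O q]

lemma disjoint_primeCompl {p : Ideal R} (h : p ≤ q) :
    Disjoint (q.primeCompl : Set R) (p : Set R) :=
  Set.disjoint_left.mpr fun _ ha hb => ha (h hb)

lemma isPrime_map_of_le {p : Ideal R} [hp : p.IsPrime] (h : p ≤ q) :
    (p.map (algebraMap R O)).IsPrime :=
  IsLocalization.isPrime_of_isPrime_disjoint q.primeCompl O p hp (disjoint_primeCompl h)

lemma comap_map_of_le {p : Ideal R} [hp : p.IsPrime] (h : p ≤ q) :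
    (p.map (algebraMap R O)).comap (algebraMap R O) = p :=
  IsLocalization.under_map_of_isPrime_disjoint q.primeCompl O hp (disjoint_primeCompl h)

lemma map_comap_atPrime (q : Ideal R) [q.IsPrime] [IsLocalization.AtPrime O q] (p : Ideal O) :
    (p.comap (algebraMap R O)).map (algebraMap R O) = p :=
  IsLocalization.map_under q.primeCompl O p

lemma maximalIdeal_eq_map (q : Ideal R) [q.IsPrime] [IsLocalization.AtPrime O q]
    [IsLocalRing O] : IsLocalRing.maximalIdeal O = q.map (algebraMap R O) := by
  rw [← map_comap_atPrime q (IsLocalRing.maximalIdeal O)]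
  congr 1
  exact IsLocalization.AtPrime.under_maximalIdeal O q

end AtPrime

/-! ### Snc systems on a smooth surface -/

section Plane

variable {k : Type u} [Field k]

/-- Restriction to the line `v = 0`. -/
def restrictLine (k : Type u) [Field k] : M k →ₐ[k] Polynomial k :=
  MvPolynomial.aeval ![Polynomial.X, 0]

lemma restrictLine_surjective : Function.Surjective (restrictLine k) := by
  intro p
  refine ⟨Polynomial.aeval (uu k) p, ?_⟩
  have : (restrictLine k).comp (Polynomial.aeval (uu k)) = AlgHom.id k _ := by
    ext
    simp [restrictLine]
  exact AlgHom.congr_fun this p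

lemma ker_restrictLine : RingHom.ker (restrictLine k).toRingHom = Ideal.span {vv k} := by
  refine le_antisymm (fun a ha => ?_) ?_
  · have : ((Ideal.Quotient.mkₐ k (Ideal.span {vv k})).comp (Polynomial.aeval (uu k))).comp
        (restrictLine k) = Ideal.Quotient.mkₐ k (Ideal.span {vv k}) := by
      refine MvPolynomial.algHom_ext fun i => ?_
      fin_cases i
      · simp [restrictLine]
      · simp [restrictLine]
    have h := AlgHom.congr_fun this a
    have h0 : restrictLine k a = 0 := ha
    rw [AlgHom.comp_apply, h0, map_zero] at h
    exact Ideal.Quotient.eq_zero_iff_mem.mp h.symm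
  · rw [Ideal.span_singleton_le_iff_mem]
    simp [RingHom.mem_ker, restrictLine]

lemma vv_ne_zero : vv k ≠ 0 := MvPolynomial.X_ne_zero _

instance isPrime_span_vv : (Ideal.span {vv k}).IsPrime :=
  (Ideal.span_singleton_prime vv_ne_zero).mpr MvPolynomial.X_prime

open Classical in
/-- On a smooth surface with coordinates `u`, `v` every divisor `α (v = 0)` is snc. -/
lemma exists_isSncSystem_plane {O : Type u} [CommRing O] [IsLocalRing O] [Algebra (M k) O]
    (q : Ideal (M k)) [q.IsPrime] [IsLocalization.AtPrime O q] (α : ℚ)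
    (D : PrimeSpectrum O → ℚ)
    (hD : ∀ p, D p = if p.asIdeal.comap (algebraMap (M k) O) = Ideal.span {vv k} then α else 0) :
    ∃ (n : ℕ) (t : Fin n → O) (β : Fin n → ℚ), IsSncSystem (RingHom.id O) t β D := by
  have : IsNoetherianRing O := IsLocalization.isNoetherianRing q.primeCompl O inferInstance
  have : IsDomain O := IsLocalization.isDomain_of_le_nonZeroDivisors (M := q.primeCompl) O
    q.primeCompl_le_nonZeroDivisors
  have hmin : ∀ p ∈ minimalPrimes O, p = ⊥ := by
    intro p hp
    rw [IsDomain.minimalPrimes_eq_singleton_bot] at hp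
    exact hp
  have hle : ∀ p : PrimeSpectrum O, p.asIdeal.comap (algebraMap (M k) O) ≤ q := by
    intro p
    have := Ideal.comap_mono (f := algebraMap (M k) O)
      (IsLocalRing.le_maximalIdeal p.isPrime.ne_top)
    exact this.trans (IsLocalization.AtPrime.under_maximalIdeal O q).le
  have hcomp : ∀ {n : ℕ} (t : Fin n → O), ∀ p ∈ minimalPrimes O, ∃ I : Set (Fin n),
      p.comap (RingHom.id O) = Ideal.span (t '' I) := fun t p hp =>
    ⟨∅, by rw [hmin p hp, Set.image_empty, Ideal.span_empty, Ideal.comap_id]⟩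
  -- If the line `v = 0` passes through the point, `v` is extended to a system of coordinates.
  -- Otherwise `D` vanishes on the local ring and any minimal system of generators serves.
  by_cases hv : vv k ∈ q
  · have hvq : Ideal.span {vv k} ≤ q := (Ideal.span_singleton_le_iff_mem _).mpr hv
    have hmap : (Ideal.span {vv k}).map (algebraMap (M k) O) =
        Ideal.span {algebraMap (M k) O (vv k)} := by rw [Ideal.map_span, Set.image_singleton]
    have hprime : (Ideal.span {algebraMap (M k) O (vv k)}).IsPrime :=
      hmap ▸ isPrime_map_of_le hvq
    have hv0 : algebraMap (M k) O (vv k) ≠ 0 := fun h => vv_ne_zero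
      (IsLocalization.injective O q.primeCompl_le_nonZeroDivisors (h.trans (map_zero _).symm))
    obtain ⟨s, hs⟩ := exists_eq_sup_span_singleton (restrictLine k).toRingHom
      restrictLine_surjective (ker_restrictLine.trans_le hvq)
    rw [ker_restrictLine] at hs
    have hm := maximalIdeal_eq_map (O := O) q
    rw [hs, Ideal.map_sup, hmap, Ideal.map_span, Set.image_singleton] at hm
    have hr : Set.range (fun _ : Fin 1 => algebraMap (M k) O (vv k)) =
      {algebraMap (M k) O (vv k)} := Set.range_const
    obtain ⟨n, hn, t, ht, htv⟩ := exists_isRegularSystem_extending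
      (fun _ : Fin 1 => algebraMap (M k) O (vv k)) (by rwa [hr])
      (by
        rw [hr, Nat.cast_one, Order.one_le_iff_ne_zero]
        intro h0
        have := Ideal.height_add_one_le_of_lt_of_isPrime
          (bot_lt_iff_ne_bot.mpr (Ideal.span_singleton_eq_bot.not.mpr hv0))
        rw [h0] at this
        simp at this) _ (by rwa [hr])
    have htv0 := htv 0
    refine ⟨n, t, fun j => if j = Fin.castLE hn 0 then α else 0, ht, hcomp t, ?_, ?_⟩
    · intro j hj p hp
      have : j = Fin.castLE hn 0 := by
        by_contra h
        exact hj (if_neg h)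
      rw [hmin p hp, this, htv0]
      exact hv0
    · intro p
      rw [hD, Finset.sum_eq_single (Fin.castLE hn 0)]
      · rw [htv0, RingHom.id_apply, if_pos rfl]
        have hmem : p.asIdeal ∈ (Ideal.span {algebraMap (M k) O (vv k)}).minimalPrimes ↔
            p.asIdeal = Ideal.span {algebraMap (M k) O (vv k)} := by
          rw [Ideal.minimalPrimes_eq_subsingleton_self, Set.mem_singleton_iff]
        refine if_congr (Iff.trans ⟨fun h => ?_, fun h => ?_⟩ hmem.symm) rfl rfl
        · rw [← map_comap_atPrime q p.asIdeal, h, hmap]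
        · rw [h, ← hmap, comap_map_of_le hvq]
      · intro j _ hj
        rw [if_neg hj, ite_self]
      · intro h; exact absurd (Finset.mem_univ _) h
  · obtain ⟨n, t, ht⟩ := exists_isRegularSystem O
    refine ⟨n, t, 0, ht, hcomp t, fun j hj => absurd rfl hj, fun p => ?_⟩
    rw [hD, if_neg]
    · simp
    · intro h
      exact hv (hle p (h ▸ Ideal.mem_span_singleton_self (vv k)))

end Plane

section

variable {k : Type u} [Field k]

instance smooth_Spec_mvPolynomial (n : ℕ) : Smooth (Spec.map (CommRingCat.ofHom
    (algebraMap k (MvPolynomial (Fin n) k)))) := by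
  rw [HasRingHomProperty.Spec_iff (P := @Smooth)]
  rw [CommRingCat.hom_ofHom]
  exact (RingHom.smooth_algebraMap (R := k) (S := MvPolynomial (Fin n) k)).mpr
    ⟨inferInstance, inferInstance⟩

open Classical in
/-- A pair is snc at the points of an open smooth surface on which the cycle is `α (v = 0)`. -/
theorem isSncAt_plane (P : Pair k) {W : Scheme.{u}} (c : W ⟶ P.X) [IsOpenImmersion c]
    (j : W ⟶ Spec (CommRingCat.of (M k))) [IsOpenImmersion j]
    (hj : j ≫ Spec.map (CommRingCat.ofHom (algebraMap k (M k))) = c ≫ P.str) (α : ℚ)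
    (hD : ∀ b : W, P.D (c b) =
      if (show PrimeSpectrum (M k) from j b).asIdeal = Ideal.span {vv k} then α else 0) (b : W) :
    P.IsSncAt (c b) := by
  -- `W` is smooth, so it serves as its own ambient space `Z`.
  have : Smooth (c ≫ P.str) := hj ▸ inferInstance
  refine isSncAt_of_isSncSystem P c b (c ≫ P.str) (𝟙 W) (Category.id_comp _) ?_
  let p : PrimeSpectrum (M k) := j b
  let := (germHom j b).toAlgebra
  have hloc : IsLocalization.AtPrime (W.presheaf.stalk b) p.asIdeal :=
    isLocalization_germHom j b p rfl
  obtain ⟨n, t, β, h⟩ := exists_isSncSystem_plane (O := W.presheaf.stalk b) p.asIdeal α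
    (fun q => P.D (c (W.fromSpecStalk b q))) (fun q => by
      rw [hD]
      have e := congrArg (fun f : Spec _ ⟶ Spec (CommRingCat.of (M k)) => f q)
        (fromSpecStalk_comp j b)
      have e' : (show PrimeSpectrum (M k) from j (W.fromSpecStalk b q)).asIdeal =
        q.asIdeal.comap (algebraMap (M k) (W.presheaf.stalk b)) := congrArg PrimeSpectrum.asIdeal e
      rw [e'])
  refine ⟨n, t, β, ?_⟩
  rw [Scheme.Hom.stalkMap_id]
  exact h

end

/-! ### The `w`-axis away from the origin -/

section Axis

variable {k : Type u} [Field k]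

variable (k) in
/-- The ideal of the `w`-axis. -/
def axisIdeal : Ideal (A k) := Ideal.span {x k, y k, z k}

variable (k) in
/-- Restriction to the `w`-axis. -/
def restrictAxis : A k →ₐ[k] Polynomial k := MvPolynomial.aeval ![Polynomial.X, 0, 0, 0]

lemma restrictAxis_surjective : Function.Surjective (restrictAxis k) := by
  intro p
  refine ⟨Polynomial.aeval (w k) p, ?_⟩
  have : (restrictAxis k).comp (Polynomial.aeval (w k)) = AlgHom.id k _ := by
    ext
    simp [restrictAxis]
  exact AlgHom.congr_fun this p

lemma ker_restrictAxis : RingHom.ker (restrictAxis k).toRingHom = axisIdeal k := by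
  refine le_antisymm (fun a ha => ?_) ?_
  · have : ((Ideal.Quotient.mkₐ k (axisIdeal k)).comp (Polynomial.aeval (w k))).comp
        (restrictAxis k) = Ideal.Quotient.mkₐ k (axisIdeal k) := by
      have h0 : ∀ a ∈ ({x k, y k, z k} : Set (A k)), Ideal.Quotient.mk (axisIdeal k) a = 0 :=
        fun a ha => Ideal.Quotient.eq_zero_iff_mem.mpr (Ideal.subset_span ha)
      refine MvPolynomial.algHom_ext fun i => ?_
      fin_cases i
      · simp [restrictAxis]
      · simpa [restrictAxis] using (h0 (x k) (by simp)).symm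
      · simpa [restrictAxis] using (h0 (y k) (by simp)).symm
      · simpa [restrictAxis] using (h0 (z k) (by simp)).symm
    have h := AlgHom.congr_fun this a
    have h0 : restrictAxis k a = 0 := ha
    rw [AlgHom.comp_apply, h0, map_zero] at h
    exact Ideal.Quotient.eq_zero_iff_mem.mp h.symm
  · rw [axisIdeal, Ideal.span_le]
    rintro _ (rfl | rfl | rfl) <;> simp [RingHom.mem_ker, restrictAxis]

instance isPrime_axisIdeal : (axisIdeal k).IsPrime := by
  rw [← ker_restrictAxis]
  exact RingHom.ker_isPrime _

/-- The chain `0 < (z) < (z, x) < (x, y, z)` of primes. -/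
lemma three_le_height_axisIdeal : 3 ≤ (axisIdeal k).height := by
  have hz : (Ideal.span {z k}).IsPrime :=
    (Ideal.span_singleton_prime (MvPolynomial.X_ne_zero _)).mpr MvPolynomial.X_prime
  have := (isPlane₁ k).isPrime
  have h1 : (⊥ : Ideal (A k)) < Ideal.span {z k} := bot_lt_iff_ne_bot.mpr
    (Ideal.span_singleton_eq_bot.not.mpr (MvPolynomial.X_ne_zero _))
  have h2 : Ideal.span {z k} < P₁ k := by
    refine lt_of_le_of_ne (Ideal.span_mono (by simp)) fun h => ?_
    have hx : x k ∈ P₁ k := Ideal.subset_span (by simp)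
    rw [← h, Ideal.mem_span_singleton] at hx
    simp [MvPolynomial.X_dvd_X] at hx
  have h3 : P₁ k < axisIdeal k := by
    refine lt_of_le_of_ne (Ideal.span_mono fun a => ?_) fun h => ?_
    · rintro (rfl | rfl) <;> simp
    have hy : y k ∈ axisIdeal k := Ideal.subset_span (by simp)
    rw [← h, (isPlane₁ k).mem_iff, (isPlane₁ k).map_f] at hy
    exact MvPolynomial.X_ne_zero _ hy
  have e1 := Ideal.height_add_one_le_of_lt_of_isPrime h1
  have e2 := Ideal.height_add_one_le_of_lt_of_isPrime h2
  have e3 := Ideal.height_add_one_le_of_lt_of_isPrime h3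
  refine le_trans (le_trans ?_ (add_le_add_left (le_trans (add_le_add_left e1 1) e2) 1)) e3
  rw [add_assoc, add_assoc]
  exact le_add_left (by norm_num)

/-- `X` is snc along the `w`-axis away from the origin: there the three components of `X` are
coordinate subspaces for the coordinates `z`, `z + x w`, `z - y w` of `𝔸⁴`. -/
lemma exists_isSncSystem_axis {O S : Type u} [CommRing O] [CommRing S] [IsLocalRing O]
    [Algebra (A k) O] [Algebra (RX k) S] (q : Ideal (RX k)) [q.IsPrime]
    [IsLocalization.AtPrime S q] [IsLocalization.AtPrime O (q.comap (mkX k))] (φ : O →+* S)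
    (hφ : φ.comp (algebraMap (A k) O) = (algebraMap (RX k) S).comp (mkX k))
    (hq : axisIdeal k ≤ q.comap (mkX k)) (hw : w k ∉ q.comap (mkX k)) :
    ∃ (n : ℕ) (t : Fin n → O), IsSncSystem φ t 0 fun _ => 0 := by
  obtain ⟨Q, hQ⟩ : ∃ Q, Q = q.comap (mkX k) := ⟨_, rfl⟩
  have hQp : Q.IsPrime := hQ ▸ inferInstance
  rw [← hQ] at hq hw
  have hloc : IsLocalization.AtPrime O Q := by subst hQ; assumption
  have : IsNoetherianRing O := IsLocalization.isNoetherianRing Q.primeCompl O inferInstance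
  let ι := algebraMap (A k) O
  have hwu : IsUnit (ι (w k)) := IsLocalization.map_units O (⟨w k, hw⟩ : Q.primeCompl)
  obtain ⟨w', hw'⟩ := hwu.exists_left_inv
  -- `w x = t₁ - t₀`, `w y = t₀ - t₂` and `w (x + y) = t₁ - t₂`. With `w` a unit, each plane is
  -- given by two of the three coordinates, and the axis by all three.
  let t₀ : Fin 3 → O := ![ι (z k), ι (z k + x k * w k), ι (z k - y k * w k)]
  have hspan : ∀ {s : Set (A k)} {s' : Set O}, (∀ a ∈ s, ι a ∈ Ideal.span s') →
      (∀ b ∈ s', b ∈ (Ideal.span s).map ι) → (Ideal.span s).map ι = Ideal.span s' := by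
    intro s s' h1 h2
    refine le_antisymm ?_ (Ideal.span_le.mpr h2)
    rw [Ideal.map_span, Ideal.span_le]
    rintro _ ⟨a, ha, rfl⟩
    exact h1 a ha
  have hmem : ∀ {s : Set (A k)} {a : A k}, a ∈ Ideal.span s → ι a ∈ (Ideal.span s).map ι :=
    fun h => Ideal.mem_map_of_mem ι h
  -- the three planes and the axis in terms of `t₀`
  have hx : ∀ {s : Set O}, t₀ 0 ∈ s → t₀ 1 ∈ s → ι (x k) ∈ Ideal.span s := fun {s} h0 h1 => by
    have : ι (x k) = w' * (t₀ 1 - t₀ 0) := by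
      simp only [t₀, Matrix.cons_val, map_add, map_mul]
      linear_combination (- ι (x k)) * hw'
    rw [this]
    exact Ideal.mul_mem_left _ _ (Ideal.sub_mem _ (Ideal.subset_span h1) (Ideal.subset_span h0))
  have hy : ∀ {s : Set O}, t₀ 0 ∈ s → t₀ 2 ∈ s → ι (y k) ∈ Ideal.span s := fun {s} h0 h1 => by
    have : ι (y k) = w' * (t₀ 0 - t₀ 2) := by
      simp only [t₀, Matrix.cons_val, map_sub, map_mul]
      linear_combination (- ι (y k)) * hw'
    rw [this]
    exact Ideal.mul_mem_left _ _ (Ideal.sub_mem _ (Ideal.subset_span h0) (Ideal.subset_span h1))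
  have hxy : ∀ {s : Set O}, t₀ 1 ∈ s → t₀ 2 ∈ s → ι (x k + y k) ∈ Ideal.span s :=
    fun {s} h0 h1 => by
    have : ι (x k + y k) = w' * (t₀ 1 - t₀ 2) := by
      simp only [t₀, Matrix.cons_val, map_add, map_sub, map_mul]
      linear_combination (- ι (x k) - ι (y k)) * hw'
    rw [this]
    exact Ideal.mul_mem_left _ _ (Ideal.sub_mem _ (Ideal.subset_span h0) (Ideal.subset_span h1))
  have hP1 : (P₁ k).map ι = Ideal.span (t₀ '' {0, 1}) := by
    have hz' : z k ∈ Ideal.span {z k, x k} := Ideal.subset_span (by simp)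
    have hx' : x k ∈ Ideal.span {z k, x k} := Ideal.subset_span (by simp)
    refine hspan ?_ ?_
    · rintro _ (rfl | rfl)
      · exact Ideal.subset_span ⟨0, by simp, rfl⟩
      · exact hx ⟨0, by simp, rfl⟩ ⟨1, by simp, rfl⟩
    · rintro _ ⟨_, rfl | rfl, rfl⟩
      · exact hmem hz'
      · exact hmem (Ideal.add_mem _ hz' (Ideal.mul_mem_right _ _ hx'))
  have hP2 : (P₂ k).map ι = Ideal.span (t₀ '' {0, 2}) := by
    have hz' : z k ∈ Ideal.span {z k, y k} := Ideal.subset_span (by simp)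
    have hy' : y k ∈ Ideal.span {z k, y k} := Ideal.subset_span (by simp)
    refine hspan ?_ ?_
    · rintro _ (rfl | rfl)
      · exact Ideal.subset_span ⟨0, by simp, rfl⟩
      · exact hy ⟨0, by simp, rfl⟩ ⟨2, by simp, rfl⟩
    · rintro _ ⟨_, rfl | rfl, rfl⟩
      · exact hmem hz'
      · exact hmem (Ideal.sub_mem _ hz' (Ideal.mul_mem_right _ _ hy'))
  have hP3 : (P₃ k).map ι = Ideal.span (t₀ '' {1, 2}) := by
    have h1 : z k + x k * w k ∈ Ideal.span {z k + x k * w k, x k + y k} :=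
      Ideal.subset_span (by simp)
    have h2 : x k + y k ∈ Ideal.span {z k + x k * w k, x k + y k} := Ideal.subset_span (by simp)
    refine hspan ?_ ?_
    · rintro _ (rfl | rfl)
      · exact Ideal.subset_span ⟨1, by simp, rfl⟩
      · exact hxy ⟨1, by simp, rfl⟩ ⟨2, by simp, rfl⟩
    · rintro _ ⟨_, rfl | rfl, rfl⟩
      · exact hmem h1
      · refine hmem ?_
        rw [show z k - y k * w k = z k + x k * w k - w k * (x k + y k) by ring]
        exact Ideal.sub_mem _ h1 (Ideal.mul_mem_left _ _ h2)
  have hL : (axisIdeal k).map ι = Ideal.span (Set.range t₀) := by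
    have h1 : x k ∈ Ideal.span {x k, y k, z k} := Ideal.subset_span (by simp)
    have h2 : y k ∈ Ideal.span {x k, y k, z k} := Ideal.subset_span (by simp)
    have h3 : z k ∈ Ideal.span {x k, y k, z k} := Ideal.subset_span (by simp)
    refine hspan ?_ ?_
    · rintro _ (rfl | rfl | rfl)
      · exact hx ⟨0, rfl⟩ ⟨1, rfl⟩
      · exact hy ⟨0, rfl⟩ ⟨2, rfl⟩
      · exact Ideal.subset_span ⟨0, rfl⟩
    · rintro _ ⟨i, rfl⟩
      fin_cases i
      · exact hmem h3
      · exact hmem (Ideal.add_mem _ h3 (Ideal.mul_mem_right _ _ h1))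
      · exact hmem (Ideal.sub_mem _ h3 (Ideal.mul_mem_right _ _ h2))
  obtain ⟨s, hs⟩ := exists_eq_sup_span_singleton (restrictAxis k).toRingHom
    restrictAxis_surjective (ker_restrictAxis.trans_le hq)
  have hm := maximalIdeal_eq_map (O := O) Q
  rw [hs, ker_restrictAxis, Ideal.map_sup, hL, Ideal.map_span, Set.image_singleton] at hm
  obtain ⟨n, hn, t, ht, htv⟩ := exists_isRegularSystem_extending t₀
    (hL ▸ isPrime_map_of_le hq)
    (by
      rw [← hL, IsLocalization.height_map_of_disjoint Q.primeCompl _ (disjoint_primeCompl hq)]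
      exact three_le_height_axisIdeal) _ hm
  have hI : ∀ I₀ : Set (Fin 3), t '' (Fin.castLE hn '' I₀) = t₀ '' I₀ := fun I₀ => by
    rw [Set.image_image]
    exact Set.image_congr fun j _ => htv j
  refine ⟨n, t, ht, fun p hp => ?_, fun j hj => absurd rfl hj, fun _ => by simp⟩
  have hpp : p.IsPrime := hp.1.1
  have hcc : (p.comap φ).comap ι = (p.comap (algebraMap (RX k) S)).comap (mkX k) := by
    rw [Ideal.comap_comap, Ideal.comap_comap, hφ]
  -- The contraction of `p` contains the ideal of `X`, hence that of one plane. The extension of the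
  -- latter to `S` is a prime inside `p`, so it equals `p` by minimality.
  have hcomp : ∀ (P : Ideal (A k)) (_ : P.IsPrime), idealX k ≤ P → P ≤ (p.comap φ).comap ι →
      p.comap φ = P.map ι := by
    intro P hPp hXP hP
    have hker : RingHom.ker (mkX k) ≤ P := by rwa [Ideal.mk_ker]
    have hT : (P.map (mkX k)).IsPrime := Ideal.map_isPrime_of_surjective mkX_surjective hker
    have hTp : P.map (mkX k) ≤ p.comap (algebraMap (RX k) S) := by
      rw [Ideal.map_le_iff_le_comap, ← hcc]; exact hP
    have hTq : P.map (mkX k) ≤ q := by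
      refine hTp.trans ?_
      have := IsLocalization.AtPrime.isLocalRing S q
      exact (Ideal.comap_mono (IsLocalRing.le_maximalIdeal hpp.ne_top)).trans
        (IsLocalization.AtPrime.under_maximalIdeal S q).le
    have hTS : ((P.map (mkX k)).map (algebraMap (RX k) S)).IsPrime := isPrime_map_of_le hTq
    have hpe : p = (P.map (mkX k)).map (algebraMap (RX k) S) :=
      le_antisymm (hp.2 ⟨hTS, bot_le⟩ (Ideal.map_le_iff_le_comap.mpr hTp))
        (Ideal.map_le_iff_le_comap.mpr hTp)
    rw [← map_comap_atPrime Q (p.comap φ)]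
    congr 1
    change (p.comap φ).comap ι = P
    rw [hcc, hpe, comap_map_of_le hTq, Ideal.comap_map_of_surjective _ mkX_surjective,
      ← RingHom.ker_eq_comap_bot, sup_eq_left]
    exact hker
  have hle : idealX k ≤ (p.comap φ).comap ι := by
    rw [hcc]
    intro a ha
    rw [Ideal.mem_comap, Ideal.Quotient.eq_zero_iff_mem.mpr ha]
    exact zero_mem _
  have hpA : ((p.comap φ).comap ι).IsPrime := inferInstance
  rw [idealX_eq, hpA.inf_le, hpA.inf_le] at hle
  rcases hle with (hle | hle) | hle
  · exact ⟨_, by rw [hI, ← hP1]; exact hcomp _ (isPlane₁ k).isPrime isComponent₁.idealX_le hle⟩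
  · exact ⟨_, by rw [hI, ← hP2]; exact hcomp _ (isPlane₂ k).isPrime isComponent₂.idealX_le hle⟩
  · exact ⟨_, by rw [hI, ← hP3]; exact hcomp _ (isPlane₃ k).isPrime isComponent₃.idealX_le hle⟩

instance isClosedImmersion_incl : IsClosedImmersion (incl k) :=
  IsClosedImmersion.spec_of_surjective _ mkX_surjective

lemma incl_comp : incl k ≫ Spec.map (CommRingCat.ofHom (algebraMap k (A k))) = strX k := by
  rw [incl, strX, ← Spec.map_comp]
  rfl

/-- A pair is snc at the points of the `w`-axis other than the origin in an open copy of `X`, if its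
cycle is concentrated on `w = 0`. -/
theorem isSncAt_axis (P : Pair k) (c : X k ⟶ P.X) [IsOpenImmersion c] (hc : c ≫ P.str = strX k)
    (hD : ∀ q : PrimeSpectrum (RX k), mkX k (w k) ∉ q.asIdeal → P.D (c q) = 0)
    (q : PrimeSpectrum (RX k)) (hq : axisIdeal k ≤ q.asIdeal.comap (mkX k))
    (hw : mkX k (w k) ∉ q.asIdeal) : P.IsSncAt (c q) := by
  refine isSncAt_of_isSncSystem P c q (Spec.map (CommRingCat.ofHom (algebraMap k (A k))))
    (incl k) (incl_comp.trans hc.symm) ?_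
  let b : X k := q
  let O := (A4 k).presheaf.stalk (incl k b)
  let S := (X k).presheaf.stalk b
  let := (germHom (𝟙 (A4 k)) (incl k b)).toAlgebra
  let := (germHom (𝟙 (X k)) b).toAlgebra
  have hO : IsLocalization.AtPrime O (q.asIdeal.comap (mkX k)) :=
    isLocalization_germHom (𝟙 (A4 k)) (incl k b) (PrimeSpectrum.comap (mkX k) q) rfl
  have hS : IsLocalization.AtPrime S q.asIdeal := isLocalization_germHom (𝟙 (X k)) b q rfl
  obtain ⟨n, t, ht⟩ := exists_isSncSystem_axis (O := O) (S := S) q.asIdeal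
    ((incl k).stalkMap b).hom (by
      change _ = (germHom (𝟙 (X k)) b).comp (mkX k)
      have e1 := germHom_comp (incl k) (𝟙 (A4 k)) b
      have e2 := germHom_comp_Spec_map (𝟙 (X k)) (mkX k) b
      rw [← e2, ← incl.eq_1, Category.id_comp]
      rw [Category.comp_id] at e1
      exact e1.symm) hq hw
  refine ⟨n, t, 0, ?_⟩
  -- Every generization of `q` also avoids `w = 0`, so no component of the cycle passes through `q`.
  have hzero : (fun p : PrimeSpectrum S => P.D (c ((X k).fromSpecStalk b p))) = fun _ => 0 := by
    funext p
    refine hD _ fun hwp => hw ?_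
    have e := congrArg (fun f : Spec _ ⟶ X k => f p) (fromSpecStalk_comp (𝟙 (X k)) b)
    rw [Category.comp_id] at e
    have e' : (show PrimeSpectrum (RX k) from (X k).fromSpecStalk b p).asIdeal =
        p.asIdeal.comap (algebraMap (RX k) S) := congrArg PrimeSpectrum.asIdeal e
    rw [e'] at hwp
    exact (Ideal.comap_mono (IsLocalRing.le_maximalIdeal p.isPrime.ne_top)).trans
        (IsLocalization.AtPrime.under_maximalIdeal S q.asIdeal).le hwp
  exact hzero ▸ ht

end Axis

/-! ### Components without the axis; copies of `X` and their transforms -/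

section Localization

variable {k : Type u} [Field k]

/-- Since `s` annihilates the kernel of `π`, inverting `s` in `R` and `π s` in `S` gives the same
ring. Hence a plane without the axis is open in `X`. -/
lemma isLocalization_away_of_surjective {R S T : Type*} [CommRing R] [CommRing S] [CommRing T]
    [Algebra R T] [Algebra S T] (π : R →+* S) (hπ : Function.Surjective π)
    (hT : algebraMap R T = (algebraMap S T).comp π) (s : R)
    (hs : ∀ a, π a = 0 → s * a = 0) [IsLocalization.Away (π s) T] : IsLocalization.Away s T where
  map_units := by
    rintro ⟨_, n, rfl⟩
    rw [map_pow, hT]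
    exact (IsLocalization.Away.algebraMap_isUnit (S := T) (π s)).pow n
  surj := by
    intro t
    obtain ⟨⟨m, ⟨_, n, rfl⟩⟩, h⟩ := IsLocalization.surj (Submonoid.powers (π s)) t
    obtain ⟨r, rfl⟩ := hπ m
    refine ⟨⟨r, ⟨s ^ n, n, rfl⟩⟩, ?_⟩
    simpa [hT] using h
  exists_of_eq := by
    intro a b h
    rw [hT] at h
    obtain ⟨⟨_, n, rfl⟩, h⟩ := IsLocalization.exists_of_eq (M := Submonoid.powers (π s)) h
    refine ⟨⟨s ^ (n + 1), n + 1, rfl⟩, ?_⟩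
    have h' : π (s ^ n * (a - b)) = 0 := by
      simp only [map_mul, map_pow, map_sub]
      linear_combination h
    have := hs _ h'
    change s ^ (n + 1) * a = s ^ (n + 1) * b
    linear_combination this

variable (k) in
/-- The coordinate ring `k[u, v, u⁻¹]` of the plane without the line `u = 0`. -/
abbrev MU : Type u := Localization.Away (uu k)

variable (k) in
/-- The ideal of the line `v = 0`. -/
def lineIdeal : Ideal (MU k) := (Ideal.span {vv k}).map (algebraMap (M k) (MU k))

lemma disjoint_powers_uu : Disjoint (Submonoid.powers (uu k) : Set (M k))
    (Ideal.span {vv k} : Ideal (M k)) := by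
  rw [Set.disjoint_left]
  rintro _ ⟨n, rfl⟩ h
  have h := (isPrime_span_vv (k := k)).mem_of_pow_mem n h
  rw [Ideal.mem_span_singleton] at h
  simp [MvPolynomial.X_dvd_X] at h

instance isPrime_lineIdeal : (lineIdeal k).IsPrime :=
  IsLocalization.isPrime_of_isPrime_disjoint (Submonoid.powers (uu k)) (MU k) _ isPrime_span_vv
    disjoint_powers_uu

lemma comap_eq_span_vv_iff (r : Ideal (MU k)) :
    r.comap (algebraMap (M k) (MU k)) = Ideal.span {vv k} ↔ r = lineIdeal k := by
  constructor
  · intro h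
    rw [lineIdeal, ← h]
    exact (IsLocalization.map_under (Submonoid.powers (uu k)) (MU k) r).symm
  · rintro rfl
    exact IsLocalization.under_map_of_isPrime_disjoint (Submonoid.powers (uu k)) (MU k)
      isPrime_span_vv disjoint_powers_uu

namespace IsComponent

variable {P : Ideal (A k)} {f f' : A k} {ρ : A k →ₐ[k] M k} (h : IsComponent P f f' ρ)

/-- The restriction of functions on `X` to the component, without the `w`-axis. -/
def loc : RX k →+* MU k := (algebraMap (M k) (MU k)).comp h.res.toRingHom

/-- The inclusion of the component without the `w`-axis in `X`. -/
def immersion : Spec (CommRingCat.of (MU k)) ⟶ X k := Spec.map (CommRingCat.ofHom h.loc)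

lemma res_mul : h.res (mkX k f * mkX k f') = uu k ^ 2 ∨ h.res (mkX k f * mkX k f') = -uu k ^ 2 := by
  have e : h.res (mkX k f * mkX k f') = ρ f * ρ f' := map_mul h.res _ _
  rw [e, h.isPlane.map_f]
  rcases h.map_f' with h' | h' <;> rw [h']
  · left; ring
  · right; ring

lemma isLocalization_loc :
    @IsLocalization.Away (RX k) _ (mkX k f * mkX k f') (MU k) _ h.loc.toAlgebra := by
  let := h.loc.toAlgebra
  have hu : IsUnit (algebraMap (M k) (MU k) (uu k)) :=
    IsLocalization.Away.algebraMap_isUnit (uu k)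
  have : IsLocalization.Away (uu k ^ 2) (MU k) := by
    rw [pow_two]
    exact IsLocalization.Away.mul_of_isUnit (S := MU k) (uu k) (uu k) hu
  have : IsLocalization.Away (h.res.toRingHom (mkX k f * mkX k f')) (MU k) := by
    refine IsLocalization.Away.of_associated (r := uu k ^ 2) ?_
    rcases h.res_mul with h' | h'
    · exact Associated.of_eq h'.symm
    · exact (Associated.of_eq h'.symm).symm.trans (Associated.neg_left (Associated.refl _)) |>.symm
  exact isLocalization_away_of_surjective h.res.toRingHom h.res_surjective rfl _
    fun a ha => h.mul_eq_zero_of_res_eq_zero ha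

instance : IsOpenImmersion h.immersion := by
  let := h.loc.toAlgebra
  have := h.isLocalization_loc
  exact IsOpenImmersion.of_isLocalization (S := MU k) (mkX k f * mkX k f')

lemma range_immersion : Set.range h.immersion =
    {q : PrimeSpectrum (RX k) | mkX k f * mkX k f' ∉ q.asIdeal} := by
  let := h.loc.toAlgebra
  have := h.isLocalization_loc
  exact PrimeSpectrum.localization_away_comap_range (MU k) (mkX k f * mkX k f')

lemma immersion_comp : h.immersion ≫ strX k =
    Spec.map (CommRingCat.ofHom (algebraMap (M k) (MU k))) ≫
      Spec.map (CommRingCat.ofHom (algebraMap k (M k))) := by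
  rw [immersion, strX, ← Spec.map_comp, ← Spec.map_comp, ← CommRingCat.ofHom_comp,
    ← CommRingCat.ofHom_comp]
  congr 2
  rw [loc, RingHom.comp_assoc]
  congr 1
  exact h.res.comp_algebraMap

lemma loc_w : h.loc (mkX k (w k)) = algebraMap (M k) (MU k) (vv k) := by
  rw [← h.isPlane.map_w]
  rfl

end IsComponent

/-- The three components cover the complement of the `w`-axis. -/
lemma exists_immersion_eq (q : PrimeSpectrum (RX k))
    (hq : ¬ axisIdeal k ≤ q.asIdeal.comap (mkX k)) :
    ∃ (P : Ideal (A k)) (f f' : A k) (ρ : A k →ₐ[k] M k) (h : IsComponent P f f' ρ),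
      q ∈ Set.range h.immersion := by
  by_contra! hcon
  have h1 := hcon _ _ _ _ isComponent₁
  have h2 := hcon _ _ _ _ isComponent₂
  have h3 := hcon _ _ _ _ isComponent₃
  rw [IsComponent.range_immersion] at h1 h2 h3
  replace h1 : y k * (x k + y k) ∈ q.asIdeal.comap (mkX k) := not_not.mp h1
  replace h2 : x k * (x k + y k) ∈ q.asIdeal.comap (mkX k) := not_not.mp h2
  replace h3 : x k * y k ∈ q.asIdeal.comap (mkX k) := not_not.mp h3
  have hp : (q.asIdeal.comap (mkX k)).IsPrime := inferInstance
  obtain ⟨I, hI⟩ : ∃ I, I = q.asIdeal.comap (mkX k) := ⟨_, rfl⟩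
  have hz : z k * (z k + x k * w k) ∈ I := by
    rw [hI, Ideal.mem_comap, mkX_eq_zero (by simp [equationsX])]
    exact zero_mem _
  rw [← hI] at h1 h2 h3 hp hq
  have hx : x k ∈ I := by
    by_contra hx
    have hy := (hp.mem_or_mem h3).resolve_left hx
    have hxy := (hp.mem_or_mem h2).resolve_left hx
    exact hx ((Ideal.add_mem_iff_left _ hy).mp hxy)
  have hy : y k ∈ I := by
    by_contra hy
    have hxy := (hp.mem_or_mem h1).resolve_left hy
    exact hy ((Ideal.add_mem_iff_right _ hx).mp hxy)
  have hz' : z k ∈ I := by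
    rcases hp.mem_or_mem hz with h | h
    · exact h
    · exact (Ideal.add_mem_iff_left _ (Ideal.mul_mem_right _ _ hx)).mp h
  refine hq (Ideal.span_le.mpr ?_)
  rintro _ (rfl | rfl | rfl) <;> assumption

open Classical in
/-- `c` is an open immersion of a copy of `X` in the pair `P`, such that the cycle of `P` is
`α (w = 0)` on each of the components of `X`. -/
structure IsCopy (P : Pair k) (c : X k ⟶ P.X) (α : ℚ) : Prop where
  isOpenImmersion : IsOpenImmersion c
  comp_str : c ≫ P.str = strX k
  eq_zero : ∀ q : X k, mkX k (w k) ∉ q.asIdeal → P.D (c q) = 0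
  eq_ite : ∀ {Q : Ideal (A k)} {f f' : A k} {ρ : A k →ₐ[k] M k} (h : IsComponent Q f f' ρ)
    (r : Spec (CommRingCat.of (MU k))), P.D (c (h.immersion r)) = if r.asIdeal = lineIdeal k then α else 0

lemma axisIdeal_sup (q : Ideal (RX k)) (hq : axisIdeal k ≤ q.comap (mkX k))
    (hw : mkX k (w k) ∈ q) : originIdealX k ≤ q := by
  rw [originIdealX, Ideal.map_le_iff_le_comap, originIdealA4, Ideal.span_le]
  rintro _ (rfl | rfl | rfl | rfl)
  · exact hw
  · exact hq (Ideal.subset_span (by simp))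
  · exact hq (Ideal.subset_span (by simp))
  · exact hq (Ideal.subset_span (by simp))

/-- On the axis, a point other than the origin has `w ≠ 0`. Off the axis, the point lies on a single
plane, on which the cycle is `α (v = 0)`. -/
theorem IsCopy.isSncAt {P : Pair k} {c : X k ⟶ P.X} {α : ℚ} (h : IsCopy P c α)
    (q : X k) (hq : ¬ originIdealX k ≤ q.asIdeal) : P.IsSncAt (c q) := by
  have := h.isOpenImmersion
  by_cases hax : axisIdeal k ≤ q.asIdeal.comap (mkX k)
  · exact isSncAt_axis P c h.comp_str h.eq_zero q hax fun hw => hq (axisIdeal_sup _ hax hw)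
  · obtain ⟨_, _, _, _, hc, r, rfl⟩ := exists_immersion_eq q hax
    have : IsOpenImmersion (Spec.map (CommRingCat.ofHom (algebraMap (M k) (MU k)))) :=
      IsOpenImmersion.of_isLocalization (uu k)
    refine isSncAt_plane P (hc.immersion ≫ c)
      (Spec.map (CommRingCat.ofHom (algebraMap (M k) (MU k)))) ?_ α (fun b => ?_) r
    · rw [Category.assoc, h.comp_str, hc.immersion_comp]
    · exact (h.eq_ite hc b).trans (if_congr (comap_eq_span_vv_iff _).symm rfl rfl)

lemma isCopy_pairX : IsCopy (pairX k) (𝟙 (X k)) 0 where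
  isOpenImmersion := inferInstanceAs (IsOpenImmersion (𝟙 (Spec (CommRingCat.of (RX k)))))
  comp_str := Category.id_comp _
  eq_zero _ _ := rfl
  eq_ite _ _ := (ite_self _).symm

lemma mem_support_comap {Y Z : Scheme.{u}} (C : Z.IdealSheafData) (f : Y ⟶ Z) (b : Y) :
    b ∈ (C.comap f).support ↔ f b ∈ C.support := by
  rw [Scheme.IdealSheafData.support_comap]
  rfl

lemma chartX_comp_strX : chartX k ≫ strX k = strX k := by
  rw [chartX, strX, ← Spec.map_comp, ← CommRingCat.ofHom_comp]
  congr 2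
  ext a
  change mkX k (chartHom k (algebraMap k (A k) a)) = _
  rw [AlgHom.commutes]
  rfl

lemma map_originIdealX : (originIdealX k).map (chartHomX k) = Ideal.span {mkX k (w k)} := by
  have h := (isBlowupChart_X.generates (mkX k (w k)) rfl).2
  rw [h]
  congr 2
  change mkX k (chartHom k (w k)) = _
  rw [chartHom_w]

lemma comap_origin_chartX :
    (sheafOf (originIdealX k)).comap (chartX k) = sheafOf (Ideal.span {mkX k (w k)}) := by
  change (sheafOf (originIdealX k)).comap (Spec.map (CommRingCat.ofHom (chartHomX k))) = _
  rw [comap_sheafOf, map_originIdealX]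

/-- The `w`-chart of the blowing-up of the origin is again a copy of `X`. -/
theorem IsCopy.transform_origin {P P' : Pair k} {c : X k ⟶ P.X} {α : ℚ} (h : IsCopy P c α)
    {C : P.X.IdealSheafData} {σ : P'.X ⟶ P.X} (hC : C.comap c = sheafOf (originIdealX k))
    (hstr : σ ≫ P.str = P'.str) (hD : P'.D = transform C σ P.D) (c' : X k ⟶ P'.X)
    [IsOpenImmersion c'] (hc' : c' ≫ σ = chartX k ≫ c) : IsCopy P' c' 1 := by
  have hCσ : (C.comap σ).comap c' = sheafOf (Ideal.span {mkX k (w k)}) := by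
    rw [← Scheme.IdealSheafData.comap_comp, hc', Scheme.IdealSheafData.comap_comp, hC,
      comap_origin_chartX]
  have hpt : ∀ q, σ (c' q) = c (chartX k q) := fun q =>
    congrArg (fun f : X k ⟶ P.X => f q) hc'
  have hsupp : ∀ q : X k, σ (c' q) ∈ C.support ↔ mkX k (w k) ∈ q.asIdeal := by
    intro q
    rw [← mem_support_comap C σ (c' q), ← mem_support_comap _ c' q, hCσ, mem_support_sheafOf,
      Ideal.span_singleton_le_iff_mem]
  -- The chart map sends `w ≠ 0` into `w ≠ 0`, where the old cycle is zero. So the birational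
  -- transform of the old cycle misses this chart, and the new coefficient does not depend on `α`.
  have hzero : ∀ q : X k, mkX k (w k) ∉ q.asIdeal → P'.D (c' q) = 0 := by
    intro q hq
    rw [hD, transform, if_neg ((hsupp q).not.mpr hq), hpt]
    refine h.eq_zero _ fun hw => hq ?_
    have : chartHomX k (mkX k (w k)) ∈ q.asIdeal := hw
    change mkX k (chartHom k (w k)) ∈ _ at this
    rwa [chartHom_w] at this
  refine ⟨inferInstance, ?_, hzero, fun hc r => ?_⟩
  · rw [← hstr, reassoc_of% hc', h.comp_str, chartX_comp_strX]
  · have hline : (Ideal.span {mkX k (w k)}).map hc.loc = lineIdeal k := by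
      rw [lineIdeal, Ideal.map_span, Ideal.map_span, Set.image_singleton, Set.image_singleton,
        hc.loc_w]
    by_cases hr : mkX k (w k) ∈ (hc.immersion r).asIdeal
    · rw [hD, transform, if_pos ((hsupp _).mpr hr)]
      refine exceptionalCoeff_eq (hc.immersion ≫ c') (K := lineIdeal k) ?_ r
      rw [Scheme.IdealSheafData.comap_comp, hCσ, IsComponent.immersion, comap_sheafOf, hline]
    · rw [hzero _ hr, if_neg]
      intro hr'
      refine hr ?_
      have : hc.loc (mkX k (w k)) ∈ lineIdeal k :=
        hline ▸ Ideal.mem_map_of_mem _ (Ideal.mem_span_singleton_self _)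
      rwa [← hr'] at this

/-- A blowing-up with centre away from the copy of `X`. -/
theorem IsCopy.transform_top {P P' : Pair k} {c : X k ⟶ P.X} {α : ℚ} (h : IsCopy P c α)
    {C : P.X.IdealSheafData} {σ : P'.X ⟶ P.X} (hC : C.comap c = ⊤)
    (hstr : σ ≫ P.str = P'.str) (hD : P'.D = transform C σ P.D) (c' : X k ⟶ P'.X)
    [IsOpenImmersion c'] (hc' : c' ≫ σ = c) : IsCopy P' c' α := by
  have hpt : ∀ q, P'.D (c' q) = P.D (c q) := fun q => by
    have e : σ (c' q) = c q := congrArg (fun f : X k ⟶ P.X => f q) hc'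
    rw [hD, transform, e, if_neg]
    rw [← mem_support_comap C c, hC, Scheme.IdealSheafData.support_top]
    exact Set.notMem_empty q
  refine ⟨inferInstance, by rw [← hstr, reassoc_of% hc', h.comp_str], fun q hq => ?_,
    fun hc r => ?_⟩
  · rw [hpt, h.eq_zero q hq]
  · rw [hpt, h.eq_ite hc r]

end Localization

/-! ### The origin -/

section Origin

variable {k : Type u} [Field k]

variable (k) in
/-- The value of a function at the origin. -/
def evalA : A k →ₐ[k] k := MvPolynomial.aeval 0

lemma sub_evalA_mem (a : A k) : a - algebraMap k (A k) (evalA k a) ∈ originIdealA4 k := by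
  have h0 : ∀ a ∈ ({w k, x k, y k, z k} : Set (A k)), Ideal.Quotient.mk (originIdealA4 k) a = 0 :=
    fun a ha => Ideal.Quotient.eq_zero_iff_mem.mpr (Ideal.subset_span ha)
  have : (Algebra.ofId k (A k ⧸ originIdealA4 k)).comp (evalA k) =
      Ideal.Quotient.mkₐ k (originIdealA4 k) := by
    refine MvPolynomial.algHom_ext fun i => ?_
    rw [AlgHom.comp_apply, evalA, MvPolynomial.aeval_X, Pi.zero_apply, map_zero, eq_comm]
    fin_cases i
    exacts [h0 (w k) (by simp), h0 (x k) (by simp), h0 (y k) (by simp), h0 (z k) (by simp)]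
  rw [← Ideal.Quotient.eq]
  exact (AlgHom.congr_fun this a).symm

lemma evalA_eq_zero {a : A k} (ha : a ∈ originIdealA4 k) : evalA k a = 0 := by
  have : originIdealA4 k ≤ RingHom.ker (evalA k) := by
    rw [originIdealA4, Ideal.span_le]
    rintro _ (rfl | rfl | rfl | rfl) <;> simp [RingHom.mem_ker, evalA]
  exact this ha

lemma idealX_le_originIdealA4 : idealX k ≤ originIdealA4 k := by
  rw [span_equationsX, Ideal.span_le]
  rintro _ (rfl | rfl | rfl | rfl)
  · exact Ideal.mul_mem_right _ _ x_mem
  · exact Ideal.mul_mem_right _ _ z_mem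
  · exact Ideal.mul_mem_left _ _ z_mem
  · exact Ideal.mul_mem_left _ _ (Ideal.mul_mem_right _ _ x_mem)

variable (k) in
/-- The value at the origin of a function on `X`. -/
def evalX : RX k →ₐ[k] k :=
  Ideal.Quotient.liftₐ (idealX k) (evalA k) fun _ ha => evalA_eq_zero (idealX_le_originIdealA4 ha)

lemma sub_evalX_mem (a : RX k) : a - algebraMap k (RX k) (evalX k a) ∈ originIdealX k := by
  obtain ⟨a, rfl⟩ := mkX_surjective a
  exact Ideal.mem_map_of_mem (mkX k) (sub_evalA_mem a)

lemma ker_evalX : RingHom.ker (evalX k) = originIdealX k := by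
  refine le_antisymm (fun a ha => ?_) ?_
  · have := sub_evalX_mem a
    rwa [RingHom.mem_ker.mp ha, map_zero, sub_zero] at this
  · rw [originIdealX, Ideal.map_le_iff_le_comap]
    exact fun a ha => evalA_eq_zero ha

lemma evalX_surjective : Function.Surjective (evalX k) := fun a =>
  ⟨algebraMap k _ a, (evalX k).commutes a⟩

instance isMaximal_originIdealX : (originIdealX k).IsMaximal := by
  rw [← ker_evalX]
  exact RingHom.ker_isMaximal_of_surjective _ evalX_surjective

variable (k) in
/-- The origin. -/
def origin : X k := (⟨originIdealX k, inferInstance⟩ : PrimeSpectrum (RX k))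

lemma originIdealX_le_iff (q : X k) : originIdealX k ≤ q.asIdeal ↔ q = origin k := by
  constructor
  · intro h
    exact PrimeSpectrum.ext (isMaximal_originIdealX.eq_of_le q.isPrime.ne_top h).symm
  · rintro rfl
    exact le_rfl

/-- Relations between the elements of a system of coordinates have no invertible coefficients. -/
lemma IsRegularSystem.mem_maximalIdeal {O : Type*} [CommRing O] [IsLocalRing O] {n : ℕ}
    {t : Fin n → O} (ht : IsRegularSystem t) {e : Fin n → O} (he : ∑ j, e j * t j = 0)
    (j : Fin n) : e j ∈ IsLocalRing.maximalIdeal O := by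
  by_contra hu
  obtain ⟨v, hv⟩ := (IsLocalRing.notMem_maximalIdeal.mp hu).exists_left_inv
  have hmem : t j ∈ Ideal.span (t '' {j}ᶜ) := by
    have : t j = -(v * ∑ i ∈ Finset.univ.erase j, e i * t i) := by
      have h := Finset.add_sum_erase Finset.univ (fun i => e i * t i) (Finset.mem_univ j)
      rw [he] at h
      linear_combination (-t j) * hv + v * h
    rw [this]
    refine neg_mem (Ideal.mul_mem_left _ _ (Ideal.sum_mem _ fun i hi => Ideal.mul_mem_left _ _
      (Ideal.subset_span ⟨i, ?_, rfl⟩)))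
    exact Finset.ne_of_mem_erase hi
  have hspan : Ideal.span (t '' {j}ᶜ) = IsLocalRing.maximalIdeal O := by
    rw [← ht.1]
    refine le_antisymm (Ideal.span_mono (Set.image_subset_range _ _)) (Ideal.span_le.mpr ?_)
    rintro _ ⟨i, rfl⟩
    by_cases hi : i = j
    · exact hi ▸ hmem
    · exact Ideal.subset_span ⟨i, hi, rfl⟩
  have h1 := Submodule.spanFinrank_span_le_ncard_of_finite (R := O)
    (Set.toFinite (t '' ({j}ᶜ : Set (Fin n))))
  have h2 := Set.ncard_image_le (f := t) (Set.toFinite ({j}ᶜ : Set (Fin n)))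
  have h3 := Set.ncard_add_ncard_compl ({j} : Set (Fin n))
  rw [Set.ncard_singleton, Nat.card_eq_fintype_card, Fintype.card_fin] at h3
  have h4 : n = (Ideal.span (t '' {j}ᶜ)).spanFinrank := hspan ▸ ht.2
  have : (Ideal.span (t '' {j}ᶜ)).spanFinrank ≤ (t '' {j}ᶜ).ncard := h1
  omega

/-- Each component of `X` gives a minimal prime of the local rings of `X` at its points. -/
lemma IsComponent.mem_minimalPrimes {P : Ideal (A k)} {f f' : A k} {ρ : A k →ₐ[k] M k}
    (h : IsComponent P f f' ρ) {S : Type*} [CommRing S] [Algebra (RX k) S] (q : Ideal (RX k))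
    [q.IsPrime] [IsLocalization.AtPrime S q] (hPq : P.map (mkX k) ≤ q) :
    (P.map (mkX k)).map (algebraMap (RX k) S) ∈ minimalPrimes S := by
  have hPp := h.isPlane.isPrime
  have hker : RingHom.ker (mkX k) ≤ P := by rw [Ideal.mk_ker]; exact h.idealX_le
  have hT : (P.map (mkX k)).IsPrime := Ideal.map_isPrime_of_surjective mkX_surjective hker
  have hTS : ((P.map (mkX k)).map (algebraMap (RX k) S)).IsPrime := isPrime_map_of_le hPq
  have hTc : (P.map (mkX k)).comap (mkX k) = P := by
    rw [Ideal.comap_map_of_surjective _ mkX_surjective, ← RingHom.ker_eq_comap_bot, sup_eq_left]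
    exact hker
  refine ⟨⟨hTS, bot_le⟩, fun p hp hle => ?_⟩
  have hpp : p.IsPrime := hp.1
  rw [Ideal.map_le_iff_le_comap]
  have hle' : (p.comap (algebraMap (RX k) S)).comap (mkX k) ≤ P := by
    rw [← hTc, ← comap_map_of_le (O := S) hPq]
    exact Ideal.comap_mono (Ideal.comap_mono hle)
  have hu : uu k ≠ 0 := MvPolynomial.X_ne_zero _
  have hf : f ∉ P := by rwa [h.isPlane.mem_iff, h.isPlane.map_f]
  have hf' : f' ∉ P := by
    rw [h.isPlane.mem_iff]
    rcases h.map_f' with e | e <;> rw [e]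
    exacts [hu, neg_ne_zero.mpr hu]
  rw [Ideal.map_le_iff_le_comap]
  intro a ha
  have hp' : ((p.comap (algebraMap (RX k) S)).comap (mkX k)).IsPrime := inferInstance
  have hmem : f * f' * a ∈ (p.comap (algebraMap (RX k) S)).comap (mkX k) := by
    rw [Ideal.mem_comap, Ideal.Quotient.eq_zero_iff_mem.mpr (h.mul_mem_idealX a ha)]
    exact zero_mem _
  refine (hp'.mem_or_mem hmem).resolve_left fun hm => ?_
  rcases hp'.mem_or_mem hm with hm | hm
  exacts [hf (hle' hm), hf' (hle' hm)]

variable (k) in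
/-- The derivatives with respect to `x` and `y` at the origin. -/
def tangentA : A k →ₐ[k] TrivSqZeroExt k (k × k) :=
  MvPolynomial.aeval ![0, TrivSqZeroExt.inr (1, 0), TrivSqZeroExt.inr (0, 1), 0]

variable (k) in
/-- The derivatives with respect to `x` and `y` at the origin, for functions on `X`. -/
def tangentX : RX k →ₐ[k] TrivSqZeroExt k (k × k) :=
  Ideal.Quotient.liftₐ (idealX k) (tangentA k) fun a ha => by
    have : idealX k ≤ RingHom.ker (tangentA k) := by
      rw [span_equationsX, Ideal.span_le]
      rintro _ (rfl | rfl | rfl | rfl) <;>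
        simp [RingHom.mem_ker, tangentA, TrivSqZeroExt.inr_mul_inr]
    exact this ha

lemma fst_tangentX (a : RX k) : (tangentX k a).fst = evalX k a := by
  have : (TrivSqZeroExt.fstHom k k (k × k)).comp (tangentA k) = evalA k := by
    refine MvPolynomial.algHom_ext fun i => ?_
    fin_cases i <;> simp [tangentA, evalA]
  obtain ⟨a, rfl⟩ := mkX_surjective a
  exact AlgHom.congr_fun this a

/-- The tangent space of a component lies in a hyperplane. -/
lemma map_tangent_eq_zero {S : Type*} [CommRing S] [Algebra (RX k) S] (L : (k × k) →ₗ[k] k)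
    {s s' : A k} (hs : TrivSqZeroExt.map L (tangentA k s) = 0)
    (hs' : TrivSqZeroExt.map L (tangentA k s') = 0) (Ψ : S →+* TrivSqZeroExt k (k × k))
    (hΨ : Ψ.comp (algebraMap (RX k) S) = (tangentX k).toRingHom) {a : S}
    (ha : a ∈ ((Ideal.span {s, s'}).map (mkX k)).map (algebraMap (RX k) S)) :
    L (Ψ a).snd = 0 := by
  have hle : ((Ideal.span {s, s'}).map (mkX k)).map (algebraMap (RX k) S) ≤
      RingHom.ker ((TrivSqZeroExt.map L).toRingHom.comp Ψ) := by
    rw [Ideal.map_map, Ideal.map_le_iff_le_comap, Ideal.span_le]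
    have hA : ∀ b : A k, Ψ (algebraMap (RX k) S (mkX k b)) = tangentA k b := fun b =>
      RingHom.congr_fun hΨ (mkX k b)
    rintro _ (rfl | rfl)
    · change TrivSqZeroExt.map L (Ψ (algebraMap (RX k) S (mkX k _))) = 0
      rw [hA, hs]
    · change TrivSqZeroExt.map L (Ψ (algebraMap (RX k) S (mkX k _))) = 0
      rw [hA, hs']
  have h0 : TrivSqZeroExt.map L (Ψ a) = 0 := hle ha
  rw [← TrivSqZeroExt.snd_map, h0, TrivSqZeroExt.snd_zero]

/-- The components of `X` are not coordinate subspaces at the origin. -/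
lemma not_isSncSystem_origin {O S : Type*} [CommRing O] [IsLocalRing O] [CommRing S]
    [Algebra (RX k) S] [IsLocalization.AtPrime S (originIdealX k)] (φ : O →+* S)
    (hφ : Function.Surjective φ) {n : ℕ} {t : Fin n → O} {α : Fin n → ℚ}
    {D : PrimeSpectrum S → ℚ} (h : IsSncSystem φ t α D) : False := by
  have hS : IsLocalRing S := IsLocalization.AtPrime.isLocalRing S (originIdealX k)
  have hloc : IsLocalHom φ := IsLocalHom.of_surjective φ hφ
  have hunit : ∀ a : (originIdealX k).primeCompl, IsUnit ((tangentX k).toRingHom a) := by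
    rintro ⟨a, ha⟩
    rw [TrivSqZeroExt.isUnit_iff_isUnit_fst]
    change IsUnit (tangentX k a).fst
    rw [fst_tangentX, isUnit_iff_ne_zero]
    exact fun h0 => ha (ker_evalX (k := k) ▸ h0)
  let Ψ : S →+* TrivSqZeroExt k (k × k) := IsLocalization.lift hunit
  have hΨ : Ψ.comp (algebraMap (RX k) S) = (tangentX k).toRingHom := IsLocalization.lift_comp hunit
  have hΨm : ∀ s ∈ IsLocalRing.maximalIdeal S, (Ψ s).fst = 0 := by
    have : IsLocalRing.maximalIdeal S ≤
        RingHom.ker ((TrivSqZeroExt.fstHom k k (k × k)).toRingHom.comp Ψ) := by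
      rw [maximalIdeal_eq_map (O := S) (originIdealX k), Ideal.map_le_iff_le_comap]
      intro a ha
      change (Ψ (algebraMap (RX k) S a)).fst = 0
      rw [show Ψ (algebraMap (RX k) S a) = tangentX k a from RingHom.congr_fun hΨ a, fst_tangentX]
      exact RingHom.mem_ker.mp (ker_evalX (k := k) ▸ ha)
    exact fun s hs => this hs
  have hφm : ∀ a ∈ IsLocalRing.maximalIdeal O, (Ψ (φ a)).fst = 0 := fun a ha =>
    hΨm _ (map_nonunit φ a ha)
  have ht : ∀ j, (Ψ (φ (t j))).fst = 0 := fun j =>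
    hφm _ (h.regular.1 ▸ Ideal.subset_span ⟨j, rfl⟩)
  have hle : ∀ {s s' : A k}, s ∈ originIdealA4 k → s' ∈ originIdealA4 k →
      (Ideal.span {s, s'}).map (mkX k) ≤ originIdealX k := fun hs hs' =>
    Ideal.map_mono (Ideal.span_le.mpr (by rintro _ (rfl | rfl) <;> assumption))
  obtain ⟨I₁, hI₁⟩ := h.components _ (isComponent₁.mem_minimalPrimes (originIdealX k)
    (hle z_mem x_mem))
  obtain ⟨I₂, hI₂⟩ := h.components _ (isComponent₂.mem_minimalPrimes (originIdealX k)
    (hle z_mem y_mem))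
  obtain ⟨I₃, hI₃⟩ := h.components _ (isComponent₃.mem_minimalPrimes (originIdealX k)
    (hle (Ideal.add_mem _ z_mem (Ideal.mul_mem_right _ _ x_mem)) (Ideal.add_mem _ x_mem y_mem)))
  have hmem : ∀ {I : Set (Fin n)} {p : Ideal S}, p.comap φ = Ideal.span (t '' I) →
      ∀ j ∈ I, φ (t j) ∈ p := fun hI j hj => by
    have : t j ∈ Ideal.span (t '' _) := Ideal.subset_span ⟨j, hj, rfl⟩
    rw [← hI] at this
    exact this
  have h1 : ∀ j ∈ I₁, (Ψ (φ (t j))).snd.2 = 0 := fun j hj =>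
    map_tangent_eq_zero (LinearMap.snd k k k) (by simp [tangentA]) (by simp [tangentA]) Ψ hΨ
      (hmem hI₁ j hj)
  have h2 : ∀ j ∈ I₂, (Ψ (φ (t j))).snd.1 = 0 := fun j hj =>
    map_tangent_eq_zero (LinearMap.fst k k k) (by simp [tangentA]) (by simp [tangentA]) Ψ hΨ
      (hmem hI₂ j hj)
  have h3 : ∀ j ∈ I₃, (Ψ (φ (t j))).snd.1 - (Ψ (φ (t j))).snd.2 = 0 := fun j hj =>
    map_tangent_eq_zero (LinearMap.fst k k k - LinearMap.snd k k k) (by simp [tangentA])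
      (by simp [tangentA, ← TrivSqZeroExt.inr_add]) Ψ hΨ (hmem hI₃ j hj)
  have hcoef : ∀ {I : Set (Fin n)} {p : Ideal S}, p.comap φ = Ideal.span (t '' I) →
      ∀ a, φ a ∈ p → ∃ c : Fin n → O, (∀ j ∉ I, c j = 0) ∧ ∑ j, c j * t j = a := by
    intro I p hI a ha
    have ha' : a ∈ Ideal.span (t '' I) := hI ▸ ha
    obtain ⟨c, hc, rfl⟩ := (Finsupp.mem_span_image_iff_linearCombination O).mp ha'
    refine ⟨c, fun j hj => Finsupp.notMem_support_iff.mp fun hj' => hj (hc hj'), ?_⟩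
    rw [Finsupp.linearCombination_apply, Finsupp.sum_fintype _ _ fun i => zero_smul O (t i)]
    rfl
  have hmk : ∀ {s s' a : A k}, a ∈ Ideal.span {s, s'} → algebraMap (RX k) S (mkX k a) ∈
      ((Ideal.span {s, s'}).map (mkX k)).map (algebraMap (RX k) S) := fun ha =>
    Ideal.mem_map_of_mem _ (Ideal.mem_map_of_mem _ ha)
  obtain ⟨X', hX'⟩ := hφ (algebraMap (RX k) S (mkX k (x k)))
  obtain ⟨Y', hY'⟩ := hφ (algebraMap (RX k) S (mkX k (y k)))
  obtain ⟨a, ha, haX⟩ := hcoef hI₁ X' (hX' ▸ hmk (Ideal.subset_span (by simp)))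
  obtain ⟨b, hb, hbY⟩ := hcoef hI₂ Y' (hY' ▸ hmk (Ideal.subset_span (by simp)))
  obtain ⟨c, hc, hcXY⟩ := hcoef hI₃ (X' + Y') (by
    rw [map_add, hX', hY', ← map_add, ← map_add]
    exact hmk (Ideal.subset_span (by simp)))
  have he : ∑ j, (a j + b j - c j) * t j = 0 := by
    simp only [sub_mul, add_mul, Finset.sum_sub_distrib, Finset.sum_add_distrib]
    rw [haX, hbY, hcXY, sub_self]
  have hxe : Ψ (φ X') = TrivSqZeroExt.inr (1, 0) := by
    rw [hX']
    refine (RingHom.congr_fun hΨ (mkX k (x k))).trans ?_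
    change tangentA k (x k) = _
    simp [tangentA]
  have hzero : ∀ j, (Ψ (φ (a j * t j))).snd = 0 := by
    intro j
    have hsnd : (Ψ (φ (a j * t j))).snd = (Ψ (φ (a j))).fst • (Ψ (φ (t j))).snd := by
      rw [map_mul, map_mul, TrivSqZeroExt.snd_mul, ht]
      simp
    rw [hsnd]
    by_cases j1 : j ∈ I₁
    · have e1 := h1 j j1
      by_cases j2 : j ∈ I₂
      · rw [show (Ψ (φ (t j))).snd = 0 from Prod.ext (h2 j j2) e1, smul_zero]
      by_cases j3 : j ∈ I₃
      · have e3 := h3 j j3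
        rw [e1, sub_zero] at e3
        rw [show (Ψ (φ (t j))).snd = 0 from Prod.ext e3 e1, smul_zero]
      have := h.regular.mem_maximalIdeal he j
      rw [hb j j2, hc j j3, add_zero, sub_zero] at this
      rw [hφm _ this, zero_smul]
    · rw [ha j j1, map_zero, map_zero, TrivSqZeroExt.fst_zero, zero_smul]
  have : (Ψ (φ X')).snd = 0 := by
    rw [← haX, map_sum, map_sum, TrivSqZeroExt.snd_sum]
    exact Finset.sum_eq_zero fun j _ => hzero j
  rw [hxe, TrivSqZeroExt.snd_inr] at this
  exact one_ne_zero (congrArg Prod.fst this)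

/-- The origin of an open copy of `X` is not an snc point. -/
theorem not_isSncAt_origin (P : Pair k) (c : X k ⟶ P.X) [IsOpenImmersion c] :
    ¬ P.IsSncAt (c (origin k)) := by
  rintro ⟨U, hU, Z, g, i, _, hi, -, n, t, α, ht, hcomp, hnot, hdiv⟩
  have h : IsSncSystem (i.stalkMap ⟨c (origin k), hU⟩).hom t α
      (fun q => P.D (U.ι (U.toScheme.fromSpecStalk ⟨c (origin k), hU⟩ q))) :=
    ⟨ht, hcomp, hnot, hdiv⟩
  let a : U.toScheme := ⟨c (origin k), hU⟩
  let e : U.toScheme.presheaf.stalk a →+* (X k).presheaf.stalk (origin k) :=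
    (c.stalkMap (origin k)).hom.comp (inv (U.ι.stalkMap a)).hom
  have he : Function.Bijective e :=
    (ConcreteCategory.bijective_of_isIso (c.stalkMap (origin k))).comp
      (ConcreteCategory.bijective_of_isIso (inv (U.ι.stalkMap a)))
  let := (germHom (𝟙 (X k)) (origin k)).toAlgebra
  have hS : IsLocalization.AtPrime ((X k).presheaf.stalk (origin k)) (originIdealX k) :=
    isLocalization_germHom (𝟙 (X k)) (origin k) (origin k) rfl
  exact not_isSncSystem_origin (k := k) (e.comp (i.stalkMap a).hom)
    (he.2.comp (i.stalkMap_surjective a)) (h.comp e he)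

end Origin

/-! ### Permissible centres -/

section Tangent

variable {k S : Type u} [Field k] [CommRing S] [Algebra k S]

/-- A tangent vector of `S` at a rational point which does not vanish on a given element of the
ideal of this point. -/
lemma exists_algHom_dualNumber (ε : S →ₐ[k] k) {s : S} (hs : s ∈ RingHom.ker ε)
    (hs' : s ∉ RingHom.ker ε ^ 2) :
    ∃ (g : S →ₐ[k] DualNumber k) (c : k), c ≠ 0 ∧ g s = TrivSqZeroExt.inr c := by
  obtain ⟨m, hm⟩ : ∃ m, m = RingHom.ker ε := ⟨_, rfl⟩
  rw [← hm] at hs'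
  have hne : Ideal.Quotient.mkₐ k (m ^ 2) s ≠ 0 := fun h =>
    hs' (Ideal.Quotient.eq_zero_iff_mem.mp h)
  obtain ⟨f, hf⟩ := not_forall.mp ((Module.forall_dual_apply_eq_zero_iff k _).not.mpr hne)
  have hsub : ∀ a, a - algebraMap k S (ε a) ∈ m := fun a => by
    rw [hm, RingHom.mem_ker, map_sub, AlgHom.commutes, Algebra.algebraMap_self_apply, sub_self]
  let D : S →ₗ[k] k := f ∘ₗ (Ideal.Quotient.mkₐ k (m ^ 2)).toLinearMap ∘ₗ
    (LinearMap.id - (Algebra.linearMap k S) ∘ₗ ε.toLinearMap)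
  have hDapp : ∀ a, D a = f (Ideal.Quotient.mkₐ k (m ^ 2) (a - algebraMap k S (ε a))) :=
    fun a => rfl
  have hDmul : ∀ a b, D (a * b) = ε a * D b + D a * ε b := by
    intro a b
    have e : Ideal.Quotient.mkₐ k (m ^ 2) (a * b - algebraMap k S (ε (a * b))) =
        Ideal.Quotient.mkₐ k (m ^ 2) (ε a • (b - algebraMap k S (ε b)) +
          ε b • (a - algebraMap k S (ε a))) := by
      refine Ideal.Quotient.eq.mpr ?_
      have := Ideal.mul_mem_mul (hsub a) (hsub b)
      rw [← pow_two] at this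
      convert this using 1
      rw [map_mul, map_mul, Algebra.smul_def, Algebra.smul_def]
      ring
    rw [hDapp, e, map_add, map_smul, map_smul, map_add, map_smul, map_smul, ← hDapp, ← hDapp,
      smul_eq_mul, smul_eq_mul, mul_comm (D a)]
  have hDalg : ∀ c, D (algebraMap k S c) = 0 := by
    intro c
    rw [hDapp, AlgHom.commutes, Algebra.algebraMap_self_apply, sub_self, map_zero, map_zero]
  refine ⟨AlgHom.ofLinearMap
    { toFun := fun a => TrivSqZeroExt.inl (ε a) + TrivSqZeroExt.inr (D a)
      map_add' := fun a b => by
        ext <;> simp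
      map_smul' := fun c a => by
        ext <;> simp } ?_ ?_, D s, ?_, ?_⟩
  · have := hDalg 1
    rw [map_one] at this
    ext <;> simp [this]
  · intro a b
    ext
    · simp
    · simp [hDmul]
  · rw [hDapp, RingHom.mem_ker.mp hs, map_zero, sub_zero]
    exact hf
  · change TrivSqZeroExt.inl (ε s) + TrivSqZeroExt.inr (D s) = _
    rw [RingHom.mem_ker.mp hs, TrivSqZeroExt.inl_zero, zero_add]

variable (k) in
/-- The ring `k[t]/(t ^ N)`. -/
abbrev Truncated (N : ℕ) : Type u := Polynomial k ⧸ Ideal.span {(Polynomial.X : Polynomial k) ^ N}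

variable (k) in
/-- The projection from `k[t]/(t ^ (n + 2))` to the dual numbers. -/
def truncate (n : ℕ) : Truncated k (n + 2) →ₐ[k] DualNumber k :=
  Ideal.Quotient.liftₐ _ (Polynomial.aeval DualNumber.eps) fun a ha => by
    obtain ⟨b, rfl⟩ := Ideal.mem_span_singleton'.mp ha
    rw [map_mul, map_pow, Polynomial.aeval_X, pow_add, pow_two, DualNumber.eps_mul_eps, mul_zero,
      mul_zero]

lemma fst_aeval_eps (p : Polynomial k) :
    (Polynomial.aeval (DualNumber.eps : DualNumber k) p).fst = p.coeff 0 := by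
  have : (TrivSqZeroExt.fstHom k k k).comp (Polynomial.aeval (DualNumber.eps : DualNumber k)) =
      Polynomial.aeval 0 := by
    ext
    simp
  rw [Polynomial.coeff_zero_eq_aeval_zero]
  exact AlgHom.congr_fun this p

lemma X_dvd_of_fst_eq_zero {p : Polynomial k}
    (h : (Polynomial.aeval (DualNumber.eps : DualNumber k) p).fst = 0) : Polynomial.X ∣ p := by
  rwa [Polynomial.X_dvd_iff, ← fst_aeval_eps]

lemma truncate_surjective (n : ℕ) : Function.Surjective (truncate k n) := by
  intro a
  refine ⟨Ideal.Quotient.mk _ (Polynomial.C a.fst + Polynomial.C a.snd * Polynomial.X), ?_⟩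
  change Polynomial.aeval DualNumber.eps _ = a
  ext <;> simp [TrivSqZeroExt.algebraMap_eq_inl]

lemma isNilpotent_ker_truncate (n : ℕ) :
    IsNilpotent (RingHom.ker (truncate k n : Truncated k (n + 2) →+* DualNumber k)) := by
  have hle : RingHom.ker (truncate k n : Truncated k (n + 2) →+* DualNumber k) ≤
      Ideal.span {Ideal.Quotient.mk _ Polynomial.X} := by
    intro a ha
    obtain ⟨p, rfl⟩ := Ideal.Quotient.mk_surjective a
    have h0 : Polynomial.aeval (DualNumber.eps : DualNumber k) p = 0 := ha
    obtain ⟨q, rfl⟩ := X_dvd_of_fst_eq_zero (by rw [h0, TrivSqZeroExt.fst_zero])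
    rw [map_mul]
    exact Ideal.mul_mem_right _ _ (Ideal.mem_span_singleton_self _)
  refine ⟨n + 2, le_bot_iff.mp ((Ideal.pow_right_mono hle _).trans ?_)⟩
  rw [Ideal.span_singleton_pow, ← map_pow,
    Ideal.Quotient.eq_zero_iff_mem.mpr (Ideal.mem_span_singleton_self _), Ideal.span_singleton_zero]

/-- A smooth algebra is reduced at a rational point whose ideal is nilpotent. -/
theorem ker_eq_bot_of_formallySmooth [Algebra.FormallySmooth k S] (ε : S →ₐ[k] k)
    (hfg : (RingHom.ker ε).FG) (hnil : RingHom.ker ε ≤ nilradical S) : RingHom.ker ε = ⊥ := by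
  obtain ⟨N, hN⟩ := hfg.isNilpotent_iff_le_nilradical.mpr hnil
  by_contra hne
  have hsq : ¬ RingHom.ker ε ≤ RingHom.ker ε ^ 2 := by
    intro hle
    have : ∀ i, RingHom.ker ε ≤ RingHom.ker ε ^ (i + 1) := by
      intro i
      induction i with
      | zero => rw [zero_add, pow_one]
      | succ i ih =>
        refine hle.trans ?_
        rw [pow_two, pow_succ (RingHom.ker ε) (i + 1)]
        exact Ideal.mul_mono ih le_rfl
    exact hne (le_bot_iff.mp ((this N).trans (by rw [pow_succ, hN, zero_mul]; rfl)))
  obtain ⟨s, hs, hs'⟩ := SetLike.not_le_iff_exists.mp hsq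
  obtain ⟨g, c, hc, hg⟩ := exists_algHom_dualNumber ε hs hs'
  obtain ⟨n, hn⟩ := mem_nilradical.mp (hnil hs)
  let h : S →ₐ[k] Truncated k (n + 2) := Algebra.FormallySmooth.liftOfSurjective g (truncate k n)
    (truncate_surjective n) (isNilpotent_ker_truncate n)
  have hh : truncate k n (h s) = g s :=
    Algebra.FormallySmooth.liftOfSurjective_apply g (truncate k n) _ _ s
  obtain ⟨p, hp⟩ := Ideal.Quotient.mk_surjective (h s)
  have hp1 : Polynomial.aeval (DualNumber.eps : DualNumber k) p = TrivSqZeroExt.inr c := by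
    rw [← hg, ← hh, ← hp]
    rfl
  obtain ⟨q, rfl⟩ := X_dvd_of_fst_eq_zero (p := p) (by rw [hp1, TrivSqZeroExt.fst_inr])
  have hq : q.coeff 0 = c := by
    rw [map_mul, Polynomial.aeval_X] at hp1
    have := congrArg TrivSqZeroExt.snd hp1
    simpa [fst_aeval_eps] using this
  have h0 : Ideal.Quotient.mk (Ideal.span {(Polynomial.X : Polynomial k) ^ (n + 2)})
      ((Polynomial.X * q) ^ n) = 0 := by
    rw [map_pow, hp, ← map_pow, hn, map_zero]
  rw [Ideal.Quotient.eq_zero_iff_mem, Ideal.mem_span_singleton, mul_pow, pow_add] at h0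
  have h1 := (mul_dvd_mul_iff_left (pow_ne_zero n Polynomial.X_ne_zero)).mp h0
  have h2 := Polynomial.prime_X.dvd_of_dvd_pow ((dvd_pow_self Polynomial.X two_ne_zero).trans h1)
  rw [Polynomial.X_dvd_iff, hq] at h2
  exact hc h2

end Tangent

section Centres

variable {k : Type u} [Field k]

lemma mk_comp_strX (J : Ideal (RX k)) :
    Spec.map (CommRingCat.ofHom (Ideal.Quotient.mk J)) ≫ strX k =
      Spec.map (CommRingCat.ofHom (algebraMap k (RX k ⧸ J))) := by
  rw [strX, ← Spec.map_comp]
  rfl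

/-- A smooth closed subscheme of an affine scheme which has at most one point, a given rational
point, is empty or this reduced point. -/
theorem eq_top_or_eq_ker {R : Type u} [CommRing R] [Algebra k R] [IsNoetherianRing R]
    (e : R →ₐ[k] k) (J : Ideal R) [Algebra.FormallySmooth k (R ⧸ J)]
    (h : ∀ p : Ideal R, p.IsPrime → J ≤ p → p = RingHom.ker e) : J = ⊤ ∨ J = RingHom.ker e := by
  rw [or_iff_not_imp_left]
  intro htop
  have hJm : J ≤ RingHom.ker e := by
    obtain ⟨p, hp, hJp⟩ := Ideal.exists_le_maximal J htop
    rwa [← h p hp.isPrime hJp]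
  let ε : R ⧸ J →ₐ[k] k := Ideal.Quotient.liftₐ J e fun a ha => hJm ha
  have hnil : RingHom.ker ε ≤ nilradical (R ⧸ J) := by
    intro a ha
    obtain ⟨a, rfl⟩ := Ideal.Quotient.mk_surjective a
    have ha' : a ∈ RingHom.ker e := ha
    have : a ∈ J.radical := by
      rw [Ideal.radical_eq_sInf, Ideal.mem_sInf]
      intro p hp
      rwa [h p hp.2 hp.1]
    obtain ⟨n, hn⟩ := this
    exact ⟨n, by rw [← map_pow, Ideal.Quotient.eq_zero_iff_mem.mpr hn]; rfl⟩
  have hbot := ker_eq_bot_of_formallySmooth ε (IsNoetherian.noetherian _) hnil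
  refine le_antisymm hJm fun a ha => ?_
  have : Ideal.Quotient.mk J a ∈ RingHom.ker ε := ha
  rw [hbot] at this
  exact Ideal.Quotient.eq_zero_iff_mem.mp this

lemma formallySmooth_of_smooth {S : Type u} [CommRing S] [Algebra k S]
    (h : Smooth (Spec.map (CommRingCat.ofHom (algebraMap k S)))) : Algebra.FormallySmooth k S := by
  rw [HasRingHomProperty.Spec_iff (P := @Smooth)] at h
  exact ((RingHom.smooth_algebraMap (R := k) (S := S)).mp h).formallySmooth

theorem eq_top_or_eq_origin {J : Ideal (RX k)}
    (hJ : Smooth (Spec.map (CommRingCat.ofHom (algebraMap k (RX k ⧸ J)))))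
    (hsupp : ∀ q : X k, J ≤ q.asIdeal → q = origin k) : J = ⊤ ∨ J = originIdealX k := by
  have := formallySmooth_of_smooth hJ
  rw [← ker_evalX]
  refine eq_top_or_eq_ker (evalX k) J fun p hp hJp => ?_
  rw [ker_evalX]
  exact congrArg PrimeSpectrum.asIdeal (hsupp (⟨p, hp⟩ : PrimeSpectrum (RX k)) hJp)

lemma smooth_subschemeι_sheafOf {R : Type u} [CommRing R] (J : Ideal R)
    (f : Spec (CommRingCat.of R) ⟶ Spec (CommRingCat.of k))
    (h : Smooth (Spec.map (CommRingCat.ofHom (Ideal.Quotient.mk J)) ≫ f)) :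
    Smooth ((sheafOf J).subschemeι ≫ f) := by
  let i := Spec.map (CommRingCat.ofHom (Ideal.Quotient.mk J))
  have : IsClosedImmersion i := IsClosedImmersion.spec_of_surjective _ Ideal.Quotient.mk_surjective
  have hker : ∀ I, i.ker = I → Smooth (I.subschemeι ≫ f) := by
    rintro _ rfl
    have e : i.imageι ≫ f = inv i.toImage ≫ i ≫ f := by
      rw [IsIso.eq_inv_comp, ← Category.assoc, i.toImage_imageι]
    change Smooth (i.imageι ≫ f)
    rw [e]
    infer_instance
  exact hker _ rfl

lemma isIso_Spec_map_algebraMap {R : Type u} [CommRing R] [Algebra k R] (e : R →ₐ[k] k)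
    (I : Ideal R) (hI : I ≠ ⊤) (h : ∀ a, a - algebraMap k R (e a) ∈ I) :
    IsIso (Spec.map (CommRingCat.ofHom (algebraMap k (R ⧸ I)))) := by
  have : Nontrivial (R ⧸ I) := Ideal.Quotient.nontrivial_iff.mpr hI
  have : IsIso (CommRingCat.ofHom (algebraMap k (R ⧸ I))) := by
    refine (ConcreteCategory.isIso_iff_bijective _).mpr
      ⟨(algebraMap k (R ⧸ I)).injective, fun a => ?_⟩
    obtain ⟨a, rfl⟩ := Ideal.Quotient.mk_surjective a
    exact ⟨e a, (Ideal.Quotient.eq.mpr (h a)).symm⟩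
  infer_instance

theorem IsCopy.comap_centre {P : Pair k} {c : X k ⟶ P.X} {α : ℚ} (h : IsCopy P c α)
    {C : P.X.IdealSheafData} (hC : IsPermissibleCentre Pair.IsSncAt P C) :
    C.comap c = ⊤ ∨ C.comap c = sheafOf (originIdealX k) := by
  have := h.isOpenImmersion
  obtain ⟨J, hJ⟩ : ∃ J, J = idealOf (C.comap c) := ⟨_, rfl⟩
  have hJ' : C.comap c = sheafOf J := by rw [hJ, sheafOf_idealOf]
  obtain ⟨v, hv, hvc, -⟩ := exists_openImmersion_subscheme C c hJ'
  have hsm := hC.1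
  have e : v ≫ C.subschemeι ≫ P.str =
      Spec.map (CommRingCat.ofHom (algebraMap k (RX k ⧸ J))) := by
    rw [reassoc_of% hvc, h.comp_str, mk_comp_strX]
  have hsmooth : Smooth (v ≫ C.subschemeι ≫ P.str) := inferInstance
  rw [e] at hsmooth
  rw [hJ', ← sheafOf_top]
  refine (eq_top_or_eq_origin hsmooth fun q hq => ?_).imp (congrArg _) (congrArg _)
  rw [← originIdealX_le_iff]
  by_contra hq'
  refine hC.2 (c q) ?_ (h.isSncAt q hq')
  rw [← mem_support_comap C c q, hJ', mem_support_sheafOf]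
  exact hq

theorem IsCopy.of_isPermissibleTransform {P P' : Pair k} {c : X k ⟶ P.X} {α : ℚ}
    (h : IsCopy P c α) (hP : IsPermissibleTransform Pair.IsSncAt P P') :
    ∃ (c' : X k ⟶ P'.X) (α' : ℚ), IsCopy P' c' α' := by
  obtain ⟨C, σ, hC, hσ, hstr, hD⟩ := hP
  have := h.isOpenImmersion
  rcases h.comap_centre hC with h0 | h0
  · obtain ⟨c', hc', e⟩ := (isBlowupChart_top (RX k)).exists_openImmersion hσ c
      (by rw [h0, sheafOf_top])
    rw [CommRingCat.ofHom_id, Spec.map_id, Category.id_comp] at e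
    exact ⟨c', α, h.transform_top h0 hstr hD c' e⟩
  · obtain ⟨c', hc', e⟩ := isBlowupChart_X.exists_openImmersion hσ c h0
    exact ⟨c', 1, h.transform_origin h0 hstr hD c' e⟩

/-- The singularity at the origin of `X` cannot be resolved by permissible blowings-up. -/
theorem not_isResolvable : ¬ IsResolvable Pair.IsSncAt (pairX k) := by
  rintro ⟨P', hP', hgood⟩
  have : ∃ (c' : X k ⟶ P'.X) (α' : ℚ), IsCopy P' c' α' := by
    clear hgood
    induction hP' with
    | refl => exact ⟨𝟙 _, 0, isCopy_pairX⟩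
    | tail _ hstep ih =>
      obtain ⟨c, α, h⟩ := ih
      exact h.of_isPermissibleTransform hstep
  obtain ⟨c', α', h⟩ := this
  have := h.isOpenImmersion
  exact not_isSncAt_origin P' c' (hgood _)

theorem isSncAt_pairX_iff (a : (pairX k).X) :
    (pairX k).IsSncAt a ↔ a ∉ (sheafOf (originIdealX k)).support := by
  have h := isCopy_pairX (k := k)
  have := h.isOpenImmersion
  have hsupp : a ∈ (sheafOf (originIdealX k)).support ↔ originIdealX k ≤ (show X k from a).asIdeal :=
    mem_support_sheafOf _ _
  rw [hsupp]
  constructor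
  · intro ha ha'
    have e : a = origin k := (originIdealX_le_iff a).mp ha'
    subst e
    exact not_isSncAt_origin (pairX k) (𝟙 (X k)) ha
  · exact fun ha => h.isSncAt a ha

theorem isPermissibleCentre_iff (C : (X k).IdealSheafData) :
    IsPermissibleCentre Pair.IsSncAt (pairX k) C ↔
      C = ⊤ ∨ C = sheafOf (originIdealX k) := by
  constructor
  · intro hC
    have := (isCopy_pairX (k := k)).comap_centre hC
    have e : C.comap (𝟙 (X k)) = C := Scheme.IdealSheafData.comap_id C
    rwa [← e]
  · rintro (rfl | rfl)
    · refine ⟨?_, fun a ha => ?_⟩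
      · have : IsEmpty (⊤ : (X k).IdealSheafData).subscheme := inferInstance
        change Smooth ((⊤ : (X k).IdealSheafData).subschemeι ≫ strX k)
        infer_instance
      · have e : (⊤ : (X k).IdealSheafData).support = ⊥ := Scheme.IdealSheafData.support_top
        have ha' : (show X k from a) ∈ (⊥ : Closeds (X k)) := by rw [← e]; exact ha
        exact absurd ha' (Set.notMem_empty (show X k from a))
    · refine ⟨?_, fun a ha h => (isSncAt_pairX_iff a).mp h ha⟩
      refine smooth_subschemeι_sheafOf (originIdealX k) (strX k) ?_
      rw [mk_comp_strX]
      have := isIso_Spec_map_algebraMap (evalX k) (originIdealX k) Ideal.IsPrime.ne_top'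
        sub_evalX_mem
      infer_instance

end Centres

section Main

variable {k : Type u} [Field k]

/-! ### The blowing-up of the origin of `𝔸⁴` -/

lemma isRadical_idealX : (idealX k).IsRadical := by
  rw [idealX_eq]
  exact ((isPlane₁ k).isPrime.isRadical.inf (isPlane₂ k).isPrime.isRadical).inf
    (isPlane₃ k).isPrime.isRadical

lemma map_chartHom_mem_iff {q : Ideal (A k)} [hq : q.IsPrime] (hw : w k ∉ q) :
    (idealX k).map (chartHom k).toRingHom ≤ q ↔ idealX k ≤ q := by
  have hpow : ∀ {n : ℕ} {a b : A k}, chartHom k a = w k ^ n * b → (chartHom k a ∈ q ↔ b ∈ q) :=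
    fun {n a b} e => by
      rw [e]
      exact ⟨fun h => (hq.mem_or_mem h).resolve_left fun h' => hw (hq.mem_of_pow_mem n h'),
        fun h => Ideal.mul_mem_left _ _ h⟩
  have h : ∀ g ∈ equationsX k, chartHom k g ∈ q ↔ g ∈ q := by
    rintro _ (rfl | rfl | rfl | rfl)
    · exact hpow (n := 2)
        (by simp only [map_sub, map_mul, chartHom_w, chartHom_x, chartHom_y, chartHom_z]; ring)
    · exact hpow (n := 2)
        (by simp only [map_add, map_mul, chartHom_w, chartHom_x, chartHom_z]; ring)
    · exact hpow (n := 2)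
        (by simp only [map_add, map_mul, chartHom_x, chartHom_y, chartHom_z]; ring)
    · exact hpow (n := 3) (by simp only [map_add, map_mul, chartHom_x, chartHom_y]; ring)
  rw [Ideal.map_le_iff_le_comap, span_equationsX, Ideal.span_le, Ideal.span_le]
  exact ⟨fun H g hg => (h g hg).mp (H hg), fun H g hg => (h g hg).mpr (H hg)⟩

lemma IsComponent.w_notMem {P : Ideal (A k)} {f f' : A k} {ρ : A k →ₐ[k] M k}
    (h : IsComponent P f f' ρ) : w k ∉ P := by
  rw [h.isPlane.mem_iff, h.isPlane.map_w]
  exact vv_ne_zero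

lemma closure_diff_eq :
    closure {q : A4 k | idealX k ≤ q.asIdeal ∧ w k ∉ q.asIdeal} =
      {q : A4 k | idealX k ≤ q.asIdeal} := by
  refine Set.Subset.antisymm ?_ fun q hq => ?_
  · have hcl : IsClosed {q : A4 k | idealX k ≤ q.asIdeal} :=
      PrimeSpectrum.isClosed_zeroLocus (idealX k : Set (A k))
    exact closure_minimal (fun q hq => hq.1) hcl
  have key : ∀ {P : Ideal (A k)} {f f' : A k} {ρ : A k →ₐ[k] M k}, IsComponent P f f' ρ →
      P ≤ q.asIdeal → q ∈ closure {q : A4 k | idealX k ≤ q.asIdeal ∧ w k ∉ q.asIdeal} := by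
    intro P f f' ρ h hP
    let p : A4 k := (⟨P, h.isPlane.isPrime⟩ : PrimeSpectrum (A k))
    have hs : p ⤳ q := (PrimeSpectrum.le_iff_specializes p q).mp hP
    exact hs.mem_closed isClosed_closure (subset_closure ⟨h.idealX_le, h.w_notMem⟩)
  have hqp : q.asIdeal.IsPrime := q.isPrime
  have hq' : idealX k ≤ q.asIdeal := hq
  rw [idealX_eq, hqp.inf_le, hqp.inf_le] at hq'
  rcases hq' with (h | h) | h
  exacts [key isComponent₁ h, key isComponent₂ h, key isComponent₃ h]

lemma isRadical_of_comap_vanishingIdeal {B : Scheme.{u}} (Z : Closeds B) {R : Type u} [CommRing R]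
    (c : Spec (CommRingCat.of R) ⟶ B) [IsOpenImmersion c] {K : Ideal R}
    (hK : (Scheme.IdealSheafData.vanishingIdeal Z).comap c = sheafOf K) : K.IsRadical := by
  have hU : IsAffineOpen c.opensRange := isAffineOpen_opensRange c
  let e := IsOpenImmersion.isoOfRangeEq c hU.fromSpec (by rw [hU.range_fromSpec]; rfl)
  have he : e.hom ≫ hU.fromSpec = c := IsOpenImmersion.isoOfRangeEq_hom_fac _ _ _
  obtain ⟨ψ, hψ⟩ : ∃ ψ : Γ(B, c.opensRange) →+* R, Spec.map (CommRingCat.ofHom ψ) = e.hom :=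
    ⟨(Spec.preimage e.hom).hom, Spec.map_preimage e.hom⟩
  have hbij : Function.Bijective ψ := by
    have : IsIso (Spec.map (CommRingCat.ofHom ψ)) := by rw [hψ]; infer_instance
    exact isIso_SpecMap_iff.mp this
  obtain ⟨V, hV⟩ : ∃ V, V = idealOf ((Scheme.IdealSheafData.vanishingIdeal Z).comap hU.fromSpec) :=
    ⟨_, rfl⟩
  have hVrad : V.IsRadical := by
    rw [hV, idealOf_comap_fromSpec]
    exact PrimeSpectrum.isRadical_vanishingIdeal _
  have hKV : K = V.map ψ := by
    rw [← he, Scheme.IdealSheafData.comap_comp, ← hψ, ← sheafOf_idealOf (Scheme.IdealSheafData.comap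
      _ hU.fromSpec), ← hV] at hK
    erw [comap_sheafOf] at hK
    rw [← idealOf_sheafOf K, ← hK, idealOf_sheafOf]
  rw [hKV]
  rintro a ⟨n, hn⟩
  obtain ⟨a, rfl⟩ := hbij.2 a
  rw [← map_pow, Ideal.mem_map_iff_of_surjective ψ hbij.2] at hn
  obtain ⟨v, hv, hva⟩ := hn
  exact Ideal.mem_map_of_mem ψ (hVrad ⟨n, hbij.1 hva ▸ hv⟩)

/-- The strict transform of `X` in the `w`-chart is given by the equations of `X`. -/
theorem comap_strictTransform {B : Scheme.{u}} (π : B ⟶ A4 k) (c : A4 k ⟶ B) [IsOpenImmersion c]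
    (hc : c ≫ π = chartA4 k) : (strictTransform k π).comap c = sheafOf (idealX k) := by
  obtain ⟨K, hK⟩ : ∃ K, K = idealOf ((strictTransform k π).comap c) := ⟨_, rfl⟩
  have hK' : (strictTransform k π).comap c = sheafOf K := by rw [hK, sheafOf_idealOf]
  have hrad : K.IsRadical := isRadical_of_comap_vanishingIdeal _ c hK'
  have hsupp : ∀ q : A4 k, K ≤ q.asIdeal ↔ idealX k ≤ q.asIdeal := by
    intro q
    have e : c ⁻¹' closure (π ⁻¹' (((sheafOf (idealX k)).support : Set (A4 k)) \
        ((sheafOf (originIdealA4 k)).support : Set (A4 k)))) =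
        {q : A4 k | idealX k ≤ q.asIdeal} := by
      rw [c.isOpenEmbedding.isOpenMap.preimage_closure_eq_closure_preimage c.continuous,
        ← closure_diff_eq]
      congr 1
      ext q
      have hq : π (c q) = chartA4 k q := congrArg (fun f : A4 k ⟶ A4 k => f q) hc
      have h1 : π (c q) ∈ (sheafOf (originIdealA4 k)).support ↔ w k ∈ q.asIdeal := by
        rw [hq, mem_support_sheafOf]
        change originIdealA4 k ≤ q.asIdeal.comap (chartHom k).toRingHom ↔ _
        rw [← Ideal.map_le_iff_le_comap, (isBlowupChart_A4.generates (w k) rfl).2,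
          Ideal.span_singleton_le_iff_mem]
        change chartHom k (w k) ∈ _ ↔ _
        rw [chartHom_w]
      have h2 : π (c q) ∈ (sheafOf (idealX k)).support ↔
          (idealX k).map (chartHom k).toRingHom ≤ q.asIdeal := by
        rw [hq, mem_support_sheafOf, Ideal.map_le_iff_le_comap]
        rfl
      change (π (c q) ∈ (sheafOf (idealX k)).support ∧
        ¬ π (c q) ∈ (sheafOf (originIdealA4 k)).support) ↔ _ ∧ _
      rw [h1, h2]
      have := q.isPrime
      exact and_congr_left fun hw => map_chartHom_mem_iff hw
    have h3 : q ∈ ((strictTransform k π).comap c).support ↔ idealX k ≤ q.asIdeal := by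
      rw [mem_support_comap, ← SetLike.mem_coe, strictTransform,
        Scheme.IdealSheafData.coe_support_vanishingIdeal]
      exact Set.ext_iff.mp e q
    rw [← h3, hK', mem_support_sheafOf]
  rw [hK']
  congr 1
  rw [← hrad.radical, ← (isRadical_idealX (k := k)).radical, Ideal.radical_eq_sInf,
    Ideal.radical_eq_sInf]
  congr 1
  ext p
  exact and_congr_left fun hp => hsupp (⟨p, hp⟩ : PrimeSpectrum (A k))

theorem exists_chart_A4 {B : Scheme.{u}} (π : B ⟶ A4 k)
    (hπ : IsBlowup (sheafOf (originIdealA4 k)) π) :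
    ∃ c : A4 k ⟶ B, IsOpenImmersion c ∧ c ≫ π = chartA4 k ∧
      (strictTransform k π).comap c = sheafOf (idealX k) ∧
      ((sheafOf (originIdealA4 k)).comap π).comap c = sheafOf (Ideal.span {w k}) := by
  obtain ⟨c, hc, hcπ, -⟩ := isBlowupChart_A4.exists_openImmersion_of_Spec hπ
  refine ⟨c, hc, hcπ, comap_strictTransform π c hcπ, ?_⟩
  rw [← Scheme.IdealSheafData.comap_comp, hcπ, comap_sheafOf,
    (isBlowupChart_A4.generates (w k) rfl).2]
  congr 3
  exact chartHom_w

/-! ### The blowing-up of the origin of `X` -/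

variable (k) in
/-- The transform of `(X, 0)` by a blowing-up of the origin. -/
def pairX' {X' : Scheme.{u}} (σ : X' ⟶ X k) : Pair k :=
  ⟨X', σ ≫ strX k, transform (sheafOf (originIdealX k)) σ fun _ => 0⟩

/-- The transform of `(X, 0)` is snc in the charts in which `w` does not generate the ideal of the
exceptional divisor. -/
theorem IsComponent.isSncAt {P : Ideal (A k)} {f f' : A k} {ρ : A k →ₐ[k] M k}
    (h : IsComponent P f f' ρ) {X' : Scheme.{u}} {σ : X' ⟶ X k}
    (hσ : IsBlowup (sheafOf (originIdealX k)) σ) {b : X'}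
    (hb : ∀ g ∈ ({mkX k f, mkX k f'} : Set (RX k)), GeneratesAt σ (originIdealX k) g b) :
    (pairX' k σ).IsSncAt b := by
  obtain ⟨c, hc, hcσ, hrange⟩ := h.isBlowupChart.exists_openImmersion_of_Spec hσ
  obtain ⟨b, rfl⟩ := hrange b hb
  have hmap : (originIdealX k).map ((tau k).comp h.res).toRingHom = Ideal.span {vv k} := by
    rw [(h.isBlowupChart.generates _ (Set.mem_insert _ _)).2]
    congr 2
    change tau k (ρ f) = _
    rw [h.isPlane.map_f, tau_uu]
  have hK : ((sheafOf (originIdealX k)).comap σ).comap c = sheafOf (Ideal.span {vv k}) := by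
    rw [← Scheme.IdealSheafData.comap_comp, hcσ, comap_sheafOf, hmap]
  have : IsOpenImmersion (Y := (pairX' k σ).X) c := hc
  refine isSncAt_plane (pairX' k σ) c (𝟙 (Spec (CommRingCat.of (M k)))) ?_ 1 (fun b => ?_) b
  · change _ = c ≫ σ ≫ strX k
    rw [reassoc_of% hcσ, Category.id_comp, strX, ← Spec.map_comp, ← CommRingCat.ofHom_comp]
    congr 2
    exact ((tau k).comp h.res).comp_algebraMap.symm
  · change transform (sheafOf (originIdealX k)) σ (fun _ => 0) (c b) = if b.asIdeal = _ then 1 else 0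
    have hsupp : σ (c b) ∈ (sheafOf (originIdealX k)).support ↔ vv k ∈ b.asIdeal := by
      rw [← mem_support_comap _ σ, ← mem_support_comap _ c, hK, mem_support_sheafOf,
        Ideal.span_singleton_le_iff_mem]
    by_cases hv : vv k ∈ b.asIdeal
    · rw [transform, if_pos (hsupp.mpr hv)]
      exact exceptionalCoeff_eq c hK b
    · rw [transform, if_neg (hsupp.not.mpr hv), if_neg]
      exact fun e => hv (e ▸ Ideal.mem_span_singleton_self _)

theorem exists_chart_X {X' : Scheme.{u}} (σ : X' ⟶ X k)
    (hσ : IsBlowup (sheafOf (originIdealX k)) σ) :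
    ∃ c : X k ⟶ X', IsOpenImmersion c ∧ c ≫ σ = chartX k ∧
      ((sheafOf (originIdealX k)).comap σ).comap c = sheafOf (Ideal.span {mkX k (w k)}) ∧
      ∀ b : X', (pairX' k σ).IsSncAt b ↔
        b ∉ c '' ((sheafOf (originIdealX k)).support : Set (X k)) := by
  obtain ⟨c, hc, hcσ, hrange⟩ := isBlowupChart_X.exists_openImmersion_of_Spec hσ
  replace hcσ : c ≫ σ = chartX k := hcσ
  have : IsOpenImmersion (Y := (pairX' k σ).X) c := hc
  have hcopy : IsCopy (pairX' k σ) c 1 := by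
    refine (isCopy_pairX (k := k)).transform_origin (P' := pairX' k σ)
      (C := sheafOf (originIdealX k)) (σ := σ) ?_ rfl rfl c ?_
    · exact Scheme.IdealSheafData.comap_id _
    · exact hcσ.trans (Category.comp_id (chartX k)).symm
  refine ⟨c, hc, hcσ, ?_, fun b => ⟨?_, fun hb => ?_⟩⟩
  · rw [← Scheme.IdealSheafData.comap_comp, hcσ, comap_origin_chartX]
  · rintro h ⟨q, hq, rfl⟩
    have hq' : q = origin k := (originIdealX_le_iff q).mp ((mem_support_sheafOf _ q).mp hq)
    subst hq'
    exact not_isSncAt_origin (pairX' k σ) c h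
  · obtain ⟨s, hs, hJ⟩ := exists_generator_stalk hσ.invertible b
    rcases exists_generates (germHom σ b) hs hJ with h | ⟨h, h'⟩ | ⟨h, h'⟩ | ⟨h, h'⟩
    · obtain ⟨q, rfl⟩ := hrange b (by rintro _ rfl; exact h)
      refine hcopy.isSncAt q fun hq => hb ⟨q, (mem_support_sheafOf _ q).mpr hq, rfl⟩
    · exact isComponent₁.isSncAt hσ (by rintro _ (rfl | rfl); exacts [h, h'])
    · exact isComponent₂.isSncAt hσ (by rintro _ (rfl | rfl); exacts [h, h'])
    · exact isComponent₃.isSncAt hσ (by rintro _ (rfl | rfl); exacts [h, h'])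

/-! ### The desingularization theorem fails -/

lemma isVariety_strX : IsVariety (strX k) where
  reduced := by
    have : _root_.IsReduced (RX k) := (Ideal.isRadical_iff_quotient_reduced _).mp isRadical_idealX
    exact inferInstanceAs (IsReduced (Spec (CommRingCat.of (RX k))))
  separated := inferInstanceAs (IsSeparated (Spec.map _))
  locallyOfFiniteType := by
    rw [strX, HasRingHomProperty.Spec_iff (P := @LocallyOfFiniteType)]
    exact RingHom.finiteType_algebraMap.mpr (inferInstanceAs (Algebra.FiniteType k (RX k)))
  quasiCompact := inferInstanceAs (QuasiCompact (Spec.map _))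

lemma isQWeilDivisor_zero (Y : Scheme.{u}) : IsQWeilDivisor Y fun _ => 0 :=
  ⟨by simp, fun _ h => absurd rfl h⟩

theorem not_desingularizationTheorem : ¬ DesingularizationTheorem k Pair.IsSncAt := fun h =>
  not_isResolvable (h (pairX k) isVariety_strX (isQWeilDivisor_zero _))

end Main

end SncBlowup

end

theorem mainTheorem10 (k : Type u) [Field k] [CharZero k] :
    -- `X` is snc exactly at the points other than the origin
    (∀ a : (SncBlowup.pairX k).X, (SncBlowup.pairX k).IsSncAt a ↔
      a ∉ (SncBlowup.sheafOf (SncBlowup.originIdealX k)).support) ∧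
    -- the only (nonempty) permissible centre is the origin
    (∀ C : (SncBlowup.X k).IdealSheafData,
      SncBlowup.IsPermissibleCentre SncBlowup.Pair.IsSncAt (SncBlowup.pairX k) C ↔
        C = ⊤ ∨ C = SncBlowup.sheafOf (SncBlowup.originIdealX k)) ∧
    -- in the `w`-chart of the blowing-up of the origin of `𝔸⁴`, the strict transform of `X` is
    -- given by the same equations as `X`, and the exceptional divisor is `(w = 0)`
    (∀ (B : Scheme.{u}) (π : B ⟶ SncBlowup.A4 k),
      SncBlowup.IsBlowup (SncBlowup.sheafOf (SncBlowup.originIdealA4 k)) π →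
      ∃ c : SncBlowup.A4 k ⟶ B, IsOpenImmersion c ∧ c ≫ π = SncBlowup.chartA4 k ∧
        (SncBlowup.strictTransform k π).comap c = SncBlowup.sheafOf (SncBlowup.idealX k) ∧
        ((SncBlowup.sheafOf (SncBlowup.originIdealA4 k)).comap π).comap c =
          SncBlowup.sheafOf (Ideal.span {SncBlowup.w k})) ∧
    -- the `w`-chart of the blowing-up `X'` of the origin of `X` is a copy of `X`, with exceptional
    -- divisor `D' = (w = 0)`, and `(X', D')` is snc exactly at the points other than the origin of
    -- this chart
    (∀ (X' : Scheme.{u}) (σ : X' ⟶ SncBlowup.X k),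
      SncBlowup.IsBlowup (SncBlowup.sheafOf (SncBlowup.originIdealX k)) σ →
      ∃ c : SncBlowup.X k ⟶ X', IsOpenImmersion c ∧ c ≫ σ = SncBlowup.chartX k ∧
        ((SncBlowup.sheafOf (SncBlowup.originIdealX k)).comap σ).comap c =
          SncBlowup.sheafOf
            (Ideal.span {Ideal.Quotient.mk (SncBlowup.idealX k) (SncBlowup.w k)}) ∧
        ∀ b : X', SncBlowup.Pair.IsSncAt
            ⟨X', σ ≫ SncBlowup.strX k,
              SncBlowup.transform (SncBlowup.sheafOf (SncBlowup.originIdealX k)) σ fun _ => 0⟩ b ↔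
          b ∉ c '' ((SncBlowup.sheafOf (SncBlowup.originIdealX k)).support :
            Set (SncBlowup.X k))) ∧
    -- the pair `(X, 0)` cannot be made snc by blowing up only non-snc points
    ¬ SncBlowup.IsResolvable SncBlowup.Pair.IsSncAt (SncBlowup.pairX k) ∧
    -- hence the desingularization theorem fails for snc
    ¬ SncBlowup.DesingularizationTheorem k SncBlowup.Pair.IsSncAt := by
  exact ⟨SncBlowup.isSncAt_pairX_iff, SncBlowup.isPermissibleCentre_iff,
    fun _ => SncBlowup.exists_chart_A4, fun _ => SncBlowup.exists_chart_X,
    SncBlowup.not_isResolvable, SncBlowup.not_desingularizationTheorem⟩
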